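/- Let $n\ge 0$ and let $K^{X_n}_{\lambda,\mu}(q)=\sum_{\sigma\in W}(-1)^{\ell(\sigma)}\mathcal P_q(\sigma(\lambda+\rho)-(\mu+\rho))$ be the Kostka--Foulkes polynomial (Lusztig $q$-weight multiplicity) of the root system $X_n=B_n,C_n,D_n$, where $W$ is the Weyl group, $\ell$ its length function, $\rho$ the half sum of the positive roots, and $\mathcal P_q(\beta)$ the coefficient of $x^\beta$ in $\prod_{\alpha>0}(1-qx^\alpha)^{-1}$. Weights are written in the usual orthonormal coordinates (positive roots $\varepsilon_i\pm\varepsilon_j$ for $i<j$, together with $\varepsilon_i$ in type $B$ and $2\varepsilon_i$ in type $C$), and a partition with at most $n$ parts is a dominant weight after completion by zeros. For all partitions $\lambda,\mu$ with at most $n$ parts, $|\lambda|\le 3$ and $|\mu|\le 2$, the polynomial $K^{X_n}_{\lambda,\mu}(q)$ is the entry in row $\mu$ and column $\lambda$ of the following matrices. Type $B_n$: $$\begin{array}{c|ccccccc} & (3) & (2,1) & (1,1,1) & (2) & (1,1) & (1) & \emptyset\\\hline (2) & q^n & q^{n-1} & 0 & 1 & 0 & 0 & 0\\ (1,1) & q^{n+1}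 & q^n+q^{n-1} & q^{n-2} & q & 1 & 0 & 0\\ (1) & q^2\frac{q^{2n}-1}{q^2-1} & q\frac{q^{2n-1}-1}{q-1} & q\frac{q^{2n-2}-1}{q^2-1} & q^n & q^{n-1} & 1 & 0\\ \emptyset & q^{n+2}\frac{q^{2n}-1}{q^2-1} & q^{n+1}\frac{q^{2n-1}-1}{q-1} & q^{n-1}\frac{q^{2n}-1}{q^2-1} & q^2\frac{q^{2n}-1}{q^2-1} & q\frac{q^{2n}-1}{q^2-1} & q^n & 1 \end{array}$$ Type $C_n$: $$\begin{array}{c|ccccccc} & (3) & (2,1) & (1,1,1) & (2) & (1,1) & (1) & \emptyset\\\hline (2) & 0 & 0 & 0 & 1 & 0 & 0 & 0\\ (1,1) & 0 & 0 & 0 & q & 1 & 0 & 0\\ (1) & q\frac{q^{2n}-1}{q^2-1} & q\frac{q^{2n-2}-1}{q-1} & q^2\frac{q^{2n-4}-1}{q^2-1} & 0 & 0 & 1 & 0\\ \emptyset & 0 & 0 & 0 & q\frac{q^{2n}-1}{q^2-1} & q^2\frac{q^{2n-2}-1}{q^2-1} & 0 & 1 \end{array}$$ Type $D_n$, $n\ge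 2$: $$\begin{array}{c|ccccccc} & (3) & (2,1) & (1,1,1) & (2) & (1,1) & (1) & \emptyset\\\hline (2) & 0 & 0 & 0 & 1 & 0 & 0 & 0\\ (1,1) & 0 & 0 & 0 & q & 1 & 0 & 0\\ (1) & q^2\frac{q^{2n-2}-1}{q^2-1} & q^{n-1}+q\frac{q^{2n-3}-1}{q-1} & q^{n-2}+q\frac{q^{2n-4}-1}{q^2-1} & 0 & 0 & 1 & 0\\ \emptyset & 0 & 0 & 0 & q^2\frac{q^{2n-2}-1}{q^2-1} & q^{n-1}+q\frac{q^{2n-2}-1}{q^2-1} & 0 & 1 \end{array}$$ except that, in type $D_n$, when $\lambda$ has exactly $n$ nonzero parts and $|\lambda|=|\mu|+2$ (that is, $n=2$ with $(\lambda,\mu)=((2,1),(1))$ or $((1,1),\emptyset)$, or $n=3$ with $(\lambda,\mu)=((1,1,1),(1))$), one has $K^{D_n}_{\lambda,\mu}(q)=q$ instead of the tabulated $2q$. -/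

import Mathlib

open Polynomial

namespace KostkaFoulkes

/-- The three families of classical root systems, of rank `n`. -/
inductive ClassicalType
  | B
  | C
  | D

/-- The standard basis vector `ε` at position `i`. Vectors of `ℚ ^ n` are written with the largest
coordinate of a dominant weight first: position `i` (counted from `0`) carries the coordinate that
is labelled by the barred letter `n - i`. -/
def stdVec (n : ℕ) (i : Fin n) : Fin n → ℚ := Pi.single i 1

/-- The positive roots: `ε i - ε j` and `ε i + ε j` for `i < j`, together with `ε i` in type `B`
and `2 ε i` in type `C`. -/
def posRoots (t : ClassicalType) (n : ℕ) : Finset (Fin n → ℚ) :=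
  (Finset.univ.filter fun p : Fin n × Fin n => p.1 < p.2).image
      (fun p => stdVec n p.1 - stdVec n p.2) ∪
    (Finset.univ.filter fun p : Fin n × Fin n => p.1 < p.2).image
      (fun p => stdVec n p.1 + stdVec n p.2) ∪
    match t with
    | .B => Finset.univ.image fun i => stdVec n i
    | .C => Finset.univ.image fun i => (2 : ℚ) • stdVec n i
    | .D => ∅

/-- The half sum of the positive roots. -/
noncomputable def rho (t : ClassicalType) (n : ℕ) : Fin n → ℚ :=
  (1 / 2 : ℚ) • ∑ α ∈ posRoots t n, α

/-- The `2 n` letters permuted by the Weyl group: `(i, 1)` is the (barred) letter attached to the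
coordinate `i`, and `(i, -1)` is the opposite letter. -/
abbrev Letter (n : ℕ) : Type := Fin n × ℤˣ

/-- The Coxeter generators of the Weyl group, as permutations of the letters: the exchanges of
neighbouring coordinates, and in types `B`, `C` the sign change of the last coordinate, in type `D`
the exchange of the last two coordinates combined with a change of both signs. -/
def simpleGens : ClassicalType → (n : ℕ) → Set (Equiv.Perm (Letter n))
  | .B, n | .C, n =>
    {s | ∃ i j : Fin n, (j : ℕ) = i + 1 ∧
        s = Equiv.swap (i, 1) (j, 1) * Equiv.swap (i, -1) (j, -1)} ∪
      {s | ∃ i : Fin n, (i : ℕ) + 1 = n ∧ s = Equiv.swap (i, 1) (i, -1)}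
  | .D, n =>
    {s | ∃ i j : Fin n, (j : ℕ) = i + 1 ∧
        s = Equiv.swap (i, 1) (j, 1) * Equiv.swap (i, -1) (j, -1)} ∪
      {s | ∃ i j : Fin n, (j : ℕ) = i + 1 ∧ (j : ℕ) + 1 = n ∧
        s = Equiv.swap (i, 1) (j, -1) * Equiv.swap (i, -1) (j, 1)}

/-- The Weyl group. -/
def weylGroup (t : ClassicalType) (n : ℕ) : Subgroup (Equiv.Perm (Letter n)) :=
  Subgroup.closure (simpleGens t n)

/-- The length of `σ`: the least number of factors in an expression of `σ` as a product of
generators. (Each generator is an involution, so no inverses are needed.) -/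
noncomputable def weylLength (t : ClassicalType) (n : ℕ) (σ : Equiv.Perm (Letter n)) : ℕ :=
  sInf {k | ∃ w : List (Equiv.Perm (Letter n)),
    w.length = k ∧ (∀ s ∈ w, s ∈ simpleGens t n) ∧ w.prod = σ}

/-- The action of `σ` on vectors: the coordinate `i` of `σ · β` is `β k` if `σ (i, 1) = (k, 1)`
and `- β k` if `σ (i, 1) = (k, -1)`. -/
def weylAct {n : ℕ} (σ : Equiv.Perm (Letter n)) (β : Fin n → ℚ) : Fin n → ℚ :=
  fun i => (((σ (i, 1)).2 : ℤ) : ℚ) * β (σ (i, 1)).1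

/-- The ways of writing `β` as a sum of positive roots: `m α` is the multiplicity of `α`. -/
def rootDecomps (t : ClassicalType) (n : ℕ) (β : Fin n → ℚ) : Set (posRoots t n → ℕ) :=
  {m | ∑ α, m α • (α : Fin n → ℚ) = β}

/-- Every vector has finitely many decompositions, because the linear form
`∑ i, (n - i) x i` takes values at least `1` on the positive roots. -/
theorem rootDecomps_finite (t : ClassicalType) (n : ℕ) (β : Fin n → ℚ) :
    (rootDecomps t n β).Finite := by
  let h : (Fin n → ℚ) →ₗ[ℚ] ℚ := ∑ i : Fin n, ((n : ℚ) - i) • LinearMap.proj i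
  have hs : ∀ i, h (stdVec n i) = (n : ℚ) - i := by
    intro i
    simp [h, stdVec, Pi.single_apply]
  have hp : ∀ i : Fin n, (1 : ℚ) ≤ (n : ℚ) - i := by
    intro i
    have : ((i : ℕ) : ℚ) + 1 ≤ n := by exact_mod_cast i.2
    linarith
  have h1 : ∀ α ∈ posRoots t n, 1 ≤ h α := by
    intro α hα
    simp only [posRoots, Finset.mem_union, Finset.mem_image, Finset.mem_filter,
      Finset.mem_univ, true_and] at hα
    rcases hα with (⟨p, hlt, rfl⟩ | ⟨p, hlt, rfl⟩) | hα
    · rw [map_sub, hs, hs]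
      have : ((p.1 : ℕ) : ℚ) + 1 ≤ (p.2 : ℕ) := by exact_mod_cast hlt
      linarith
    · rw [map_add, hs, hs]
      linarith [hp p.1, hp p.2]
    · cases t <;> simp at hα
      · obtain ⟨i, rfl⟩ := hα
        rw [hs]; exact hp i
      · obtain ⟨i, rfl⟩ := hα
        rw [map_smul, hs, smul_eq_mul]
        linarith [hp i]
  refine (Set.finite_Iic (fun _ : posRoots t n => ⌈h β⌉₊)).subset ?_
  intro m hm α
  have e : h β = ∑ α, (m α : ℚ) * h α := by
    rw [← (hm : ∑ α, m α • (α : Fin n → ℚ) = β), map_sum]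
    exact Finset.sum_congr rfl fun a _ => by rw [map_nsmul, nsmul_eq_mul]
  have g : (m α : ℚ) ≤ h β := by
    rw [e]
    calc (m α : ℚ) ≤ (m α : ℚ) * h α :=
          le_mul_of_one_le_right (Nat.cast_nonneg _) (h1 _ α.2)
      _ ≤ _ := Finset.single_le_sum (f := fun α : posRoots t n => (m α : ℚ) * h α)
          (fun a _ => mul_nonneg (Nat.cast_nonneg _) (zero_le_one.trans (h1 _ a.2)))
          (Finset.mem_univ α)
  exact_mod_cast g.trans (Nat.le_ceil _)

/-- The `q`-analogue of Kostant's partition function, i.e. the coefficient of `x ^ β` in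
`∏ α, 1 / (1 - q x ^ α)`, the product over the positive roots: each decomposition of `β` as a sum
of positive roots contributes `q` to the number of its summands. -/
noncomputable def kostantQ (t : ClassicalType) (n : ℕ) (β : Fin n → ℚ) : ℤ[X] :=
  ∑ m ∈ (rootDecomps_finite t n β).toFinset, X ^ (∑ α, m α)

/-- The Kostka-Foulkes polynomial `K_{lam, mu}(q)`. -/
noncomputable def kostkaFoulkes (t : ClassicalType) (n : ℕ) (lam mu : Fin n → ℚ) : ℤ[X] :=
  ∑ σ ∈ (Set.toFinite (weylGroup t n : Set (Equiv.Perm (Letter n)))).toFinset,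
    (-1) ^ weylLength t n σ *
      kostantQ t n (weylAct σ (lam + rho t n) - (mu + rho t n))

/-- The weight of a partition (the list of its nonzero parts), completed by zeros. -/
def weightOf (n : ℕ) (p : List ℕ) : Fin n → ℚ := fun i => (p.getD i 0 : ℕ)

/-- The entry `K_{lam, mu}(q)` for partitions, viewed in the field of fractions of `ℤ[q]`. -/
noncomputable def entry (t : ClassicalType) (n : ℕ) (lam mu : List ℕ) : RatFunc ℤ :=
  algebraMap ℤ[X] (RatFunc ℤ) (kostkaFoulkes t n (weightOf n lam) (weightOf n mu))

/-- The columns of the tables: all partitions of size at most `3`. -/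
def colShape : Fin 7 → List ℕ := ![[3], [2, 1], [1, 1, 1], [2], [1, 1], [1], []]

/-- The rows of the tables: all partitions of size at most `2`. -/
def rowShape : Fin 4 → List ℕ := ![[2], [1, 1], [1], []]

/-- The indeterminate `q`. -/
noncomputable abbrev q : RatFunc ℤ := RatFunc.X

/-- The table for type `B`. -/
noncomputable def tableB (n : ℕ) : Matrix (Fin 4) (Fin 7) (RatFunc ℤ) :=
  !![q ^ n, q ^ (n - 1), 0, 1, 0, 0, 0;
     q ^ (n + 1), q ^ n + q ^ (n - 1), q ^ (n - 2), q, 1, 0, 0;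
     q ^ 2 * ((q ^ (2 * n) - 1) / (q ^ 2 - 1)), q * ((q ^ (2 * n - 1) - 1) / (q - 1)),
       q * ((q ^ (2 * n - 2) - 1) / (q ^ 2 - 1)), q ^ n, q ^ (n - 1), 1, 0;
     q ^ (n + 2) * ((q ^ (2 * n) - 1) / (q ^ 2 - 1)),
       q ^ (n + 1) * ((q ^ (2 * n - 1) - 1) / (q - 1)),
       q ^ (n - 1) * ((q ^ (2 * n) - 1) / (q ^ 2 - 1)),
       q ^ 2 * ((q ^ (2 * n) - 1) / (q ^ 2 - 1)), q * ((q ^ (2 * n) - 1) / (q ^ 2 - 1)), q ^ n, 1]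

/-- The table for type `C`. -/
noncomputable def tableC (n : ℕ) : Matrix (Fin 4) (Fin 7) (RatFunc ℤ) :=
  !![0, 0, 0, 1, 0, 0, 0;
     0, 0, 0, q, 1, 0, 0;
     q * ((q ^ (2 * n) - 1) / (q ^ 2 - 1)), q * ((q ^ (2 * n - 2) - 1) / (q - 1)),
       q ^ 2 * ((q ^ (2 * n - 4) - 1) / (q ^ 2 - 1)), 0, 0, 1, 0;
     0, 0, 0, q * ((q ^ (2 * n) - 1) / (q ^ 2 - 1)),
       q ^ 2 * ((q ^ (2 * n - 2) - 1) / (q ^ 2 - 1)), 0, 1]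

/-- The table for type `D`. -/
noncomputable def tableD (n : ℕ) : Matrix (Fin 4) (Fin 7) (RatFunc ℤ) :=
  !![0, 0, 0, 1, 0, 0, 0;
     0, 0, 0, q, 1, 0, 0;
     q ^ 2 * ((q ^ (2 * n - 2) - 1) / (q ^ 2 - 1)),
       q ^ (n - 1) + q * ((q ^ (2 * n - 3) - 1) / (q - 1)),
       q ^ (n - 2) + q * ((q ^ (2 * n - 4) - 1) / (q ^ 2 - 1)), 0, 0, 1, 0;
     0, 0, 0, q ^ 2 * ((q ^ (2 * n - 2) - 1) / (q ^ 2 - 1)),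
       q ^ (n - 1) + q * ((q ^ (2 * n - 2) - 1) / (q ^ 2 - 1)), 0, 1]

end KostkaFoulkes

/-! Everything follows from peeling off the first coordinate. The positive roots of rank `n + 1` are
those of rank `n` with a 0 put in front, the vectors `(1, ±ε j)`, and `(1, 0)` in type `B` or `(2,
0)` in type `C`. In the sum over signed permutations, expand by the entry that is moved to the first
place. A sum of positive roots has nonnegative first coordinate, so for small weights at most two
terms survive (`kfSum_succ_succ`, `kfSum_wt`). They are signed sums in rank one lower, in which the
first coordinate `R` of the argument of the partition function is prescribed.

The roots with nonzero first coordinate generate the complete symmetric functions of the weights of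
the defining representation, up to the factor of the long root in type `C`. Newton's identity `R h_R
= ∑ p_k h_{R-k}` therefore turns the prescribed first coordinate into an action of power sums
(`kostantQ_cons_rec`, `kfPart_rec`). A signed sum is alternating in `lam + rho`, so `p_k` acts on it
as on characters: shift one coordinate by `±k`, then straighten. Only `R ≤ 3` is needed, and on
partitions of size at most three the resulting rules do not depend on the rank
(`evals_isUniversal`). In small rank they persist once partitions that are too long are interpreted
by modification rules (`functionals_isUniversal`). The outcome is a set of rank recurrences
(`nullStep`, `oneStep`, `twoStep`). They give the row of `∅` by induction on the rank, and each
further row in one step from an earlier one.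

In type `D` the Weyl group has index two in the signed permutations, so `2 K` is the sum of two
alternants, without and with the product of the signs (`two_mul_kostkaFoulkes_D`). The first obeys
the rules for characters of the full orthogonal group. The second vanishes when `lam` or `mu` has
fewer than `n` parts, because `lam + rho` or `mu + rho` then ends in 0 (`IsAlt.eq_zero_of_zero`,
`kfSum_eq_zero_of_last`). If `lam` has `n` parts and `mu` fewer, the orthogonal character splits
into two halves contributing equally; this halves the generic value and explains the exception. If
both have `n` parts, then `n = 2` and `mu = (1, 1)`, and the second alternant is computed directly.
-/

namespace KostkaFoulkes

/-! ### Positive roots sorted by their first coordinate -/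

/-- The contribution of the root `ε 0` or `2 ε 0` to a sum over the positive roots. -/
def shortSum {M : Type*} [Zero M] {n : ℕ} (t : ClassicalType) (f : (Fin (n + 1) → ℚ) → M) : M :=
  match t with
  | .B => f (Fin.cons 1 0)
  | .C => f (Fin.cons 2 0)
  | .D => 0

theorem stdVec_zero (n : ℕ) : stdVec (n + 1) 0 = Fin.cons 1 0 := by
  ext i
  refine Fin.cases ?_ (fun j => ?_) i <;> simp [stdVec]

theorem stdVec_succ (n : ℕ) (j : Fin n) : stdVec (n + 1) j.succ = Fin.cons 0 (stdVec n j) := by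
  ext i
  refine Fin.cases ?_ (fun j => ?_) i <;> simp [stdVec, Pi.single_apply]

theorem cons_add_cons {n : ℕ} (a b : ℚ) (u v : Fin n → ℚ) :
    (Fin.cons a u + Fin.cons b v : Fin (n + 1) → ℚ) = Fin.cons (a + b) (u + v) := by
  ext i
  refine Fin.cases ?_ (fun j => ?_) i <;> simp

theorem cons_sub_cons {n : ℕ} (a b : ℚ) (u v : Fin n → ℚ) :
    (Fin.cons a u - Fin.cons b v : Fin (n + 1) → ℚ) = Fin.cons (a - b) (u - v) := by
  ext i
  refine Fin.cases ?_ (fun j => ?_) i <;> simp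

theorem smul_cons {n : ℕ} (c a : ℚ) (u : Fin n → ℚ) :
    (c • Fin.cons a u : Fin (n + 1) → ℚ) = Fin.cons (c * a) (c • u) := by
  ext i
  refine Fin.cases ?_ (fun j => ?_) i <;> simp

theorem stdVec_injective (n : ℕ) : Function.Injective (stdVec n) := by
  intro i j h
  by_contra hne
  have := congrFun h i
  simp [stdVec, hne] at this

theorem stdVec_ne_neg (n : ℕ) (i j : Fin n) : stdVec n i ≠ -stdVec n j := by
  intro h
  have := congrFun h i
  simp only [stdVec, Pi.neg_apply, Pi.single_apply] at this
  split_ifs at this <;> norm_num at this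

theorem stdVec_ne_zero (n : ℕ) (i : Fin n) : stdVec n i ≠ 0 := by
  intro h
  have := congrFun h i
  simp [stdVec] at this

theorem posRoots_succ (t : ClassicalType) (n : ℕ) :
    posRoots t (n + 1) =
      (Finset.univ.image (fun j => (Fin.cons 1 (stdVec n j) : Fin (n + 1) → ℚ)) ∪
        Finset.univ.image (fun j => (Fin.cons 1 (-stdVec n j) : Fin (n + 1) → ℚ))) ∪
      (match t with
        | .B => {Fin.cons 1 0}
        | .C => {Fin.cons 2 0}
        | .D => ∅) ∪
      (posRoots t n).image (fun α => (Fin.cons 0 α : Fin (n + 1) → ℚ)) := by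
  ext α
  simp only [posRoots, Finset.mem_union, Finset.mem_image, Finset.mem_filter, Finset.mem_univ,
    true_and, Prod.exists, Fin.exists_fin_succ, stdVec_zero, stdVec_succ, cons_add_cons,
    cons_sub_cons, or_and_right, exists_or, Fin.succ_lt_succ_iff, Fin.succ_pos, lt_irrefl,
    false_and, Fin.not_lt_zero]
  cases t <;> simp [smul_cons, stdVec_zero, stdVec_succ, exists_or]
  all_goals
    generalize (∃ i, (Fin.cons 1 (stdVec n i) : Fin (n + 1) → ℚ) = α) = p1
    generalize (∃ i, (Fin.cons 1 (-stdVec n i) : Fin (n + 1) → ℚ) = α) = p2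
    generalize (∃ i j, i < j ∧ (Fin.cons 0 (stdVec n i - stdVec n j) : Fin (n + 1) → ℚ) = α) = p3
    generalize (∃ i j, i < j ∧ (Fin.cons 0 (stdVec n i + stdVec n j) : Fin (n + 1) → ℚ) = α) = p4
  · simp only [Fin.exists_fin_succ, stdVec_zero, stdVec_succ, eq_comm (b := Fin.cons 1 0)]
    generalize (∃ i, (Fin.cons 0 (stdVec n i) : Fin (n + 1) → ℚ) = α) = p5
    tauto
  · simp only [Fin.exists_fin_succ, stdVec_zero, stdVec_succ, eq_comm (b := Fin.cons 2 0),
      smul_cons, mul_one, mul_zero, smul_zero]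
    generalize (∃ i, (Fin.cons 0 ((2 : ℚ) • stdVec n i) : Fin (n + 1) → ℚ) = α) = p5
    tauto
  · tauto

/-- The families in `posRoots_succ` are pairwise disjoint: the first coordinate, and for first
coordinate 1 the remaining vector, tells them apart. -/
theorem sum_posRoots_succ {M : Type*} [AddCommMonoid M] (t : ClassicalType) (n : ℕ)
    (f : (Fin (n + 1) → ℚ) → M) :
    ∑ α ∈ posRoots t (n + 1), f α =
      ∑ j, (f (Fin.cons 1 (stdVec n j)) + f (Fin.cons 1 (-stdVec n j))) + shortSum t f +
        ∑ α ∈ posRoots t n, f (Fin.cons 0 α) := by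
  have hinj : ∀ a : ℚ, Function.Injective (fun u : Fin n → ℚ => (Fin.cons a u : Fin (n + 1) → ℚ)) :=
    fun a => Fin.cons_right_injective (α := fun _ => ℚ) a
  rw [posRoots_succ, Finset.sum_union, Finset.sum_union, Finset.sum_union,
    Finset.sum_image, Finset.sum_image, Finset.sum_image, Finset.sum_add_distrib]
  · congr 2
    cases t <;> simp [shortSum]
  · exact fun a _ b _ h => hinj 0 h
  · exact fun a _ b _ h => stdVec_injective n (neg_injective (hinj 1 h))
  · exact fun a _ b _ h => stdVec_injective n (hinj 1 h)
  · rw [Finset.disjoint_left]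
    simp only [Finset.mem_image, Finset.mem_univ, true_and, not_exists]
    rintro _ ⟨i, rfl⟩ j h
    exact stdVec_ne_neg n i j (hinj 1 h).symm
  · rw [Finset.disjoint_left]
    intro a ha
    have h1 : a 0 = 1 ∧ Fin.tail a ≠ 0 := by
      simp only [Finset.mem_union, Finset.mem_image, Finset.mem_univ, true_and] at ha
      rcases ha with ⟨i, rfl⟩ | ⟨i, rfl⟩
      · exact ⟨rfl, by simpa using stdVec_ne_zero n i⟩
      · exact ⟨rfl, by simpa using stdVec_ne_zero n i⟩
    intro h
    cases t
    · simp only [Finset.mem_singleton] at h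
      subst h
      exact h1.2 (Fin.tail_cons _ _)
    · simp only [Finset.mem_singleton] at h
      subst h
      simp at h1
    · simp at h
  · rw [Finset.disjoint_right]
    simp only [Finset.mem_image, Finset.mem_union, Finset.mem_univ, true_and]
    rintro _ ⟨α, -, rfl⟩ h
    rcases h with (⟨i, h⟩ | ⟨i, h⟩) | h
    · simpa using congrFun h 0
    · simpa using congrFun h 0
    · cases t
      · simp only [Finset.mem_singleton] at h
        simpa using congrFun h 0
      · simp only [Finset.mem_singleton] at h
        simpa using congrFun h 0
      · simp at h

/-! ### Newton's identity for the `q`-partition function -/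

/-- The decompositions of `β`, as a finite set. -/
noncomputable def decomps (t : ClassicalType) (n : ℕ) (β : Fin n → ℚ) :
    Finset (posRoots t n → ℕ) :=
  (rootDecomps_finite t n β).toFinset

theorem mem_decomps {t : ClassicalType} {n : ℕ} {β : Fin n → ℚ} {m : posRoots t n → ℕ} :
    m ∈ decomps t n β ↔ ∑ α, m α • (α : Fin n → ℚ) = β := by
  simp [decomps, rootDecomps]

theorem kostantQ_eq (t : ClassicalType) (n : ℕ) (β : Fin n → ℚ) :
    kostantQ t n β = ∑ m ∈ decomps t n β, X ^ (∑ α, m α) := rfl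

/-- The number of times `α` occurs in the decompositions of `β`, weighted by powers of `q`. -/
theorem sum_decomps_mul (t : ClassicalType) (n : ℕ) (β : Fin n → ℚ) (α : posRoots t n) (N : ℕ)
    (hN : ∀ m ∈ decomps t n β, m α ≤ N) :
    ∑ m ∈ decomps t n β, (m α : ℤ[X]) * X ^ (∑ γ, m γ) =
      ∑ k ∈ Finset.range N,
        X ^ (k + 1) * kostantQ t n (β - ((k : ℚ) + 1) • (α : Fin n → ℚ)) := by
  -- The multiplicity `m α` is the number of `k ≥ 0` with `k + 1 ≤ m α`. After exchanging the sums,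
  -- removing `k + 1` copies of `α` is a bijection onto the decompositions of the smaller vector.
  have h1 : ∀ m ∈ decomps t n β, (m α : ℤ[X]) * X ^ (∑ γ, m γ) =
      ∑ k ∈ Finset.range N, if k + 1 ≤ m α then (X : ℤ[X]) ^ (∑ γ, m γ) else 0 := by
    intro m hm
    rw [← Finset.sum_filter, Finset.sum_const, nsmul_eq_mul]
    congr 2
    have : Finset.filter (fun k => k + 1 ≤ m α) (Finset.range N) = Finset.range (m α) := by
      ext k
      have := hN m hm
      simp only [Finset.mem_filter, Finset.mem_range]
      omega
    rw [this, Finset.card_range]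
  rw [Finset.sum_congr rfl h1, Finset.sum_comm]
  refine Finset.sum_congr rfl fun k _ => ?_
  rw [← Finset.sum_filter, kostantQ_eq, Finset.mul_sum]
  have key : ∀ m : posRoots t n → ℕ,
      ∑ γ, (m + Pi.single α (k + 1) : posRoots t n → ℕ) γ • (γ : Fin n → ℚ) =
        ∑ γ, m γ • (γ : Fin n → ℚ) + ((k : ℚ) + 1) • (α : Fin n → ℚ) := by
    intro m
    rw [show (k : ℚ) + 1 = ((k + 1 : ℕ) : ℚ) by push_cast; rfl]
    simp only [Pi.add_apply, add_smul, Finset.sum_add_distrib]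
    congr 1
    rw [Finset.sum_eq_single α]
    · rw [Pi.single_eq_same, ← Nat.cast_smul_eq_nsmul ℚ]
    · intro γ _ h
      rw [Pi.single_eq_of_ne h, zero_smul]
    · simp
  have key2 : ∀ m : posRoots t n → ℕ, k + 1 ≤ m α →
      m - Pi.single α (k + 1) + Pi.single α (k + 1) = m := by
    intro m h
    ext γ
    by_cases hγ : γ = α
    · subst hγ
      simp only [Pi.add_apply, Pi.sub_apply, Pi.single_eq_same]
      omega
    · simp [hγ]
  refine Finset.sum_nbij' (fun m => m - Pi.single α (k + 1)) (fun m => m + Pi.single α (k + 1))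
    ?_ ?_ ?_ ?_ ?_
  · intro m hm
    rw [Finset.mem_filter, mem_decomps] at hm
    rw [mem_decomps, eq_sub_iff_add_eq, ← key, key2 m hm.2, hm.1]
  · intro m hm
    rw [mem_decomps] at hm
    rw [Finset.mem_filter, mem_decomps, key, hm]
    simp
  · intro m hm
    exact key2 m (Finset.mem_filter.1 hm).2
  · intro m _
    simp
  · intro m hm
    have h := key2 m (Finset.mem_filter.1 hm).2
    conv_lhs => rw [← h]
    simp only [Pi.add_apply, Finset.sum_add_distrib, Finset.sum_pi_single', Finset.mem_univ,
      if_true]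
    rw [pow_add, mul_comm]

theorem posRoots_zero_coord (t : ClassicalType) (n : ℕ) (α : Fin (n + 1) → ℚ)
    (h : α ∈ posRoots t (n + 1)) : (⌊α 0⌋₊ : ℚ) = α 0 := by
  rw [posRoots_succ] at h
  simp only [Finset.mem_union, Finset.mem_image, Finset.mem_univ, true_and] at h
  rcases h with ((⟨i, rfl⟩ | ⟨i, rfl⟩) | h) | ⟨i, -, rfl⟩
  · simp
  · simp
  · cases t
    · simp only [Finset.mem_singleton] at h
      simp [h]
    · simp only [Finset.mem_singleton] at h
      simp [h]
    · simp at h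
  · simp

theorem decomps_coord {t : ClassicalType} {n : ℕ} {β : Fin (n + 1) → ℚ}
    {m : posRoots t (n + 1) → ℕ} (hm : m ∈ decomps t (n + 1) β) :
    ((∑ α, m α * ⌊(α : Fin (n + 1) → ℚ) 0⌋₊ : ℕ) : ℚ) = β 0 := by
  rw [← mem_decomps.1 hm, Finset.sum_apply, Nat.cast_sum]
  refine Finset.sum_congr rfl fun α _ => ?_
  rw [Nat.cast_mul, posRoots_zero_coord t n α α.2, Pi.smul_apply, nsmul_eq_mul]

theorem kostantQ_neg (t : ClassicalType) (n : ℕ) (β : Fin (n + 1) → ℚ) (h : β 0 < 0) :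
    kostantQ t (n + 1) β = 0 := by
  rw [kostantQ_eq]
  refine Finset.sum_eq_zero fun m hm => ?_
  have := decomps_coord hm
  rw [← this] at h
  exact absurd h (not_lt.2 (Nat.cast_nonneg _))

/-- Double counting: in each decomposition the multiplicities, weighted by the first coordinates of
the roots, add up to `R`. The floors only move these coordinates, which are 0, 1 or 2, into the
natural numbers. -/
theorem sum_decomps_coord (t : ClassicalType) (n : ℕ) (R : ℕ) (b : Fin n → ℚ) :
    (R : ℤ[X]) * kostantQ t (n + 1) (Fin.cons (R : ℚ) b) =
      ∑ α ∈ posRoots t (n + 1), (⌊α 0⌋₊ : ℤ[X]) * ∑ k ∈ Finset.range R,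
        X ^ (k + 1) * kostantQ t (n + 1) (Fin.cons (R : ℚ) b - ((k : ℚ) + 1) • α) := by
  have hc : ∀ m ∈ decomps t (n + 1) (Fin.cons (R : ℚ) b),
      ∑ α, m α * ⌊(α : Fin (n + 1) → ℚ) 0⌋₊ = R := by
    intro m hm
    have := decomps_coord hm
    rw [Fin.cons_zero] at this
    exact_mod_cast this
  rw [← Finset.sum_coe_sort (posRoots t (n + 1)) (fun α => (⌊α 0⌋₊ : ℤ[X]) *
    ∑ k ∈ Finset.range R,
        X ^ (k + 1) * kostantQ t (n + 1)
          ((Fin.cons (R : ℚ) b : Fin (n + 1) → ℚ) - ((k : ℚ) + 1) • α)),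
    kostantQ_eq, Finset.mul_sum]
  trans ∑ m ∈ decomps t (n + 1) (Fin.cons (R : ℚ) b), ∑ α : posRoots t (n + 1),
    (⌊(α : Fin (n + 1) → ℚ) 0⌋₊ : ℤ[X]) * ((m α : ℤ[X]) * X ^ (∑ γ, m γ))
  · refine Finset.sum_congr rfl fun m hm => ?_
    conv_lhs => rw [← hc m hm]
    rw [Nat.cast_sum, Finset.sum_mul]
    refine Finset.sum_congr rfl fun α _ => ?_
    push_cast
    ring
  · rw [Finset.sum_comm]
    refine Finset.sum_congr rfl fun α _ => ?_
    rw [← Finset.mul_sum]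
    -- Roots with first coordinate 0 carry weight 0; any other root occurs at most `R` times.
    rcases Nat.eq_zero_or_pos ⌊(α : Fin (n + 1) → ℚ) 0⌋₊ with h | h
    · simp [h]
    · rw [sum_decomps_mul t (n + 1) _ α R]
      intro m hm
      rw [← hc m hm]
      exact (Nat.le_mul_of_pos_right _ h).trans
        (Finset.single_le_sum (f := fun α : posRoots t (n + 1) =>
          m α * ⌊(α : Fin (n + 1) → ℚ) 0⌋₊) (fun _ _ => Nat.zero_le _) (Finset.mem_univ α))

/-- This is `R h_R = ∑ p_k h_{R-k}`, the logarithmic derivative of the product over the roots that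
involve the first coordinate. The root `2 ε 0` lowers that coordinate by two per copy and therefore
has weight 2. -/
theorem kostantQ_cons_rec (t : ClassicalType) (n : ℕ) (R : ℕ) (b : Fin n → ℚ) :
    (R : ℤ[X]) * kostantQ t (n + 1) (Fin.cons (R : ℚ) b) =
      ∑ k ∈ Finset.range R, X ^ (k + 1) *
        (∑ j, (kostantQ t (n + 1) (Fin.cons ((R : ℚ) - (k + 1)) (b - ((k : ℚ) + 1) • stdVec n j)) +
          kostantQ t (n + 1) (Fin.cons ((R : ℚ) - (k + 1)) (b + ((k : ℚ) + 1) • stdVec n j))) +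
        match t with
        | .B => kostantQ .B (n + 1) (Fin.cons ((R : ℚ) - (k + 1)) b)
        | .C => 2 * kostantQ .C (n + 1) (Fin.cons ((R : ℚ) - 2 * (k + 1)) b)
        | .D => 0) := by
  rw [sum_decomps_coord, sum_posRoots_succ]
  simp only [Fin.cons_zero, Nat.floor_one, Nat.floor_zero, Nat.cast_one, Nat.cast_zero, one_mul,
    zero_mul, Finset.sum_const_zero, add_zero, smul_cons, cons_sub_cons, mul_one, smul_neg,
    sub_neg_eq_add]
  simp only [mul_add, Finset.sum_add_distrib, Finset.mul_sum]
  congr 1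
  · congr 1
    · rw [Finset.sum_comm]
    · rw [Finset.sum_comm]
  · cases t
    · simp only [shortSum, Fin.cons_zero, Nat.floor_one, Nat.cast_one, one_mul, smul_cons,
        cons_sub_cons, mul_one, smul_zero, sub_zero]
    · simp only [shortSum, Fin.cons_zero, smul_cons, cons_sub_cons, smul_zero, sub_zero,
        Nat.floor_ofNat, Nat.cast_ofNat]
      refine Finset.sum_congr rfl fun k _ => ?_
      rw [mul_left_comm]
      congr 4
      ring
    · simp [shortSum]

/-- First coordinates of positive roots are nonnegative, so a vector with first coordinate 0 can
only use the roots of rank `n`; decompositions correspond by restriction and extension by zero. -/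
theorem kostantQ_cons_zero (t : ClassicalType) (n : ℕ) (b : Fin n → ℚ) :
    kostantQ t (n + 1) (Fin.cons 0 b) = kostantQ t n b := by
  have hmem : ∀ α ∈ posRoots t n, (Fin.cons 0 α : Fin (n + 1) → ℚ) ∈ posRoots t (n + 1) := by
    intro α h
    rw [posRoots_succ]
    exact Finset.mem_union_right _ (Finset.mem_image_of_mem _ h)
  let e : posRoots t n → posRoots t (n + 1) := fun α => ⟨Fin.cons 0 α, hmem α α.2⟩
  have he : Function.Injective e := by
    intro α γ h
    exact Subtype.ext (Fin.cons_right_injective (α := fun _ => ℚ) 0 (congrArg Subtype.val h))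
  have hrange : ∀ γ : posRoots t (n + 1), γ ∉ Set.range e → 1 ≤ ⌊(γ : Fin (n + 1) → ℚ) 0⌋₊ := by
    rintro ⟨γ, hγ⟩ hr
    rw [posRoots_succ] at hγ
    simp only [Finset.mem_union, Finset.mem_image, Finset.mem_univ, true_and] at hγ
    rcases hγ with ((⟨i, rfl⟩ | ⟨i, rfl⟩) | h) | ⟨i, hi, rfl⟩
    · simp
    · simp
    · cases t
      · simp only [Finset.mem_singleton] at h
        simp [h]
      · simp only [Finset.mem_singleton] at h
        simp [h]
      · simp at h
    · exact absurd ⟨⟨i, hi⟩, rfl⟩ hr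
  have hvan : ∀ m ∈ decomps t (n + 1) (Fin.cons 0 b), ∀ γ, γ ∉ Set.range e → m γ = 0 := by
    intro m hm γ hγ
    have h0 := decomps_coord hm
    rw [Fin.cons_zero, Nat.cast_eq_zero, Finset.sum_eq_zero_iff] at h0
    rcases Nat.mul_eq_zero.1 (h0 γ (Finset.mem_univ _)) with h | h
    · exact h
    · have := hrange γ hγ
      omega
  have hsum : ∀ m : posRoots t n → ℕ, ∑ α, m α • (e α : Fin (n + 1) → ℚ) =
      Fin.cons 0 (∑ α, m α • (α : Fin n → ℚ)) := by
    intro m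
    ext i
    refine Fin.cases ?_ (fun j => ?_) i
    · simp [e]
    · simp [e]
  rw [kostantQ_eq, kostantQ_eq]
  refine Finset.sum_nbij' (fun m α => m (e α)) (fun m => Function.extend e m 0) ?_ ?_ ?_ ?_ ?_
  · intro m hm
    rw [mem_decomps]
    have h := mem_decomps.1 hm
    rw [← Fintype.sum_of_injective e he (fun α => m (e α) • (e α : Fin (n + 1) → ℚ)) _
      (fun γ hγ => by rw [hvan m hm γ hγ, zero_smul]) (fun _ => rfl), hsum (fun α => m (e α))] at h
    exact Fin.cons_right_injective (α := fun _ => ℚ) 0 h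
  · intro m hm
    rw [mem_decomps] at hm ⊢
    rw [← Fintype.sum_of_injective e he (fun α => m α • (e α : Fin (n + 1) → ℚ)) _
      (fun γ hγ => by rw [Function.extend_apply' _ _ _ (fun ⟨a, ha⟩ => hγ ⟨a, ha⟩)]; simp)
      (fun _ => by rw [he.extend_apply]), hsum, hm]
  · intro m hm
    ext γ
    by_cases hγ : γ ∈ Set.range e
    · obtain ⟨α, rfl⟩ := hγ
      rw [he.extend_apply]
    · rw [Function.extend_apply' _ _ _ (fun ⟨a, ha⟩ => hγ ⟨a, ha⟩), hvan m hm γ hγ]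
      rfl
  · intro m _
    ext α
    exact he.extend_apply m 0 α
  · intro m hm
    rw [Fintype.sum_of_injective e he (fun α => m (e α)) _ (hvan m hm) (fun _ => rfl)]

theorem kostantQ_rank_zero (t : ClassicalType) (b : Fin 0 → ℚ) : kostantQ t 0 b = 1 := by
  have h : posRoots t 0 = ∅ := by
    cases t <;> simp [posRoots]
  have : IsEmpty (posRoots t 0) := by
    rw [h]
    infer_instance
  have hd : decomps t 0 b = {isEmptyElim} := by
    ext m
    rw [mem_decomps, Finset.mem_singleton]
    exact ⟨fun _ => Subsingleton.elim _ _, fun _ => Subsingleton.elim _ _⟩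
  rw [kostantQ_eq, hd]
  simp

/-! ### Alternating sums over signed permutations -/

/-- The signed sum of `f` over the images of `v` under all signed permutations; the sign changes
count with the exponent `e`. -/
noncomputable def alternant {n : ℕ} (e : ℕ) (f : (Fin n → ℚ) → ℤ[X]) (v : Fin n → ℚ) : ℤ[X] :=
  ∑ π : Equiv.Perm (Fin n), ∑ s : Fin n → ℤˣ,
    ((((Equiv.Perm.sign π * (∏ i, s i) ^ e : ℤˣ) : ℤ) : ℤ[X])) *
      f (fun i => ((s i : ℤ) : ℚ) * v (π i))

/-- A function of vectors that changes by the sign of a permutation of the coordinates, and by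
`(-1) ^ e` under the change of the sign of one coordinate. -/
structure IsAlt {n : ℕ} (e : ℕ) (F : (Fin n → ℚ) → ℤ[X]) : Prop where
  swap : ∀ v i j, i ≠ j → F (v ∘ Equiv.swap i j) = -F v
  flip : ∀ v i, F (Function.update v i (-v i)) = (-1) ^ e * F v

theorem isAlt_alternant {n : ℕ} (e : ℕ) (f : (Fin n → ℚ) → ℤ[X]) : IsAlt e (alternant e f) := by
  constructor
  · intro v i j hij
    rw [alternant, alternant, ← Equiv.sum_comp (Equiv.mulLeft (Equiv.swap i j)),
      ← Finset.sum_neg_distrib]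
    refine Finset.sum_congr rfl fun π _ => ?_
    rw [← Finset.sum_neg_distrib]
    refine Finset.sum_congr rfl fun s _ => ?_
    simp [Equiv.Perm.sign_mul, Equiv.Perm.sign_swap hij]
  · intro v i
    rw [alternant, alternant, Finset.mul_sum]
    refine Finset.sum_congr rfl fun π _ => ?_
    rw [Finset.mul_sum,
      -- Negating `v i` has the same effect as negating the sign at the position `π.symm i`, where
      -- `v i` is placed.
      ← Equiv.sum_comp (Equiv.mulRight (Pi.mulSingle (π.symm i) (-1) : Fin n → ℤˣ))]
    refine Finset.sum_congr rfl fun s _ => ?_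
    simp only [Equiv.coe_mulRight, Pi.mul_apply, Finset.prod_mul_distrib]
    rw [show ∏ j, (Pi.mulSingle (π.symm i) (-1) : Fin n → ℤˣ) j = -1 from
      (Finset.prod_eq_single (π.symm i) (fun j _ h => Pi.mulSingle_eq_of_ne h _) (by simp)).trans
        (Pi.mulSingle_eq_same _ _), ← mul_assoc]
    congr 1
    · rw [mul_pow, mul_comm (_ ^ e), mul_left_comm]
      push_cast
      rfl
    · congr 1
      ext k
      by_cases h : k = π.symm i
      · subst h
        simp
      · have h' : π k ≠ i := fun h' => h (by rw [← h', Equiv.symm_apply_apply])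
        simp [h, h']

/-- The sum of the values of `F` at the vectors that differ from `v` by `±k` in one coordinate. -/
noncomputable def shiftSum {n : ℕ} (k : ℚ) (F : (Fin n → ℚ) → ℤ[X]) (v : Fin n → ℚ) : ℤ[X] :=
  ∑ j, (F (v + k • stdVec n j) + F (v - k • stdVec n j))

theorem alternant_sum {n : ℕ} {ι : Type*} (e : ℕ) (S : Finset ι)
    (f : ι → (Fin n → ℚ) → ℤ[X]) (v : Fin n → ℚ) :
    alternant e (fun β => ∑ i ∈ S, f i β) v = ∑ i ∈ S, alternant e (f i) v := by
  simp only [alternant, Finset.mul_sum]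
  rw [Finset.sum_comm (s := S)]
  refine Finset.sum_congr rfl fun π _ => ?_
  rw [Finset.sum_comm (s := S)]

theorem alternant_add {n : ℕ} (e : ℕ) (f g : (Fin n → ℚ) → ℤ[X]) (v : Fin n → ℚ) :
    alternant e (fun β => f β + g β) v = alternant e f v + alternant e g v := by
  simp only [alternant, mul_add, Finset.sum_add_distrib]

theorem alternant_mul {n : ℕ} (e : ℕ) (c : ℤ[X]) (f : (Fin n → ℚ) → ℤ[X]) (v : Fin n → ℚ) :
    alternant e (fun β => c * f β) v = c * alternant e f v := by
  simp only [alternant, Finset.mul_sum, mul_left_comm c]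

theorem alternant_zero {n : ℕ} (e : ℕ) (v : Fin n → ℚ) :
    alternant e (fun _ => 0) v = 0 := by
  simp [alternant]

/-- The set of all `±k ε j` is stable under signed permutations, so shifting before or after the
signed permutation gives the same sum. -/
theorem shiftSum_alternant {n : ℕ} (e : ℕ) (k : ℚ) (f : (Fin n → ℚ) → ℤ[X]) (v : Fin n → ℚ) :
    alternant e (fun β => ∑ j, (f (β - k • stdVec n j) + f (β + k • stdVec n j))) v =
      shiftSum k (alternant e f) v := by
  simp only [alternant, shiftSum, ← Finset.sum_add_distrib, ← mul_add]
  rw [Finset.sum_comm (s := (Finset.univ : Finset (Fin n)))]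
  refine Finset.sum_congr rfl fun π _ => ?_
  rw [Finset.sum_comm (s := (Finset.univ : Finset (Fin n)))]
  refine Finset.sum_congr rfl fun s _ => ?_
  rw [← Finset.mul_sum]
  congr 1
  refine Eq.trans ?_ (Equiv.sum_comp π fun j =>
    f (fun i => ((s i : ℤ) : ℚ) * (v + k • stdVec n j) (π i)) +
      f (fun i => ((s i : ℤ) : ℚ) * (v - k • stdVec n j) (π i)))
  refine Finset.sum_congr rfl fun j _ => ?_
  have h1 : ∀ c : ℚ, (fun i => ((s i : ℤ) : ℚ) * (v + c • stdVec n (π j)) (π i)) =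
      (fun i => ((s i : ℤ) : ℚ) * v (π i)) + (((s j : ℤ) : ℚ) * c) • stdVec n j := by
    intro c
    ext i
    by_cases h : i = j
    · subst h
      simp [stdVec, mul_add]
    · simp [stdVec, h]
  have h2 := h1 k
  have h3 := h1 (-k)
  rw [neg_smul, ← sub_eq_add_neg] at h3
  rw [h2, h3]
  rcases Int.units_eq_one_or (s j) with h | h
  · simp [h, sub_eq_add_neg, add_comm]
  · simp [h, sub_eq_add_neg]

/-- A signed permutation amounts to the index `p` and the sign `u` of the entry moved to the first
place, and a signed permutation of the rest. Bringing `p` forward by a transposition costs a sign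
unless `p = 0`. -/
theorem alternant_succ {n : ℕ} (e : ℕ) (f : (Fin (n + 1) → ℚ) → ℤ[X]) (v : Fin (n + 1) → ℚ) :
    alternant e f v = ∑ p : Fin (n + 1), ∑ u : ℤˣ,
      ((((if p = 0 then 1 else -1) * u ^ e : ℤˣ) : ℤ) : ℤ[X]) *
        alternant e (fun β => f (Fin.cons (((u : ℤ) : ℚ) * v p) β))
          (fun i => v (Equiv.swap 0 p i.succ)) := by
  rw [alternant, ← Equiv.sum_comp Equiv.Perm.decomposeFin.symm, Fintype.sum_prod_type]
  refine Finset.sum_congr rfl fun p _ => ?_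
  simp only [alternant, Finset.mul_sum]
  rw [Finset.sum_comm (s := (Finset.univ : Finset ℤˣ))]
  refine Finset.sum_congr rfl fun π _ => ?_
  rw [← Equiv.sum_comp (Fin.consEquiv (fun _ : Fin (n + 1) => ℤˣ)), Fintype.sum_prod_type]
  refine Finset.sum_congr rfl fun u _ => ?_
  refine Finset.sum_congr rfl fun s _ => ?_
  rw [← mul_assoc]
  congr 1
  · rw [← Int.cast_mul, ← Units.val_mul, Equiv.Perm.decomposeFin.symm_sign]
    congr 2
    simp only [Fin.consEquiv_apply, Fin.prod_univ_succ, Fin.cons_zero, Fin.cons_succ, mul_pow]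
    exact mul_mul_mul_comm _ _ _ _
  · congr 1
    ext i
    refine Fin.cases ?_ (fun j => ?_) i <;> simp

/-- The Kostka-Foulkes sum over all signed permutations, for vectors already shifted by `ρ`. -/
noncomputable def kfSum (t : ClassicalType) (e n : ℕ) (v w : Fin n → ℚ) : ℤ[X] :=
  alternant e (fun β => kostantQ t n (β - w)) v

/-- The part of `kfSum` in rank `n + 1` for which the first coordinate of the argument of the
partition function is `R`. -/
noncomputable def kfPart (t : ClassicalType) (e n : ℕ) (R : ℚ) (v w : Fin n → ℚ) : ℤ[X] :=
  alternant e (fun β => kostantQ t (n + 1) (Fin.cons R (β - w))) v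

theorem isAlt_kfSum (t : ClassicalType) (e n : ℕ) (w : Fin n → ℚ) :
    IsAlt e (fun v => kfSum t e n v w) := isAlt_alternant _ _

theorem isAlt_kfPart (t : ClassicalType) (e n : ℕ) (R : ℚ) (w : Fin n → ℚ) :
    IsAlt e (fun v => kfPart t e n R v w) := isAlt_alternant _ _

theorem kfPart_zero (t : ClassicalType) (e n : ℕ) (v w : Fin n → ℚ) :
    kfPart t e n 0 v w = kfSum t e n v w := by
  simp only [kfPart, kfSum, kostantQ_cons_zero]

theorem kfPart_neg (t : ClassicalType) (e n : ℕ) (R : ℚ) (hR : R < 0) (v w : Fin n → ℚ) :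
    kfPart t e n R v w = 0 := by
  have : ∀ b : Fin n → ℚ, kostantQ t (n + 1) (Fin.cons R b) = 0 :=
    fun b => kostantQ_neg t n _ (by simpa using hR)
  simp only [kfPart, this, alternant_zero]

/-- The recursion for the partition function survives alternation because its main term is invariant
under signed permutations. -/
theorem kfPart_rec (t : ClassicalType) (e n R : ℕ) (v w : Fin n → ℚ) :
    (R : ℤ[X]) * kfPart t e n R v w =
      ∑ k ∈ Finset.range R, X ^ (k + 1) *
        (shiftSum ((k : ℚ) + 1) (fun v => kfPart t e n ((R : ℚ) - (k + 1)) v w) v +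
        match t with
        | .B => kfPart .B e n ((R : ℚ) - (k + 1)) v w
        | .C => 2 * kfPart .C e n ((R : ℚ) - 2 * (k + 1)) v w
        | .D => 0) := by
  rw [kfPart, ← alternant_mul]
  simp only [kostantQ_cons_rec]
  rw [alternant_sum]
  refine Finset.sum_congr rfl fun k _ => ?_
  rw [alternant_mul, alternant_add]
  congr 2
  · refine Eq.trans ?_ (shiftSum_alternant e ((k : ℚ) + 1)
      (fun β => kostantQ t (n + 1) (Fin.cons ((R : ℚ) - (k + 1)) (β - w))) v)
    simp only [sub_right_comm _ _ w, sub_add_eq_add_sub]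
  · cases t
    · rfl
    · exact alternant_mul _ _ _ _
    · exact alternant_zero _ _

/-- Expansion of `kfSum` along the first coordinate. -/
theorem kfSum_succ_succ (t : ClassicalType) (e n : ℕ) (v w : Fin (n + 2) → ℚ)
    (hneg : ∀ p, -v p < w 0) (hpos : ∀ p : Fin n, v p.succ.succ < w 0) :
    kfSum t e (n + 2) v w = kfPart t e (n + 1) (v 0 - w 0) (Fin.tail v) (Fin.tail w) -
      kfPart t e (n + 1) (v 1 - w 0) (fun i => v (Equiv.swap 0 1 i.succ)) (Fin.tail w) := by
  have hpart : ∀ (x : ℚ) (u : Fin (n + 1) → ℚ),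
      alternant e (fun β => kostantQ t (n + 2) (Fin.cons x β - w)) u =
        kfPart t e (n + 1) (x - w 0) u (Fin.tail w) := by
    intro x u
    rw [kfPart]
    congr 1
    ext1 β
    conv_lhs => rw [← Fin.cons_self_tail w]
    rw [cons_sub_cons]
  -- With the sign `-1` the first coordinate `-v p - w 0` is negative, so only the sign `1`
  -- contributes.
  have hterm : ∀ (p : Fin (n + 2)) (g : ℤˣ → ℤ[X]) (u : Fin (n + 1) → ℚ),
      ∑ s : ℤˣ, g s * kfPart t e (n + 1) (((s : ℤ) : ℚ) * v p - w 0) u (Fin.tail w) =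
        g 1 * kfPart t e (n + 1) (v p - w 0) u (Fin.tail w) := by
    intro p g u
    rw [Finset.sum_eq_single 1]
    · simp
    · intro s _ hs
      rw [(Int.units_eq_one_or s).resolve_left hs, kfPart_neg, mul_zero]
      have := hneg p
      simp only [Units.val_neg, Units.val_one, Int.cast_neg, Int.cast_one]
      linarith
    · simp
  rw [kfSum, alternant_succ]
  simp only [hpart, hterm]
  rw [Fin.sum_univ_succ, Fin.sum_univ_succ, Finset.sum_eq_zero, add_zero]
  · simp [sub_eq_add_neg, Fin.tail_def]
  · intro p _
    rw [kfPart_neg _ _ _ _ (by linarith [hpos p]), mul_zero]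

theorem kfSum_one (t : ClassicalType) (e : ℕ) (v w : Fin 1 → ℚ) :
    kfSum t e 1 v w = kfPart t e 0 (v 0 - w 0) (Fin.tail v) (Fin.tail w) +
      (-1) ^ e * kfPart t e 0 (-v 0 - w 0) (Fin.tail v) (Fin.tail w) := by
  have hpart : ∀ (x : ℚ) (u : Fin 0 → ℚ),
      alternant e (fun β => kostantQ t 1 (Fin.cons x β - w)) u =
        kfPart t e 0 (x - w 0) u (Fin.tail w) := by
    intro x u
    rw [kfPart]
    congr 1
    ext1 β
    conv_lhs => rw [← Fin.cons_self_tail w]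
    rw [cons_sub_cons]
  have huniv : (Finset.univ : Finset ℤˣ) = {1, -1} := by decide
  rw [kfSum, alternant_succ]
  simp only [hpart]
  rw [Fin.sum_univ_one, huniv, Finset.sum_pair (by decide)]
  simp [Fin.tail_def]

/-! ### The Weyl group as signed permutations, and the parity of the length -/

theorem int_units_mul_cancel (a b : ℤˣ) : a * b * b = a := by
  rw [mul_assoc, Int.units_mul_self, mul_one]

/-- The signed permutation of the letters with underlying permutation `π` and signs `s`. -/
def signedPerm {n : ℕ} (π : Equiv.Perm (Fin n)) (s : Fin n → ℤˣ) : Equiv.Perm (Letter n) where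
  toFun x := (π x.1, x.2 * s x.1)
  invFun x := (π.symm x.1, x.2 * s (π.symm x.1))
  left_inv x := by simp [int_units_mul_cancel]
  right_inv x := by simp [int_units_mul_cancel]

theorem signedPerm_apply {n : ℕ} (π : Equiv.Perm (Fin n)) (s : Fin n → ℤˣ) (x : Letter n) :
    signedPerm π s x = (π x.1, x.2 * s x.1) := rfl

theorem signedPerm_mul {n : ℕ} (π π' : Equiv.Perm (Fin n)) (s s' : Fin n → ℤˣ) :
    signedPerm π s * signedPerm π' s' = signedPerm (π * π') (s' * s ∘ π') := by
  ext x <;> simp [signedPerm_apply, mul_assoc]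

theorem signedPerm_one {n : ℕ} : signedPerm (1 : Equiv.Perm (Fin n)) 1 = 1 := by
  ext x <;> simp [signedPerm_apply]

theorem signedPerm_injective {n : ℕ} :
    Function.Injective (fun p : Equiv.Perm (Fin n) × (Fin n → ℤˣ) => signedPerm p.1 p.2) := by
  rintro ⟨π, s⟩ ⟨π', s'⟩ h
  have h1 : ∀ i, (π i, s i) = (π' i, s' i) := by
    intro i
    have := Equiv.congr_fun h (i, 1)
    simpa [signedPerm_apply] using this
  ext i
  · exact congrArg Fin.val (Prod.ext_iff.1 (h1 i)).1
  · exact congrArg Units.val (Prod.ext_iff.1 (h1 i)).2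

theorem swap_mul_swap_eq {n : ℕ} (i j : Fin n) (h : i ≠ j) :
    Equiv.swap ((i, 1) : Letter n) (j, 1) * Equiv.swap (i, -1) (j, -1) =
      signedPerm (Equiv.swap i j) 1 := by
  refine Equiv.ext fun ⟨k, u⟩ => ?_
  have h1 : (1 : ℤˣ) ≠ -1 := by decide
  have h2 : (-1 : ℤˣ) ≠ 1 := by decide
  have h3 := h.symm
  rcases Int.units_eq_one_or u with rfl | rfl <;> by_cases hi : k = i <;> by_cases hj : k = j <;>
    simp_all [signedPerm_apply, Equiv.swap_apply_def]

theorem swap_neg_eq {n : ℕ} (i : Fin n) :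
    Equiv.swap ((i, 1) : Letter n) (i, -1) = signedPerm 1 (Pi.mulSingle i (-1)) := by
  refine Equiv.ext fun ⟨k, u⟩ => ?_
  have h1 : (1 : ℤˣ) ≠ -1 := by decide
  have h2 : (-1 : ℤˣ) ≠ 1 := by decide
  rcases Int.units_eq_one_or u with rfl | rfl <;> by_cases hi : k = i <;>
    simp_all [signedPerm_apply, Equiv.swap_apply_def]

theorem swap_mul_swap_neg_eq {n : ℕ} (i j : Fin n) (h : i ≠ j) :
    Equiv.swap ((i, 1) : Letter n) (j, -1) * Equiv.swap (i, -1) (j, 1) =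
      signedPerm (Equiv.swap i j) (Pi.mulSingle i (-1) * Pi.mulSingle j (-1)) := by
  refine Equiv.ext fun ⟨k, u⟩ => ?_
  have h1 : (1 : ℤˣ) ≠ -1 := by decide
  have h2 : (-1 : ℤˣ) ≠ 1 := by decide
  have h3 := h.symm
  rcases Int.units_eq_one_or u with rfl | rfl <;> by_cases hi : k = i <;> by_cases hj : k = j <;>
    simp_all [signedPerm_apply, Equiv.swap_apply_def]

theorem prod_mulSingle {n : ℕ} (i : Fin n) (u : ℤˣ) :
    ∏ j, (Pi.mulSingle i u : Fin n → ℤˣ) j = u :=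
  (Finset.prod_eq_single i (fun _ _ h => Pi.mulSingle_eq_of_ne h _) (by simp)).trans
    (Pi.mulSingle_eq_same _ _)

/-- The sign character to be compared with the length parity is the sign of the underlying
permutation times the product of the signs; it equals `-1` on every generator. -/
theorem simpleGens_signed (t : ClassicalType) (n : ℕ) (σ : Equiv.Perm (Letter n))
    (hσ : σ ∈ simpleGens t n) :
    ∃ π s, σ = signedPerm π s ∧ (t = .D → ∏ i, s i = 1) ∧
      Equiv.Perm.sign π * ∏ i, s i = -1 := by
  have hlt : ∀ i j : Fin n, (j : ℕ) = i + 1 → i ≠ j := by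
    rintro i j h rfl
    omega
  have hadj : (∃ i j : Fin n, (j : ℕ) = i + 1 ∧
      σ = Equiv.swap (i, 1) (j, 1) * Equiv.swap (i, -1) (j, -1)) →
      ∃ π s, σ = signedPerm π s ∧ (t = .D → ∏ i, s i = 1) ∧
        Equiv.Perm.sign π * ∏ i, s i = -1 := by
    rintro ⟨i, j, hij, rfl⟩
    exact ⟨_, _, swap_mul_swap_eq i j (hlt i j hij), by simp,
      by simp [Equiv.Perm.sign_swap (hlt i j hij)]⟩
  have hlast : t ≠ .D → (∃ i : Fin n, (i : ℕ) + 1 = n ∧ σ = Equiv.swap (i, 1) (i, -1)) →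
      ∃ π s, σ = signedPerm π s ∧ (t = .D → ∏ i, s i = 1) ∧
        Equiv.Perm.sign π * ∏ i, s i = -1 := by
    rintro ht ⟨i, hi, rfl⟩
    exact ⟨_, _, swap_neg_eq i, fun h => absurd h ht, by rw [prod_mulSingle]; simp⟩
  cases t
  · exact hσ.elim hadj (hlast (by simp))
  · exact hσ.elim hadj (hlast (by simp))
  · refine hσ.elim hadj ?_
    rintro ⟨i, j, hij, -, rfl⟩
    refine ⟨_, _, swap_mul_swap_neg_eq i j (hlt i j hij), fun _ => ?_, ?_⟩
    · simp only [Pi.mul_apply, Finset.prod_mul_distrib, prod_mulSingle]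
      decide
    · simp only [Pi.mul_apply, Finset.prod_mul_distrib, prod_mulSingle,
        Equiv.Perm.sign_swap (hlt i j hij)]
      decide

theorem simpleGens_list (t : ClassicalType) (n : ℕ) (w : List (Equiv.Perm (Letter n)))
    (hw : ∀ σ ∈ w, σ ∈ simpleGens t n) :
    ∃ π s, w.prod = signedPerm π s ∧ (t = .D → ∏ i, s i = 1) ∧
      Equiv.Perm.sign π * ∏ i, s i = (-1) ^ w.length := by
  induction w with
  | nil => exact ⟨1, 1, by rw [signedPerm_one, List.prod_nil], by simp, by simp⟩
  | cons σ w ih =>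
    obtain ⟨π', s', h1', h2', h3'⟩ := ih fun τ hτ => hw τ (List.mem_cons_of_mem _ hτ)
    obtain ⟨π, s, h1, h2, h3⟩ := simpleGens_signed t n σ (hw σ List.mem_cons_self)
    refine ⟨π * π', s' * s ∘ π', by rw [List.prod_cons, h1', h1, signedPerm_mul], fun ht => ?_, ?_⟩
    · simp only [Pi.mul_apply, Finset.prod_mul_distrib, Function.comp_apply]
      rw [Equiv.prod_comp π' s, h2 ht, h2' ht, one_mul]
    · simp only [Pi.mul_apply, Finset.prod_mul_distrib, Function.comp_apply]
      rw [Equiv.prod_comp π' s, Equiv.Perm.sign_mul, List.length_cons, pow_succ', ← h3', ← h3,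
        mul_comm (∏ i, s' i)]
      exact mul_mul_mul_comm _ _ _ _

theorem weylGroup_list (t : ClassicalType) (n : ℕ) (σ : Equiv.Perm (Letter n))
    (hσ : σ ∈ weylGroup t n) :
    ∃ w : List (Equiv.Perm (Letter n)), (∀ τ ∈ w, τ ∈ simpleGens t n) ∧ w.prod = σ := by
  rw [weylGroup, ← Subgroup.mem_toSubmonoid, Subgroup.closure_toSubmonoid_of_finite] at hσ
  exact Submonoid.exists_list_of_mem_closure hσ

theorem weylGroup_signed (t : ClassicalType) (n : ℕ) (σ : Equiv.Perm (Letter n))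
    (hσ : σ ∈ weylGroup t n) :
    ∃ π s, σ = signedPerm π s ∧ (t = .D → ∏ i, s i = 1) := by
  obtain ⟨w, hw, rfl⟩ := weylGroup_list t n σ hσ
  obtain ⟨π, s, h, h', -⟩ := simpleGens_list t n w hw
  exact ⟨π, s, h, h'⟩

theorem neg_one_pow_weylLength (t : ClassicalType) (n : ℕ) (π : Equiv.Perm (Fin n))
    (s : Fin n → ℤˣ) (h : signedPerm π s ∈ weylGroup t n) :
    (-1) ^ weylLength t n (signedPerm π s) = Equiv.Perm.sign π * ∏ i, s i := by
  obtain ⟨w, hw, hp⟩ := weylGroup_list t n _ h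
  have hne : {k | ∃ w : List (Equiv.Perm (Letter n)),
      w.length = k ∧ (∀ s ∈ w, s ∈ simpleGens t n) ∧ w.prod = signedPerm π s}.Nonempty :=
    ⟨_, w, rfl, hw, hp⟩
  -- The infimum is attained by a word `w'`, and the sign character of a product of generators
  -- depends on the word only through the parity of its number of factors.
  obtain ⟨w', h1, h2, h3⟩ := Nat.sInf_mem hne
  obtain ⟨π', s', h4, -, h5⟩ := simpleGens_list t n w' h2
  have := signedPerm_injective (a₁ := (π, s)) (a₂ := (π', s')) (h3.symm.trans h4)
  rw [Prod.mk.injEq] at this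
  rw [this.1, this.2, h5, h1, ← this.1, ← this.2]
  rfl

theorem signedPerm_perm_mem (t : ClassicalType) (n : ℕ) (π : Equiv.Perm (Fin n)) :
    signedPerm π 1 ∈ weylGroup t n := by
  cases n with
  | zero =>
    rw [Subsingleton.elim (signedPerm π 1) 1]
    exact one_mem _
  | succ n =>
    let φ : Equiv.Perm (Fin (n + 1)) →* Equiv.Perm (Letter (n + 1)) :=
      { toFun := fun π => signedPerm π 1
        map_one' := signedPerm_one
        map_mul' := fun π π' => by rw [signedPerm_mul]; rfl }
    have h : Submonoid.closure (Set.range fun i : Fin n => Equiv.swap i.castSucc i.succ) ≤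
        (weylGroup t (n + 1)).toSubmonoid.comap φ := by
      rw [Submonoid.closure_le]
      rintro _ ⟨i, rfl⟩
      have hm : signedPerm (Equiv.swap i.castSucc i.succ) 1 ∈ simpleGens t (n + 1) := by
        rw [← swap_mul_swap_eq _ _ (Fin.castSucc_lt_succ).ne]
        cases t <;> exact Or.inl ⟨i.castSucc, i.succ, by simp, rfl⟩
      exact Subgroup.subset_closure hm
    rw [Equiv.Perm.mclosure_swap_castSucc_succ] at h
    exact h (Submonoid.mem_top π)

theorem signedPerm_conj {n : ℕ} (π : Equiv.Perm (Fin n)) (s : Fin n → ℤˣ) :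
    signedPerm π 1 * signedPerm 1 s * signedPerm π⁻¹ 1 = signedPerm 1 (s ∘ π.symm) := by
  rw [signedPerm_mul, signedPerm_mul]
  simp

theorem mulSingle_comp_symm {n : ℕ} (π : Equiv.Perm (Fin n)) (i : Fin n) (u : ℤˣ) :
    (Pi.mulSingle i u : Fin n → ℤˣ) ∘ π.symm = Pi.mulSingle (π i) u := by
  ext j
  by_cases h : j = π i
  · subst h
    simp
  · have : π.symm j ≠ i := fun h' => h (by rw [← h', Equiv.apply_symm_apply])
    simp [h, this]

/-- Conjugating by permutations carries one sign change (types `B`, `C`), or one simultaneous change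
of two signs (type `D`), to every position; these generate all admissible sign vectors. -/
theorem signedPerm_sign_mem (t : ClassicalType) (n : ℕ) (s : Fin n → ℤˣ)
    (hs : t = .D → ∏ i, s i = 1) : signedPerm 1 s ∈ weylGroup t n := by
  let H : Submonoid (Fin n → ℤˣ) :=
    { carrier := {s | signedPerm 1 s ∈ weylGroup t n}
      one_mem' := by
        change signedPerm 1 1 ∈ weylGroup t n
        rw [signedPerm_one]
        exact one_mem _
      mul_mem' := by
        intro a b ha hb
        have hb' : signedPerm 1 b ∈ weylGroup t n := hb
        have ha' : signedPerm 1 a ∈ weylGroup t n := ha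
        have := mul_mem hb' ha'
        rw [signedPerm_mul] at this
        simpa using this }
  have hH : ∀ s, s ∈ H ↔ signedPerm 1 s ∈ weylGroup t n := fun _ => Iff.rfl
  have hconj : ∀ s ∈ H, ∀ π : Equiv.Perm (Fin n), s ∘ π.symm ∈ H := by
    intro s hs π
    rw [hH, ← signedPerm_conj]
    exact mul_mem (mul_mem (signedPerm_perm_mem t n π) hs) (signedPerm_perm_mem t n π⁻¹)
  rw [← hH]
  obtain _ | m := n
  · rw [Subsingleton.elim s 1]
    exact one_mem _
  have hBC : (Equiv.swap ((Fin.last m, 1) : Letter (m + 1)) (Fin.last m, -1)) ∈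
      simpleGens t (m + 1) → s ∈ H := by
    intro h
    have h1 : ∀ i u, (Pi.mulSingle i u : Fin (m + 1) → ℤˣ) ∈ H := by
      intro i u
      rcases Int.units_eq_one_or u with rfl | rfl
      · rw [Pi.mulSingle_one]
        exact one_mem _
      · have h2 := hconj (Pi.mulSingle (Fin.last m) (-1))
          ((hH _).2 (swap_neg_eq (Fin.last m) ▸ Subgroup.subset_closure h))
          (Equiv.swap (Fin.last m) i)
        rwa [mulSingle_comp_symm, Equiv.swap_apply_left] at h2
    rw [← Finset.univ_prod_mulSingle s]
    exact prod_mem fun i _ => h1 i _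
  cases t
  · exact hBC (Or.inr ⟨Fin.last m, by simp, rfl⟩)
  · exact hBC (Or.inr ⟨Fin.last m, by simp, rfl⟩)
  · have h1 : ∀ i j : Fin (m + 1), i ≠ j → ∀ u,
        (Pi.mulSingle i u * Pi.mulSingle j u : Fin (m + 1) → ℤˣ) ∈ H := by
      intro i j hij u
      rcases Int.units_eq_one_or u with rfl | rfl
      · rw [Pi.mulSingle_one, Pi.mulSingle_one, one_mul]
        exact one_mem _
      obtain _ | k := m
      · exact absurd (Fin.ext (by omega)) hij
      set a : Fin (k + 2) := (Fin.last k).castSucc with ha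
      set b : Fin (k + 2) := Fin.last (k + 1) with hb
      have hab : a ≠ b := (Fin.castSucc_lt_last _).ne
      have hmem : (Pi.mulSingle a (-1) * Pi.mulSingle b (-1) : Fin (k + 2) → ℤˣ) ∈ H := by
        have h2 : signedPerm (Equiv.swap a b) (Pi.mulSingle a (-1) * Pi.mulSingle b (-1)) ∈
            weylGroup .D (k + 2) := by
          rw [← swap_mul_swap_neg_eq a b hab]
          exact Subgroup.subset_closure (Or.inr ⟨a, b, by simp [ha, hb], by simp [hb], rfl⟩)
        -- Multiplying the special generator by the plain exchange of the same two coordinates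
        -- leaves a pure change of two signs.
        have h3 := mul_mem (signedPerm_perm_mem .D (k + 2) (Equiv.swap a b)) h2
        rw [signedPerm_mul] at h3
        rw [hH]
        simpa using h3
      let τ : Equiv.Perm (Fin (k + 2)) := Equiv.swap a i
      let π : Equiv.Perm (Fin (k + 2)) := Equiv.swap (τ b) j * τ
      have hτa : τ a = i := Equiv.swap_apply_left a i
      have hπa : π a = i := by
        have : i ≠ τ b := fun h => hab (τ.injective (hτa.trans h))
        rw [Equiv.Perm.mul_apply, hτa, Equiv.swap_apply_of_ne_of_ne this hij]
      have hπb : π b = j := by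
        rw [Equiv.Perm.mul_apply, Equiv.swap_apply_left]
      have h4 := hconj _ hmem π
      rw [Pi.mul_comp, mulSingle_comp_symm, mulSingle_comp_symm, hπa, hπb] at h4
      exact h4
    -- Each sign is paired with a copy at the last coordinate; these copies multiply to 1 because
    -- the product of all signs is 1.
    have h5 : s = ∏ i, (Pi.mulSingle i (s i) * Pi.mulSingle (Fin.last m) (s i)) := by
      rw [Finset.prod_mul_distrib, Finset.univ_prod_mulSingle]
      have : ∏ i, (Pi.mulSingle (Fin.last m) (s i) : Fin (m + 1) → ℤˣ) = 1 := by
        have h := map_prod (MonoidHom.mulSingle (fun _ : Fin (m + 1) => ℤˣ) (Fin.last m)) s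
          Finset.univ
        rw [hs rfl, map_one] at h
        exact h.symm
      rw [this, mul_one]
    rw [h5]
    refine prod_mem fun i _ => ?_
    by_cases h : i = Fin.last m
    · subst h
      rw [← Pi.mulSingle_mul, Int.units_mul_self, Pi.mulSingle_one]
      exact one_mem _
    · exact h1 i _ h _

theorem signedPerm_mem (t : ClassicalType) (n : ℕ) (π : Equiv.Perm (Fin n)) (s : Fin n → ℤˣ) :
    signedPerm π s ∈ weylGroup t n ↔ (t = .D → ∏ i, s i = 1) := by
  constructor
  · intro h ht
    obtain ⟨π', s', h1, h2⟩ := weylGroup_signed t n _ h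
    have := signedPerm_injective (a₁ := (π, s)) (a₂ := (π', s')) h1
    rw [Prod.mk.injEq] at this
    rw [this.2]
    exact h2 ht
  · intro h
    have := mul_mem (signedPerm_perm_mem t n π) (signedPerm_sign_mem t n s h)
    rw [signedPerm_mul] at this
    simpa using this

open Classical in
theorem kostkaFoulkes_eq_sum (t : ClassicalType) (n : ℕ) (lam mu : Fin n → ℚ) :
    kostkaFoulkes t n lam mu = ∑ π : Equiv.Perm (Fin n), ∑ s : Fin n → ℤˣ,
      if t = .D → ∏ i, s i = 1 then
        (((Equiv.Perm.sign π * ∏ i, s i : ℤˣ) : ℤ) : ℤ[X]) *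
          kostantQ t n ((fun i => ((s i : ℤ) : ℚ) * (lam + rho t n) (π i)) - (mu + rho t n))
      else 0 := by
  have himage : (Set.toFinite (weylGroup t n : Set (Equiv.Perm (Letter n)))).toFinset =
      ((Finset.univ : Finset (Equiv.Perm (Fin n) × (Fin n → ℤˣ))).filter
        fun p => t = .D → ∏ i, p.2 i = 1).image fun p => signedPerm p.1 p.2 := by
    ext σ
    simp only [Set.Finite.mem_toFinset, SetLike.mem_coe, Finset.mem_image, Finset.mem_filter,
      Finset.mem_univ, true_and, Prod.exists]
    constructor
    · intro h
      obtain ⟨π, s, h1, h2⟩ := weylGroup_signed t n σ h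
      exact ⟨π, s, h2, h1.symm⟩
    · rintro ⟨π, s, h, rfl⟩
      exact (signedPerm_mem t n π s).2 h
  rw [kostkaFoulkes, himage, Finset.sum_image fun a _ b _ h => signedPerm_injective h,
    Finset.sum_filter, Fintype.sum_prod_type]
  refine Finset.sum_congr rfl fun π _ => Finset.sum_congr rfl fun s _ => ?_
  by_cases h : t = .D → ∏ i, s i = 1
  · rw [if_pos h, if_pos h]
    have h1 := neg_one_pow_weylLength t n π s ((signedPerm_mem t n π s).2 h)
    congr 1
    · rw [← h1]
      push_cast
      rfl
    · congr 2
      ext i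
      simp [weylAct, signedPerm_apply]
  · rw [if_neg h, if_neg h]

theorem kostkaFoulkes_eq_kfSum (t : ClassicalType) (ht : t ≠ .D) (n : ℕ) (lam mu : Fin n → ℚ) :
    kostkaFoulkes t n lam mu = kfSum t 1 n (lam + rho t n) (mu + rho t n) := by
  rw [kostkaFoulkes_eq_sum, kfSum, alternant]
  simp [ht]

/-- Half the sum of the trivial character and the product of signs is the indicator of an even
number of sign changes. -/
theorem two_mul_kostkaFoulkes_D (n : ℕ) (lam mu : Fin n → ℚ) :
    2 * kostkaFoulkes .D n lam mu = kfSum .D 0 n (lam + rho .D n) (mu + rho .D n) +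
      kfSum .D 1 n (lam + rho .D n) (mu + rho .D n) := by
  rw [kostkaFoulkes_eq_sum, kfSum, kfSum, alternant, alternant, Finset.mul_sum,
    ← Finset.sum_add_distrib]
  refine Finset.sum_congr rfl fun π _ => ?_
  rw [Finset.mul_sum, ← Finset.sum_add_distrib]
  refine Finset.sum_congr rfl fun s _ => ?_
  rcases Int.units_eq_one_or (∏ i, s i) with h | h
  · simp [h, two_mul]
  · simp [h]

/-! ### Weights shifted by `rho`, and the expansion in the rank -/

/-- Twice the last coordinate of the half sum of the positive roots. -/
def twiceShift : ClassicalType → ℕ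
  | .B => 1
  | .C => 2
  | .D => 0

/-- The vector `(a, b, d, 0, …, 0)` shifted by the half sum of the positive roots, whose last
coordinate is `k / 2`. -/
def wt (k n : ℕ) (a b d : ℚ) : Fin n → ℚ := fun i =>
  (k : ℚ) / 2 + ((n : ℚ) - 1 - (i : ℕ)) +
    (if (i : ℕ) = 0 then a else if (i : ℕ) = 1 then b else if (i : ℕ) = 2 then d else 0)

theorem rho_succ (t : ClassicalType) (n : ℕ) :
    rho t (n + 1) = Fin.cons ((n : ℚ) + twiceShift t / 2) (rho t n) := by
  have hsum : ∑ α ∈ posRoots t n, (Fin.cons 0 α : Fin (n + 1) → ℚ) =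
      Fin.cons 0 (∑ α ∈ posRoots t n, α) := by
    ext i
    refine Fin.cases ?_ (fun j => ?_) i <;> simp
  have hst : ∑ j, ((Fin.cons 1 (stdVec n j) : Fin (n + 1) → ℚ) + Fin.cons 1 (-stdVec n j)) =
      Fin.cons (2 * (n : ℚ)) 0 := by
    simp only [cons_add_cons, add_neg_cancel]
    ext i
    refine Fin.cases ?_ (fun j => ?_) i
    · simp
      ring
    · simp
  have hsh : shortSum t (fun α : Fin (n + 1) → ℚ => α) = Fin.cons (twiceShift t : ℚ) 0 := by
    cases t
    · simp [shortSum, twiceShift]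
    · simp [shortSum, twiceShift]
    · ext i
      refine Fin.cases ?_ (fun j => ?_) i <;> simp [shortSum, twiceShift]
  rw [rho, rho, sum_posRoots_succ t n (fun α => α), hst, hsh, hsum, cons_add_cons, cons_add_cons,
    smul_cons, add_zero]
  congr 1
  · ring
  · rw [zero_add, zero_add]

theorem rho_apply (t : ClassicalType) (n : ℕ) (i : Fin n) :
    rho t n i = (twiceShift t : ℚ) / 2 + ((n : ℚ) - 1 - (i : ℕ)) := by
  induction n with
  | zero => exact i.elim0
  | succ n ih =>
    rw [rho_succ]
    refine Fin.cases ?_ (fun j => ?_) i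
    · simp
      ring
    · rw [Fin.cons_succ, ih]
      push_cast [Fin.val_succ]
      ring

theorem tail_wt (k n : ℕ) (a b d : ℚ) : Fin.tail (wt k (n + 1) a b d) = wt k n b d 0 := by
  ext i
  simp only [Fin.tail, wt, Fin.val_succ, Nat.add_eq_zero_iff, one_ne_zero, and_false, if_false,
    Nat.reduceEqDiff, Nat.add_eq_right, ite_self]
  push_cast
  split_ifs <;> ring

theorem swap_tail_wt (k n : ℕ) (a b d : ℚ) :
    (fun i : Fin (n + 1) => wt k (n + 2) a b d (Equiv.swap 0 1 i.succ)) =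
      wt k (n + 1) (a + 1) d 0 := by
  ext i
  refine Fin.cases ?_ (fun j => ?_) i
  · simp [wt]
    ring
  · have h : Equiv.swap (0 : Fin (n + 2)) 1 j.succ.succ = j.succ.succ :=
      Equiv.swap_apply_of_ne_of_ne (Fin.succ_ne_zero _)
        (fun h => Fin.succ_ne_zero _ (Fin.succ_injective _ h))
    rw [h]
    simp only [wt, Fin.val_succ]
    push_cast
    split_ifs <;> ring

/-- The strict inequality fails for two zero vectors in type `D` of rank one, where a weight equals
its own negative; this is the origin of the factors two in type `D`. -/
theorem neg_wt_lt {k n : ℕ} {a b d m x y : ℚ} (hn : 0 < n) (ha : 0 ≤ a) (hb : 0 ≤ b) (hd : 0 ≤ d)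
    (hm : 0 ≤ m) (hk : 0 < k ∨ 2 ≤ n) (p : Fin n) : -wt k n a b d p < wt k n m x y ⟨0, hn⟩ := by
  have h1 : ((p : ℕ) : ℚ) + 1 ≤ n := by exact_mod_cast p.2
  have h2 : (0 : ℚ) ≤ k := Nat.cast_nonneg k
  have h3 : (1 : ℚ) ≤ n := by exact_mod_cast hn
  have h4 : (1 : ℚ) ≤ k ∨ (2 : ℚ) ≤ n := by
    rcases hk with h | h
    · exact Or.inl (by exact_mod_cast h)
    · exact Or.inr (by exact_mod_cast h)
  simp only [wt, if_true, Nat.cast_zero]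
  split_ifs <;> rcases h4 with h4 | h4 <;> linarith

/-- The recurrence between consecutive ranks. -/
theorem kfSum_wt (t : ClassicalType) (e n : ℕ) (a b d m x : ℚ) (ha : 0 ≤ a) (hb : 0 ≤ b)
    (hd : 0 ≤ d) (hm : 0 ≤ m) (hd' : d ≤ 1) :
    kfSum t e (n + 2) (wt (twiceShift t) (n + 2) a b d) (wt (twiceShift t) (n + 2) m x 0) =
      kfPart t e (n + 1) (a - m) (wt (twiceShift t) (n + 1) b d 0)
          (wt (twiceShift t) (n + 1) x 0 0) -
        kfPart t e (n + 1) (b - 1 - m) (wt (twiceShift t) (n + 1) (a + 1) d 0)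
          (wt (twiceShift t) (n + 1) x 0 0) := by
  rw [kfSum_succ_succ, swap_tail_wt, tail_wt, tail_wt]
  · congr 2
    · simp [wt]
    · simp [wt]
      ring
  · intro p
    exact neg_wt_lt (by omega) ha hb hd hm (Or.inr (by omega)) p
  · intro p
    have : (0 : ℚ) ≤ (p : ℕ) := Nat.cast_nonneg _
    simp only [wt, Fin.val_succ, Fin.val_zero]
    push_cast
    split_ifs <;> linarith

/-- In rank one both signs have to be kept: for `a = m = 0` in type `D` the second term does not
vanish. -/
theorem kfSum_wt_one (t : ClassicalType) (e : ℕ) (a b d m x : ℚ) :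
    kfSum t e 1 (wt (twiceShift t) 1 a b d) (wt (twiceShift t) 1 m x 0) =
      kfPart t e 0 (a - m) (wt (twiceShift t) 0 b d 0) (wt (twiceShift t) 0 x 0 0) +
        (-1) ^ e * kfPart t e 0 (-(a + m + twiceShift t)) (wt (twiceShift t) 0 b d 0)
          (wt (twiceShift t) 0 x 0 0) := by
  rw [kfSum_one, tail_wt, tail_wt]
  congr 2
  · simp [wt]
  · congr 1
    simp [wt]
    ring

/-! ### Straightening of alternating functions -/

section Alternating

variable {n e : ℕ} {F : (Fin n → ℚ) → ℤ[X]}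

theorem IsAlt.eq_zero (hF : IsAlt e F) {v : Fin n → ℚ} {i j : Fin n} (hij : i ≠ j)
    (h : v i = v j) : F v = 0 := by
  have h1 := hF.swap v i j hij
  have h2 : v ∘ Equiv.swap i j = v := by
    ext k
    simp only [Function.comp_apply, Equiv.swap_apply_def]
    split_ifs <;> simp_all
  rw [h2] at h1
  exact self_eq_neg.1 h1

theorem IsAlt.flip' (hF : IsAlt e F) (v : Fin n → ℚ) (i : Fin n) :
    F v = (-1) ^ e * F (Function.update v i (-v i)) := by
  rw [hF.flip, ← mul_assoc, ← pow_add, ← two_mul, pow_mul]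
  simp

theorem IsAlt.eq_zero_of_neg (hF : IsAlt e F) {v : Fin n → ℚ} {i j : Fin n} (hij : i ≠ j)
    (h : v i = -v j) : F v = 0 := by
  rw [hF.flip' v j, hF.eq_zero hij, mul_zero]
  simp [hij, h]

theorem IsAlt.eq_zero_of_zero (hF : IsAlt e F) (he : Odd e) {v : Fin n → ℚ} {i : Fin n}
    (h : v i = 0) : F v = 0 := by
  have h1 := hF.flip v i
  rw [h, neg_zero, ← h, Function.update_eq_self, he.neg_one_pow, neg_one_mul] at h1
  exact self_eq_neg.1 h1

theorem add_smul_stdVec_self (v : Fin n → ℚ) (m : ℚ) (i : Fin n) :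
    (v + m • stdVec n i) i = v i + m := by
  simp [stdVec]

theorem add_smul_stdVec_ne (v : Fin n → ℚ) (m : ℚ) {i j : Fin n} (h : j ≠ i) :
    (v + m • stdVec n i) j = v j := by
  simp [stdVec, h]

end Alternating

theorem IsAlt.swap01 {n e k : ℕ} {F : (Fin (n + 2) → ℚ) → ℤ[X]} (hF : IsAlt e F) (a b d : ℚ) :
    F (wt k (n + 2) a b d) = -F (wt k (n + 2) (b - 1) (a + 1) d) := by
  rw [← hF.swap _ 0 1 (by simp)]
  congr 1
  ext i
  refine Fin.cases ?_ (fun i => Fin.cases ?_ (fun j => ?_) i) i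
  · simp [wt]
    ring
  · simp [wt]
    ring
  · have h : Equiv.swap (0 : Fin (n + 2)) 1 j.succ.succ = j.succ.succ :=
      Equiv.swap_apply_of_ne_of_ne (Fin.succ_ne_zero _)
        (fun h => Fin.succ_ne_zero _ (Fin.succ_injective _ h))
    simp only [Function.comp_apply, h]
    simp [wt]

theorem IsAlt.swap12 {n e k : ℕ} {F : (Fin (n + 3) → ℚ) → ℤ[X]} (hF : IsAlt e F) (a b d : ℚ) :
    F (wt k (n + 3) a b d) = -F (wt k (n + 3) a (d - 1) (b + 1)) := by
  have h12 : ((1 : Fin (n + 3)) : ℕ) = 1 := rfl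
  have h22 : ((2 : Fin (n + 3)) : ℕ) = 2 := rfl
  rw [← hF.swap _ 1 2 (by rw [Ne, Fin.ext_iff, h12, h22]; omega)]
  congr 1
  ext i
  by_cases h1 : i = 1
  · subst h1
    simp only [wt, Function.comp_apply, Equiv.swap_apply_left, h12, h22]
    norm_num
    ring
  by_cases h2 : i = 2
  · subst h2
    simp only [wt, Function.comp_apply, Equiv.swap_apply_right, h12, h22]
    norm_num
    ring
  · have h : Equiv.swap (1 : Fin (n + 3)) 2 i = i := Equiv.swap_apply_of_ne_of_ne h1 h2
    have h1' : (i : ℕ) ≠ 1 := fun h => h1 (Fin.ext h)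
    have h2' : (i : ℕ) ≠ 2 := fun h => h2 (Fin.ext h)
    simp only [Function.comp_apply, h]
    simp [wt, h1', h2']

theorem IsAlt.eq01 {n e k : ℕ} {F : (Fin (n + 2) → ℚ) → ℤ[X]} (hF : IsAlt e F) (a d : ℚ) :
    F (wt k (n + 2) a (a + 1) d) = 0 := by
  have := hF.swap01 (k := k) a (a + 1) d
  rw [add_sub_cancel_right] at this
  exact self_eq_neg.1 this

theorem IsAlt.eq12 {n e k : ℕ} {F : (Fin (n + 3) → ℚ) → ℤ[X]} (hF : IsAlt e F) (a b : ℚ) :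
    F (wt k (n + 3) a b (b + 1)) = 0 := by
  have := hF.swap12 (k := k) a b (b + 1)
  rw [add_sub_cancel_right] at this
  exact self_eq_neg.1 this

theorem IsAlt.flip_one {e k : ℕ} {F : (Fin 1 → ℚ) → ℤ[X]} (hF : IsAlt e F) (a b d : ℚ) :
    F (wt k 1 a b d) = (-1) ^ e * F (wt k 1 (-k - a) b d) := by
  rw [hF.flip' _ 0]
  congr 2
  ext i
  fin_cases i
  simp [wt]
  ring

theorem IsAlt.flip_two {e k : ℕ} {F : (Fin 2 → ℚ) → ℤ[X]} (hF : IsAlt e F) (a b d : ℚ) :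
    F (wt k 2 a b d) = (-1) ^ e * F (wt k 2 a (-k - b) d) := by
  rw [hF.flip' _ 1]
  congr 2
  ext i
  fin_cases i
  · simp [wt]
  · simp [wt]
    ring

theorem IsAlt.flip_three {e k : ℕ} {F : (Fin 3 → ℚ) → ℤ[X]} (hF : IsAlt e F) (a b d : ℚ) :
    F (wt k 3 a b d) = (-1) ^ e * F (wt k 3 a b (-k - d)) := by
  rw [hF.flip' _ 2]
  congr 2
  ext i
  fin_cases i
  · simp [wt]
  · simp [wt]
  · simp [wt]
    ring

theorem wt_add_zero (k n : ℕ) (a b d m : ℚ) :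
    wt k (n + 1) a b d + m • stdVec (n + 1) 0 = wt k (n + 1) (a + m) b d := by
  ext i
  refine Fin.cases ?_ (fun j => ?_) i
  · simp [wt, stdVec]
    ring
  · simp [wt, stdVec]

theorem wt_add_one (k n : ℕ) (a b d m : ℚ) :
    wt k (n + 2) a b d + m • stdVec (n + 2) 1 = wt k (n + 2) a (b + m) d := by
  ext i
  by_cases h : i = 1
  · subst h
    simp [wt, stdVec]
    ring
  · have h' : (i : ℕ) ≠ 1 := fun h' => h (Fin.ext h')
    simp [wt, stdVec, h, h']

theorem wt_add_two (k n : ℕ) (a b d m : ℚ) :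
    wt k (n + 3) a b d + m • stdVec (n + 3) 2 = wt k (n + 3) a b (d + m) := by
  ext i
  by_cases h : i = 2
  · subst h
    have h22 : ((2 : Fin (n + 3)) : ℕ) = 2 := rfl
    simp only [wt, stdVec, Pi.add_apply, Pi.smul_apply, Pi.single_eq_same, h22]
    norm_num
    ring
  · have h' : (i : ℕ) ≠ 2 := fun h' => h (Fin.ext h')
    simp [wt, stdVec, h, h']

theorem shiftSum_eq {n : ℕ} (m : ℚ) (F : (Fin n → ℚ) → ℤ[X]) (v : Fin n → ℚ) :
    shiftSum m F v = ∑ i, F (v + m • stdVec n i) + ∑ i, F (v + (-m) • stdVec n i) := by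
  simp only [shiftSum, Finset.sum_add_distrib, neg_smul, sub_eq_add_neg]

theorem shiftSum_wt_one (k : ℕ) (m : ℚ) (F : (Fin 1 → ℚ) → ℤ[X]) (a b d : ℚ) :
    shiftSum m F (wt k 1 a b d) = F (wt k 1 (a + m) b d) + F (wt k 1 (a + -m) b d) := by
  rw [shiftSum_eq, Fin.sum_univ_one, Fin.sum_univ_one, wt_add_zero, wt_add_zero]

theorem shiftSum_wt_two (k : ℕ) (m : ℚ) (F : (Fin 2 → ℚ) → ℤ[X]) (a b d : ℚ) :
    shiftSum m F (wt k 2 a b d) = F (wt k 2 (a + m) b d) + F (wt k 2 a (b + m) d) +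
      (F (wt k 2 (a + -m) b d) + F (wt k 2 a (b + -m) d)) := by
  rw [shiftSum_eq, Fin.sum_univ_two, Fin.sum_univ_two, wt_add_zero, wt_add_zero, wt_add_one,
    wt_add_one]

theorem shiftSum_wt_three (k : ℕ) (m : ℚ) (F : (Fin 3 → ℚ) → ℤ[X]) (a b d : ℚ) :
    shiftSum m F (wt k 3 a b d) =
      F (wt k 3 (a + m) b d) + F (wt k 3 a (b + m) d) + F (wt k 3 a b (d + m)) +
      (F (wt k 3 (a + -m) b d) + F (wt k 3 a (b + -m) d) + F (wt k 3 a b (d + -m))) := by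
  rw [shiftSum_eq, Fin.sum_univ_three, Fin.sum_univ_three, wt_add_zero, wt_add_zero, wt_add_one,
    wt_add_one, wt_add_two, wt_add_two]

/-- Raising a coordinate far behind the nonzero coordinates gives a vector with two equal
coordinates. -/
theorem IsAlt.raise_tail {n e k l m : ℕ} {F : (Fin n → ℚ) → ℤ[X]} (hF : IsAlt e F)
    {v : Fin n → ℚ} (hv : ∀ i : Fin n, l ≤ i → v i = (k : ℚ) / 2 + ((n : ℚ) - 1 - (i : ℕ)))
    (hm : 0 < m) (i : Fin n) (hi : l + m ≤ i) : F (v + (m : ℚ) • stdVec n i) = 0 := by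
  have hlt := i.2
  -- Consecutive coordinates of the tail differ by 1, so raising the coordinate `i` by `m` makes it
  -- equal to the coordinate `i - m`.
  let j : Fin n := ⟨i - m, by omega⟩
  have hji : j ≠ i := fun h => by
    have := congrArg Fin.val h
    simp only [j] at this
    omega
  refine hF.eq_zero hji.symm (i := i) (j := j) ?_
  rw [add_smul_stdVec_self, add_smul_stdVec_ne _ _ hji, hv i (by omega),
    hv j (by simp only [j]; omega)]
  simp only [j]
  rw [Nat.cast_sub (by omega)]
  ring

/-- Lowering a coordinate behind the nonzero coordinates gives a vector with a collision, unless
the result differs from the original vector by one sign. -/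
theorem IsAlt.lower_tail {n e k l m : ℕ} {F : (Fin n → ℚ) → ℤ[X]} (hF : IsAlt e F)
    {v : Fin n → ℚ} (hv : ∀ i : Fin n, l ≤ i → v i = (k : ℚ) / 2 + ((n : ℚ) - 1 - (i : ℕ)))
    (hk : k ≤ 1 ∨ k = 2 ∧ Odd e) (hn : l + m + 1 ≤ n + k) (hm : 0 < m) (i : Fin n) (hi : l ≤ i) :
    F (v + (-(m : ℚ)) • stdVec n i) =
      if 2 * (n - 1 - (i : ℕ)) + k = m then (-1) ^ e * F v else 0 := by
  have hlt := i.2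
  split_ifs with h
  -- Here `v i = m / 2`, so lowering by `m` is the change of one sign.
  · rw [← hF.flip]
    congr 1
    ext j
    by_cases hj : j = i
    · subst hj
      rw [add_smul_stdVec_self, Function.update_self, hv _ hi, ← h]
      push_cast [Nat.sub_sub, Nat.cast_sub (show 1 + (j : ℕ) ≤ n by omega)]
      ring
    · rw [add_smul_stdVec_ne _ _ hj, Function.update_of_ne hj]
  · by_cases him : (i : ℕ) + m < n
    -- The lowered coordinate meets the coordinate `i + m`, which still exists.
    · let j : Fin n := ⟨i + m, him⟩
      have hji : j ≠ i := fun h => by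
        have := congrArg Fin.val h
        simp only [j] at this
        omega
      refine hF.eq_zero hji.symm (i := i) (j := j) ?_
      rw [add_smul_stdVec_self, add_smul_stdVec_ne _ _ hji, hv i hi,
        hv j (by simp only [j]; omega)]
      simp only [j]
      push_cast
      ring
    -- For `k = 2` the tail ends in 1, and the lowered coordinate may become 0; this vanishes by the
    -- oddness of `e`.
    · by_cases hz : k = 2 ∧ (i : ℕ) + m = n
      · refine hF.eq_zero_of_zero (by rcases hk with hk | hk; · omega
                                      · exact hk.2) (i := i) ?_
        have hq : ((i : ℕ) : ℚ) + m = n := by exact_mod_cast hz.2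
        rw [add_smul_stdVec_self, hv i hi, hz.1]
        push_cast
        linarith
      -- The index with `v j = -(v i - m)`. The bound `hn` keeps it inside the tail, and it differs
      -- from `i` because the case of a pure sign change is excluded.
      · let j : Fin n := ⟨2 * (n - 1) + k - i - m, by omega⟩
        have hji : j ≠ i := fun h => by
          have := congrArg Fin.val h
          simp only [j] at this
          omega
        refine hF.eq_zero_of_neg hji.symm (i := i) (j := j) ?_
        rw [add_smul_stdVec_self, add_smul_stdVec_ne _ _ hji, hv i hi,
          hv j (by simp only [j]; omega)]
        have hj : ((j : ℕ) : ℚ) + i + m = 2 * (n - 1) + k := by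
          have : (j : ℕ) + i + m + 2 = 2 * n + k := by
            simp only [j]
            omega
          have h2 : (((j : ℕ) + i + m + 2 : ℕ) : ℚ) = ((2 * n + k : ℕ) : ℚ) := by rw [this]
          push_cast at h2
          linarith
        linarith

/-- The condition says that the tail coordinate at `i` equals `m / 2`. At most one index qualifies,
and the bound on `m` guarantees that it lies in range when the parity is right. -/
theorem sum_reflect_ite {n : ℕ} (k m : ℕ) (hn : m < 2 * n + k) (y : ℤ[X]) :
    (∑ i : Fin n, if 2 * (n - 1 - (i : ℕ)) + k = m then y else 0) =
      if k ≤ m ∧ Even (m - k) then y else 0 := by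
  split_ifs with h
  · obtain ⟨h1, x, hx⟩ := h
    rw [Finset.sum_eq_single ⟨n - 1 - x, by omega⟩, if_pos]
    · simp only
      omega
    · intro i _ hi
      rw [if_neg]
      intro h
      have := i.2
      exact hi (Fin.ext (by simp only; omega))
    · simp
  · refine Finset.sum_eq_zero fun i _ => if_neg fun h' => h ⟨by omega, ⟨n - 1 - i, by omega⟩⟩

/-- The shift sum of an alternating function at a vector with few nonzero coordinates. -/
theorem IsAlt.shiftSum_eq {n e k l m : ℕ} {F : (Fin n → ℚ) → ℤ[X]} (hF : IsAlt e F)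
    {v : Fin n → ℚ} (hv : ∀ i : Fin n, l ≤ i → v i = (k : ℚ) / 2 + ((n : ℚ) - 1 - (i : ℕ)))
    (hk : k ≤ 1 ∨ k = 2 ∧ Odd e) (hn : l + m + 1 ≤ n + k) (hm : 0 < m) (hln : l + m ≤ n) :
    shiftSum (m : ℚ) F v =
      (∑ i : Fin n, if (i : ℕ) < l + m then F (v + (m : ℚ) • stdVec n i) else 0) +
      (∑ i : Fin n, if (i : ℕ) < l then F (v + (-(m : ℚ)) • stdVec n i) else 0) +
      if k ≤ m ∧ Even (m - k) then (-1) ^ e * F v else 0 := by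
  rw [KostkaFoulkes.shiftSum_eq, add_assoc]
  congr 1
  · refine Finset.sum_congr rfl fun i _ => ?_
    split_ifs with h
    · rfl
    · exact hF.raise_tail hv hm i (not_lt.1 h)
  · rw [← sum_reflect_ite (n := n) k m (by omega), ← Finset.sum_add_distrib]
    refine Finset.sum_congr rfl fun i _ => ?_
    split_ifs with h1 h2 h2
    · have := i.2
      omega
    · rw [add_zero]
    · rw [hF.lower_tail hv hk hn hm i (not_lt.1 h1), if_pos h2, zero_add]
    · rw [hF.lower_tail hv hk hn hm i (not_lt.1 h1), if_neg h2, zero_add]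

section Straightening

variable {n e k : ℕ} {a b d : ℚ}

/-- The inequality here and in the next lemmas orients the involutive identities: used as rewriting
rules they act only on vectors that are out of order or negative, so straightening terminates. -/
theorem IsAlt.sort01 {F : (Fin (n + 2) → ℚ) → ℤ[X]} (hF : IsAlt e F) (_ : a + 1 < b) :
    F (wt k (n + 2) a b d) = -F (wt k (n + 2) (b - 1) (a + 1) d) := hF.swap01 a b d

theorem IsAlt.sort12 {F : (Fin (n + 3) → ℚ) → ℤ[X]} (hF : IsAlt e F) (_ : b + 1 < d) :
    F (wt k (n + 3) a b d) = -F (wt k (n + 3) a (d - 1) (b + 1)) := hF.swap12 a b d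

theorem IsAlt.vanish01 {F : (Fin (n + 2) → ℚ) → ℤ[X]} (hF : IsAlt e F) (h : b = a + 1) :
    F (wt k (n + 2) a b d) = 0 := by rw [h, hF.eq01]

theorem IsAlt.vanish12 {F : (Fin (n + 3) → ℚ) → ℤ[X]} (hF : IsAlt e F) (h : d = b + 1) :
    F (wt k (n + 3) a b d) = 0 := by rw [h, hF.eq12]

theorem IsAlt.reflect_one {F : (Fin 1 → ℚ) → ℤ[X]} (hF : IsAlt e F) (_ : 2 * a + k < 0) :
    F (wt k 1 a b d) = (-1) ^ e * F (wt k 1 (-k - a) b d) := hF.flip_one a b d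

theorem IsAlt.reflect_two {F : (Fin 2 → ℚ) → ℤ[X]} (hF : IsAlt e F) (_ : 2 * b + k < 0) :
    F (wt k 2 a b d) = (-1) ^ e * F (wt k 2 a (-k - b) d) := hF.flip_two a b d

theorem IsAlt.reflect_three {F : (Fin 3 → ℚ) → ℤ[X]} (hF : IsAlt e F) (_ : 2 * d + k < 0) :
    F (wt k 3 a b d) = (-1) ^ e * F (wt k 3 a b (-k - d)) := hF.flip_three a b d

theorem IsAlt.vanish_one {F : (Fin 1 → ℚ) → ℤ[X]} (hF : IsAlt e F) (he : Odd e)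
    (h : 2 * a + k = 0) : F (wt k 1 a b d) = 0 := by
  have h1 := hF.flip_one (k := k) a b d
  rw [he.neg_one_pow, show -(k : ℚ) - a = a by linarith, neg_one_mul] at h1
  exact self_eq_neg.1 h1

theorem IsAlt.vanish_two {F : (Fin 2 → ℚ) → ℤ[X]} (hF : IsAlt e F) (he : Odd e)
    (h : 2 * b + k = 0) : F (wt k 2 a b d) = 0 := by
  have h1 := hF.flip_two (k := k) a b d
  rw [he.neg_one_pow, show -(k : ℚ) - b = b by linarith, neg_one_mul] at h1
  exact self_eq_neg.1 h1

end Straightening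

/-! ### Power sums acting on small characters, and modification rules -/

/-- The operator on functions of vectors that corresponds to the power sum of the weights of the
defining representation. -/
noncomputable def powerShift (t : ClassicalType) {n : ℕ} (m : ℚ) (F : (Fin n → ℚ) → ℤ[X]) :
    (Fin n → ℚ) → ℤ[X] := fun v =>
  shiftSum m F v + match t with
    | .B => F v
    | .C => 0
    | .D => 0

/-- Linear functionals on functions of vectors. -/
abbrev Functional (n : ℕ) : Type := ((Fin n → ℚ) → ℤ[X]) →ₗ[ℤ[X]] ℤ[X]

/-- Evaluation at `(a, b, d, 0, …, 0) + ρ`. -/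
noncomputable def ev (k n : ℕ) (a b d : ℚ) : Functional n := LinearMap.proj (wt k n a b d)

theorem ev_apply (k n : ℕ) (a b d : ℚ) (F : (Fin n → ℚ) → ℤ[X]) :
    ev k n a b d F = F (wt k n a b d) := rfl

/-- Functionals attached to the partitions of size at most three. -/
structure Functionals (n : ℕ) where
  l0 : Functional n
  l1 : Functional n
  l2 : Functional n
  l11 : Functional n
  l3 : Functional n
  l21 : Functional n
  l111 : Functional n

/-- Evaluation at the seven partitions. -/
noncomputable def evals (k n : ℕ) : Functionals n where
  l0 := ev k n 0 0 0
  l1 := ev k n 1 0 0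
  l2 := ev k n 2 0 0
  l11 := ev k n 1 1 0
  l3 := ev k n 3 0 0
  l21 := ev k n 2 1 0
  l111 := ev k n 1 1 1

/-- The functionals that extend the evaluations at partitions with at most `n` parts by the
modification rules for longer partitions; in type `D` a partition with `n` parts counts twice,
as the character of the orthogonal group splits. -/
noncomputable def functionals : (t : ClassicalType) → (n : ℕ) → Functionals n
  -- In rank zero the defining character is 1 in type `B` and 0 in type `C`. For instance the
  -- orthogonal `(2, 1)` becomes `-1`, and the symplectic `(1, 1)`, the exterior square minus the
  -- trivial character, becomes `-1`.
  | .B, 0 => ⟨ev 1 0 0 0 0, ev 1 0 0 0 0, 0, 0, 0, -ev 1 0 0 0 0, 0⟩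
  | .B, 1 => { evals 1 1 with
      l11 := ev 1 1 1 0 0
      l21 := ev 1 1 2 0 0
      l111 := ev 1 1 0 0 0 }
  | .B, 2 => { evals 1 2 with l111 := ev 1 2 1 1 0 }
  | .B, n + 3 => evals 1 (n + 3)
  | .C, 0 => ⟨ev 2 0 0 0 0, 0, 0, -ev 2 0 0 0 0, 0, 0, 0⟩
  | .C, 1 => { evals 2 1 with
      l11 := 0
      l21 := 0
      l111 := -ev 2 1 1 0 0 }
  | .C, 2 => { evals 2 2 with l111 := 0 }
  | .C, n + 3 => evals 2 (n + 3)
  | .D, 0 => evals 0 0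
  -- The values stand for twice the orthogonal characters: evaluation at `rho`, whose last
  -- coordinate is 0, already counts each term twice, whereas a nonzero last coordinate needs the
  -- factor 2. The partition `(1, 1)` is the determinant character, which restricts to the trivial
  -- one.
  | .D, 1 => ⟨ev 0 1 0 0 0, (2 : ℤ[X]) • ev 0 1 1 0 0, (2 : ℤ[X]) • ev 0 1 2 0 0, ev 0 1 0 0 0,
      (2 : ℤ[X]) • ev 0 1 3 0 0, 0, 0⟩
  | .D, 2 => { evals 0 2 with
      l11 := (2 : ℤ[X]) • ev 0 2 1 1 0
      l21 := (2 : ℤ[X]) • ev 0 2 2 1 0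
      l111 := ev 0 2 1 0 0 }
  | .D, 3 => { evals 0 3 with l111 := (2 : ℤ[X]) • ev 0 3 1 1 1 }
  | .D, n + 4 => evals 0 (n + 4)

/-- The exponent of the sign character. -/
def signExp : ClassicalType → ℕ
  | .D => 0
  | _ => 1

/-- The coefficient by which the second power sum acts on the trivial character. -/
noncomputable def trivCoeff : ClassicalType → ℤ[X]
  | .C => -1
  | _ => 1

/-- The action of the power sums of the weights on small characters. -/
structure Functionals.IsUniversal {n : ℕ} (L : Functionals n) (t : ClassicalType) (e : ℕ) :
    Prop where
  p1_0 : ∀ F, IsAlt e F → L.l0 (powerShift t 1 F) = L.l1 F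
  p1_1 : ∀ F, IsAlt e F → L.l1 (powerShift t 1 F) = L.l2 F + L.l11 F + L.l0 F
  p1_2 : ∀ F, IsAlt e F → L.l2 (powerShift t 1 F) = L.l3 F + L.l21 F + L.l1 F
  p1_11 : ∀ F, IsAlt e F → L.l11 (powerShift t 1 F) = L.l21 F + L.l111 F + L.l1 F
  p2_0 : ∀ F, IsAlt e F → L.l0 (powerShift t 2 F) = L.l2 F - L.l11 F + trivCoeff t * L.l0 F
  p2_1 : ∀ F, IsAlt e F → L.l1 (powerShift t 2 F) = L.l3 F - L.l111 F + trivCoeff t * L.l1 F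
  p3_0 : ∀ F, IsAlt e F → L.l0 (powerShift t 3 F) = L.l3 F - L.l21 F + L.l111 F

theorem sum_lt_zero {N : ℕ} (f : Fin N → ℤ[X]) :
    (∑ i : Fin N, if (i : ℕ) < 0 then f i else 0) = 0 := by
  simp

theorem sum_lt_one {N : ℕ} (f : Fin (N + 3) → ℤ[X]) :
    (∑ i : Fin (N + 3), if (i : ℕ) < 1 then f i else 0) = f 0 := by
  simp

theorem sum_lt_two {N : ℕ} (f : Fin (N + 3) → ℤ[X]) :
    (∑ i : Fin (N + 3), if (i : ℕ) < 2 then f i else 0) = f 0 + f 1 := by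
  simp [Fin.sum_univ_succ]

theorem sum_lt_three {N : ℕ} (f : Fin (N + 3) → ℤ[X]) :
    (∑ i : Fin (N + 3), if (i : ℕ) < 3 then f i else 0) = f 0 + f 1 + f 2 := by
  rw [Fin.sum_univ_succ, Fin.sum_univ_succ, Fin.sum_univ_succ, Finset.sum_eq_zero]
  · simp [add_assoc]
    rfl
  · intro i _
    simp

/-- The terms proportional to `F v` become uniform. In type `B` the zero weight cancels the
reflected term for odd `m` and survives for `m = 2`; in types `C` and `D` only `m = 2` has a
reflected term, with sign `-1` and `1` respectively. -/
theorem powerShift_generic (t : ClassicalType) {N l m : ℕ}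
    {F : (Fin (N + 3) → ℚ) → ℤ[X]} (hF : IsAlt (signExp t) F)
    (hN : 4 ≤ N + 3 + twiceShift t) {v : Fin (N + 3) → ℚ}
    (hv : ∀ i : Fin (N + 3), l ≤ i →
      v i = (twiceShift t : ℚ) / 2 + (((N + 3 : ℕ) : ℚ) - 1 - (i : ℕ)))
    (hm : 0 < m) (hlm : l + m ≤ 3) :
    powerShift t m F v =
      (∑ i : Fin (N + 3), if (i : ℕ) < l + m then F (v + (m : ℚ) • stdVec (N + 3) i) else 0) +
      (∑ i : Fin (N + 3), if (i : ℕ) < l then F (v + (-(m : ℚ)) • stdVec (N + 3) i) else 0) +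
      if m = 2 then trivCoeff t * F v else 0 := by
  have hk : twiceShift t ≤ 1 ∨ twiceShift t = 2 ∧ Odd (signExp t) := by
    cases t <;> simp [twiceShift, signExp]
  unfold powerShift
  rw [hF.shiftSum_eq hv hk (by omega) hm (by omega), add_assoc]
  congr 1
  have h3 : m ≤ 3 := by omega
  cases t <;> interval_cases m <;> simp [twiceShift, signExp, trivCoeff, Nat.even_iff]

theorem wt_tail_eq (k n l : ℕ) (a b d : ℚ) (ha : l ≤ 0 → a = 0) (hb : l ≤ 1 → b = 0)
    (hd : l ≤ 2 → d = 0) (i : Fin n) (hi : l ≤ i) :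
    wt k n a b d i = (k : ℚ) / 2 + ((n : ℚ) - 1 - (i : ℕ)) := by
  simp only [wt]
  split_ifs with h h h
  · rw [ha (by omega), add_zero]
  · rw [hb (by omega), add_zero]
  · rw [hd (by omega), add_zero]
  · rw [add_zero]

/-- These are the Pieri and Murnaghan–Nakayama rules, with the removal of a box added: raised
coordinates that are out of order straighten to signed hooks. The inequality excludes only type `D`
of rank three, where `(1, 1, 1)` has full length. -/
theorem evals_isUniversal (t : ClassicalType) (N : ℕ) (hN : 4 ≤ N + 3 + twiceShift t) :
    (evals (twiceShift t) (N + 3)).IsUniversal t (signExp t) := by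
  constructor <;> intro F hF <;> simp only [evals, ev_apply]
  · have h := powerShift_generic t hF hN (l := 0) (m := 1)
      (wt_tail_eq (twiceShift t) (N + 3) 0 0 0 0 (by simp) (by simp) (by simp)) (by simp) (by simp)
    simp only [Nat.zero_add, sum_lt_one, sum_lt_zero, wt_add_zero] at h
    norm_num at h
    exact h
  · have h := powerShift_generic t hF hN (l := 1) (m := 1)
      (wt_tail_eq (twiceShift t) (N + 3) 1 1 0 0 (by simp) (by simp) (by simp)) (by simp) (by simp)
    simp only [Nat.reduceAdd, sum_lt_one, sum_lt_two, wt_add_zero, wt_add_one] at h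
    norm_num at h
    exact h
  · have h := powerShift_generic t hF hN (l := 1) (m := 1)
      (wt_tail_eq (twiceShift t) (N + 3) 1 2 0 0 (by simp) (by simp) (by simp)) (by simp) (by simp)
    simp only [Nat.reduceAdd, sum_lt_one, sum_lt_two, wt_add_zero, wt_add_one] at h
    norm_num at h
    exact h
  · have h := powerShift_generic t hF hN (l := 2) (m := 1)
      (wt_tail_eq (twiceShift t) (N + 3) 2 1 1 0 (by simp) (by simp) (by simp)) (by simp) (by simp)
    simp only [Nat.reduceAdd, sum_lt_three, sum_lt_two, wt_add_zero, wt_add_one, wt_add_two] at h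
    norm_num [hF.vanish01] at h
    exact h
  · have h := powerShift_generic t hF hN (l := 0) (m := 2)
      (wt_tail_eq (twiceShift t) (N + 3) 0 0 0 0 (by simp) (by simp) (by simp)) (by simp) (by simp)
    simp only [Nat.zero_add, sum_lt_two, sum_lt_zero, wt_add_zero, wt_add_one] at h
    norm_num [hF.sort01] at h
    rw [h]
    ring
  · have h := powerShift_generic t hF hN (l := 1) (m := 2)
      (wt_tail_eq (twiceShift t) (N + 3) 1 1 0 0 (by simp) (by simp) (by simp)) (by simp) (by simp)
    simp only [Nat.reduceAdd, sum_lt_three, sum_lt_one, wt_add_zero, wt_add_one, wt_add_two] at h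
    norm_num [hF.vanish01, hF.sort12] at h
    rw [h]
    ring
  · have h := powerShift_generic t hF hN (l := 0) (m := 3)
      (wt_tail_eq (twiceShift t) (N + 3) 0 0 0 0 (by simp) (by simp) (by simp)) (by simp) (by simp)
    simp only [Nat.zero_add, sum_lt_three, sum_lt_zero, wt_add_zero, wt_add_one, wt_add_two] at h
    norm_num [hF.sort01, hF.sort12] at h
    rw [h]
    ring

/-- Having the same rules in every rank is what lets one induction cover all ranks. In small rank
they are verified by direct straightening. -/
theorem functionals_isUniversal (t : ClassicalType) (n : ℕ) (hn : t = .D → 0 < n) :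
    (functionals t n).IsUniversal t (signExp t) := by
  match t, n with
  | .B, 0 =>
    constructor <;> intro F hF <;> simp [functionals, ev_apply, powerShift, shiftSum, trivCoeff]
  | .C, 0 =>
    constructor <;> intro F hF <;> simp [functionals, ev_apply, powerShift, shiftSum, trivCoeff]
  -- Rank zero in type `D` is left out: `evals 0 0` sends every partition to the same evaluation,
  -- which contradicts already the rule for `p_1` on `∅`.
  | .D, 0 => exact absurd (hn rfl) (lt_irrefl 0)
  | .B, 1 =>
    constructor <;> intro F hF <;>
      norm_num [functionals, evals, ev_apply, powerShift, shiftSum_wt_one, trivCoeff,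
        hF.reflect_one, signExp] <;> ring
  | .C, 1 =>
    constructor <;> intro F hF <;>
      norm_num [functionals, evals, ev_apply, powerShift, shiftSum_wt_one, trivCoeff,
        hF.reflect_one, hF.vanish_one (by simp [signExp]), signExp]
  | .D, 1 =>
    constructor <;> intro F hF <;>
      norm_num [functionals, evals, ev_apply, powerShift, shiftSum_wt_one, trivCoeff,
        hF.reflect_one, signExp] <;> ring
  | .B, 2 =>
    constructor <;> intro F hF <;>
      norm_num [functionals, evals, ev_apply, powerShift, shiftSum_wt_two, trivCoeff,
        hF.reflect_two, hF.sort01, hF.vanish01, signExp] <;> ring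
  | .C, 2 =>
    constructor <;> intro F hF <;>
      norm_num [functionals, evals, ev_apply, powerShift, shiftSum_wt_two, trivCoeff,
        hF.reflect_two, hF.vanish_two (by simp [signExp]), hF.sort01, hF.vanish01, signExp] <;> ring
  | .D, 2 =>
    constructor <;> intro F hF <;>
      norm_num [functionals, evals, ev_apply, powerShift, shiftSum_wt_two, trivCoeff,
        hF.reflect_two, hF.sort01, hF.vanish01, signExp] <;> ring
  | .D, 3 =>
    constructor <;> intro F hF <;>
      norm_num [functionals, evals, ev_apply, powerShift, shiftSum_wt_three, trivCoeff,
        hF.reflect_three, hF.sort01, hF.vanish01, hF.sort12, hF.vanish12, signExp] <;> ring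
  | .B, n + 3 => exact evals_isUniversal .B n (by simp [twiceShift])
  | .C, n + 3 => exact evals_isUniversal .C n (by simp [twiceShift])
  | .D, n + 4 => exact evals_isUniversal .D (n + 1) (by omega)

/-! ### Rows of the table and Newton's identity up to degree three -/

/-- One row of the table as a function of the column. -/
noncomputable def row (t : ClassicalType) (n : ℕ) (m x : ℚ) (v : Fin n → ℚ) : ℤ[X] :=
  kfSum t (signExp t) n v (wt (twiceShift t) n m x 0)

/-- The part of a row in rank `n + 1` in which the first coordinate drops by `R`. -/
noncomputable def part (t : ClassicalType) (n : ℕ) (R x : ℚ) (v : Fin n → ℚ) : ℤ[X] :=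
  kfPart t (signExp t) n R v (wt (twiceShift t) n x 0 0)

theorem isAlt_part (t : ClassicalType) (n : ℕ) (R x : ℚ) : IsAlt (signExp t) (part t n R x) :=
  isAlt_kfPart _ _ _ _ _

theorem part_zero (t : ClassicalType) (n : ℕ) (x : ℚ) : part t n 0 x = row t n x 0 := by
  ext1 v
  exact kfPart_zero _ _ _ _ _

theorem part_neg (t : ClassicalType) (n : ℕ) (R x : ℚ) (hR : R < 0) : part t n R x = 0 := by
  ext1 v
  exact kfPart_neg _ _ _ _ hR _ _

/-- `1` in type `C`, where twice a basis vector is a root. -/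
noncomputable def longCoeff : ClassicalType → ℤ[X]
  | .C => 1
  | .B => 0
  | .D => 0

theorem trivCoeff_eq (t : ClassicalType) : trivCoeff t = 1 - 2 * longCoeff t := by
  cases t <;> norm_num [trivCoeff, longCoeff]

/-- In type `B` the root `ε 0` supplies the zero weight in `powerShift`; in type `C` the root `2 ε
0` is too long to contribute to a drop by one. -/
theorem part_one (t : ClassicalType) (n : ℕ) (x : ℚ) :
    part t n 1 x = (X : ℤ[X]) • powerShift t 1 (row t n x 0) := by
  ext1 v
  have h := kfPart_rec t (signExp t) n 1 v (wt (twiceShift t) n x 0 0)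
  have hp : ∀ R, (fun v => kfPart t (signExp t) n R v (wt (twiceShift t) n x 0 0)) =
      part t n R x := fun _ => rfl
  rw [← part_zero]
  simp only [Finset.sum_range_one, hp] at h
  norm_num at h
  simp only [part, Pi.smul_apply, smul_eq_mul, powerShift]
  rw [h]
  cases t
  · simp
  · simp [kfPart_neg]
  · simp

/-- The last summand is the single copy of `2 ε 0` that fits into a drop by two; two copies would
make the remaining drop negative. -/
theorem part_two (t : ClassicalType) (n : ℕ) (x : ℚ) :
    (2 : ℤ[X]) • part t n 2 x = (X : ℤ[X]) • powerShift t 1 (part t n 1 x) +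
      (X ^ 2 : ℤ[X]) • powerShift t 2 (row t n x 0) +
      (2 * longCoeff t * X : ℤ[X]) • row t n x 0 := by
  ext1 v
  have h := kfPart_rec t (signExp t) n 2 v (wt (twiceShift t) n x 0 0)
  have hp : ∀ R, (fun v => kfPart t (signExp t) n R v (wt (twiceShift t) n x 0 0)) =
      part t n R x := fun _ => rfl
  rw [← part_zero]
  simp only [Finset.sum_range_succ, Finset.sum_range_zero, hp] at h
  norm_num at h
  simp only [part, Pi.smul_apply, Pi.add_apply, smul_eq_mul, powerShift]
  rw [h]
  cases t
  · simp [longCoeff]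
  · simp [longCoeff, kfPart_neg]
    ring
  · simp [longCoeff]

theorem part_three (t : ClassicalType) (n : ℕ) (x : ℚ) :
    (3 : ℤ[X]) • part t n 3 x = (X : ℤ[X]) • powerShift t 1 (part t n 2 x) +
      (X ^ 2 : ℤ[X]) • powerShift t 2 (part t n 1 x) +
      (X ^ 3 : ℤ[X]) • powerShift t 3 (row t n x 0) +
      (2 * longCoeff t * X : ℤ[X]) • part t n 1 x := by
  ext1 v
  have h := kfPart_rec t (signExp t) n 3 v (wt (twiceShift t) n x 0 0)
  have hp : ∀ R, (fun v => kfPart t (signExp t) n R v (wt (twiceShift t) n x 0 0)) =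
      part t n R x := fun _ => rfl
  rw [← part_zero]
  simp only [Finset.sum_range_succ, Finset.sum_range_zero, hp] at h
  norm_num at h
  simp only [part, Pi.smul_apply, Pi.add_apply, smul_eq_mul, powerShift]
  rw [h]
  cases t
  · simp [longCoeff]
  · simp [longCoeff, kfPart_neg]
    ring
  · simp [longCoeff]

section Characters

variable {t : ClassicalType} {n : ℕ} {L : Functionals n}

theorem Functionals.IsUniversal.part_one_0 (h : L.IsUniversal t (signExp t)) (x : ℚ) :
    L.l0 (part t n 1 x) = X * L.l1 (row t n x 0) := by
  rw [part_one, map_smul, smul_eq_mul, ← part_zero, h.p1_0 _ (isAlt_part _ _ _ _)]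

theorem Functionals.IsUniversal.part_one_1 (h : L.IsUniversal t (signExp t)) (x : ℚ) :
    L.l1 (part t n 1 x) =
      X * (L.l2 (row t n x 0) + L.l11 (row t n x 0) + L.l0 (row t n x 0)) := by
  rw [part_one, map_smul, smul_eq_mul, ← part_zero, h.p1_1 _ (isAlt_part _ _ _ _)]

theorem Functionals.IsUniversal.part_one_2 (h : L.IsUniversal t (signExp t)) (x : ℚ) :
    L.l2 (part t n 1 x) =
      X * (L.l3 (row t n x 0) + L.l21 (row t n x 0) + L.l1 (row t n x 0)) := by
  rw [part_one, map_smul, smul_eq_mul, ← part_zero, h.p1_2 _ (isAlt_part _ _ _ _)]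

theorem Functionals.IsUniversal.part_one_11 (h : L.IsUniversal t (signExp t)) (x : ℚ) :
    L.l11 (part t n 1 x) =
      X * (L.l21 (row t n x 0) + L.l111 (row t n x 0) + L.l1 (row t n x 0)) := by
  rw [part_one, map_smul, smul_eq_mul, ← part_zero, h.p1_11 _ (isAlt_part _ _ _ _)]

/-- In `2 h_2 = p_1 h_1 + p_2` the terms in `(1, 1)` cancel and the rest is even. What remains is
the symmetric square, `(2) + ∅` for orthogonal groups and `(2)` for symplectic ones; the long root
adds the term linear in `X`. -/
theorem Functionals.IsUniversal.part_two_0 (h : L.IsUniversal t (signExp t)) (x : ℚ) :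
    L.l0 (part t n 2 x) = X ^ 2 * (L.l2 (row t n x 0) + (1 - longCoeff t) * L.l0 (row t n x 0)) +
      longCoeff t * X * L.l0 (row t n x 0) := by
  have h1 := congrArg L.l0 (part_two t n x)
  simp only [map_add, map_smul, smul_eq_mul, h.p1_0 _ (isAlt_part _ _ _ _), h.part_one_1] at h1
  rw [h.p2_0 _ (part_zero t n x ▸ isAlt_part _ _ _ _), trivCoeff_eq] at h1
  refine mul_left_cancel₀ (two_ne_zero (α := ℤ[X])) ?_
  linear_combination h1

theorem Functionals.IsUniversal.part_two_1 (h : L.IsUniversal t (signExp t)) (x : ℚ) :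
    L.l1 (part t n 2 x) = X ^ 2 * (L.l3 (row t n x 0) + L.l21 (row t n x 0) +
        (2 - longCoeff t) * L.l1 (row t n x 0)) +
      longCoeff t * X * L.l1 (row t n x 0) := by
  have h1 := congrArg L.l1 (part_two t n x)
  simp only [map_add, map_smul, smul_eq_mul, h.p1_1 _ (isAlt_part _ _ _ _), h.part_one_2,
    h.part_one_11, h.part_one_0] at h1
  rw [h.p2_1 _ (part_zero t n x ▸ isAlt_part _ _ _ _), trivCoeff_eq] at h1
  refine mul_left_cancel₀ (two_ne_zero (α := ℤ[X])) ?_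
  linear_combination h1

/-- This is the symmetric cube: `(3) + (1)` for orthogonal groups and `(3)` for symplectic ones,
besides the contribution of the long root. All coefficients in Newton's identity are divisible by 3.
-/
theorem Functionals.IsUniversal.part_three_0 (h : L.IsUniversal t (signExp t)) (x : ℚ) :
    L.l0 (part t n 3 x) = X ^ 3 * (L.l3 (row t n x 0) + (1 - longCoeff t) * L.l1 (row t n x 0)) +
      longCoeff t * X ^ 2 * L.l1 (row t n x 0) := by
  have h1 := congrArg L.l0 (part_three t n x)
  simp only [map_add, map_smul, smul_eq_mul, h.p1_0 _ (isAlt_part _ _ _ _), h.part_two_1,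
    h.p2_0 _ (isAlt_part _ _ _ _), h.part_one_2, h.part_one_11, h.part_one_0] at h1
  rw [h.p3_0 _ (part_zero t n x ▸ isAlt_part _ _ _ _), trivCoeff_eq] at h1
  refine mul_left_cancel₀ (by norm_num : (3 : ℤ[X]) ≠ 0) ?_
  linear_combination h1

end Characters

/-! ### Recurrences in the rank -/

/-- The recurrence between the ranks `n + 1` and `n + 2`, in terms of functionals. -/
structure RankStep (t : ClassicalType) (n : ℕ) (m x : ℚ) : Prop where
  s0 : (functionals t (n + 2)).l0 (row t (n + 2) m x) =
    (functionals t (n + 1)).l0 (part t (n + 1) (-m) x)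
  s1 : (functionals t (n + 2)).l1 (row t (n + 2) m x) =
    (functionals t (n + 1)).l0 (part t (n + 1) (1 - m) x)
  s2 : (functionals t (n + 2)).l2 (row t (n + 2) m x) =
    (functionals t (n + 1)).l0 (part t (n + 1) (2 - m) x)
  s3 : (functionals t (n + 2)).l3 (row t (n + 2) m x) =
    (functionals t (n + 1)).l0 (part t (n + 1) (3 - m) x)
  s11 : (functionals t (n + 2)).l11 (row t (n + 2) m x) =
    (functionals t (n + 1)).l1 (part t (n + 1) (1 - m) x) -
      (functionals t (n + 1)).l2 (part t (n + 1) (-m) x)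
  s21 : (functionals t (n + 2)).l21 (row t (n + 2) m x) =
    (functionals t (n + 1)).l1 (part t (n + 1) (2 - m) x) -
      (functionals t (n + 1)).l3 (part t (n + 1) (-m) x)
  s111 : 0 < n → (functionals t (n + 2)).l111 (row t (n + 2) m x) =
    (functionals t (n + 1)).l11 (part t (n + 1) (1 - m) x) -
      (functionals t (n + 1)).l21 (part t (n + 1) (-m) x)

theorem row_wt (t : ClassicalType) (n : ℕ) (a b d m x : ℚ) (ha : 0 ≤ a) (hb : 0 ≤ b)
    (hd : 0 ≤ d) (hm : 0 ≤ m) (hd' : d ≤ 1) :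
    row t (n + 2) m x (wt (twiceShift t) (n + 2) a b d) =
      part t (n + 1) (a - m) x (wt (twiceShift t) (n + 1) b d 0) -
        part t (n + 1) (b - 1 - m) x (wt (twiceShift t) (n + 1) (a + 1) d 0) :=
  kfSum_wt t (signExp t) n a b d m x ha hb hd hm hd'

theorem rankStep (t : ClassicalType) (n : ℕ) (m x : ℚ) (hm : 0 ≤ m) : RankStep t n m x := by
  -- For columns with second part 0 the subtracted term has first coordinate `-1 - m` and
  -- disappears.
  have hneg : ∀ k : ℕ, part t k (-1 - m) x = 0 := fun k => part_neg t k _ x (by linarith)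
  have hw : ∀ a b d : ℚ, 0 ≤ a → 0 ≤ b → 0 ≤ d → d ≤ 1 →
      ev (twiceShift t) (n + 2) a b d (row t (n + 2) m x) =
        ev (twiceShift t) (n + 1) b d 0 (part t (n + 1) (a - m) x) -
          ev (twiceShift t) (n + 1) (a + 1) d 0 (part t (n + 1) (b - 1 - m) x) :=
    fun a b d ha hb hd hd' => row_wt t n a b d m x ha hb hd hm hd'
  have e0 := hw 0 0 0 (by norm_num) (by norm_num) (by norm_num) (by norm_num)
  have e1 := hw 1 0 0 (by norm_num) (by norm_num) (by norm_num) (by norm_num)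
  have e2 := hw 2 0 0 (by norm_num) (by norm_num) (by norm_num) (by norm_num)
  have e3 := hw 3 0 0 (by norm_num) (by norm_num) (by norm_num) (by norm_num)
  have e11 := hw 1 1 0 (by norm_num) (by norm_num) (by norm_num) (by norm_num)
  have e21 := hw 2 1 0 (by norm_num) (by norm_num) (by norm_num) (by norm_num)
  have e111 := hw 1 1 1 (by norm_num) (by norm_num) (by norm_num) (by norm_num)
  norm_num [hneg] at e0 e1 e2 e3 e11 e21 e111
  -- In type `D` a partition of full length has a remainder of full length in the rank below, so the
  -- factors 2 in the functionals match on both sides.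
  have double : ∀ {l : Functional (n + 2)} {l' l'' : Functional (n + 1)} {f g h},
      l f = l' g - l'' h → ((2 : ℤ[X]) • l) f = ((2 : ℤ[X]) • l') g - ((2 : ℤ[X]) • l'') h := by
    intro l l' l'' f g h H
    simp only [LinearMap.smul_apply, smul_eq_mul, H, mul_sub]
  have d11 := double e11
  have d21 := double e21
  have d111 := double e111
  cases t with
  | B =>
    obtain _ | _ | n := n
    · exact ⟨e0, e1, e2, e3, e11, e21, fun h => absurd h (lt_irrefl 0)⟩
    · exact ⟨e0, e1, e2, e3, e11, e21, fun _ => e111⟩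
    · exact ⟨e0, e1, e2, e3, e11, e21, fun _ => e111⟩
  | C =>
    obtain _ | _ | n := n
    · exact ⟨e0, e1, e2, e3, e11, e21, fun h => absurd h (lt_irrefl 0)⟩
    · exact ⟨e0, e1, e2, e3, e11, e21, fun _ => e111⟩
    · exact ⟨e0, e1, e2, e3, e11, e21, fun _ => e111⟩
  | D =>
    obtain _ | _ | _ | n := n
    · exact ⟨e0, e1, e2, e3, d11, d21, fun h => absurd h (lt_irrefl 0)⟩
    · exact ⟨e0, e1, e2, e3, e11, e21, fun _ => d111⟩
    · exact ⟨e0, e1, e2, e3, e11, e21, fun _ => e111⟩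
    · exact ⟨e0, e1, e2, e3, e11, e21, fun _ => e111⟩

theorem kfSum_rank_zero (t : ClassicalType) (e : ℕ) (v w : Fin 0 → ℚ) : kfSum t e 0 v w = 1 := by
  simp [kfSum, alternant, kostantQ_rank_zero]

theorem part_rank_zero (t : ClassicalType) (x : ℚ) : part t 0 0 x = 1 := by
  rw [part_zero]
  ext1 v
  exact kfSum_rank_zero _ _ _ _

theorem row_wt_one (t : ClassicalType) (a m x : ℚ) :
    ev (twiceShift t) 1 a 0 0 (row t 1 m x) = ev (twiceShift t) 0 0 0 0 (part t 0 (a - m) x) +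
      (-1) ^ signExp t * ev (twiceShift t) 0 0 0 0 (part t 0 (-(a + m + twiceShift t)) x) :=
  kfSum_wt_one t (signExp t) a 0 0 m x

theorem row_wt_one_of_ne (t : ClassicalType) (ht : t ≠ .D) (a m x : ℚ) (ha : 0 ≤ a) (hm : 0 ≤ m) :
    ev (twiceShift t) 1 a 0 0 (row t 1 m x) =
      ev (twiceShift t) 0 0 0 0 (part t 0 (a - m) x) := by
  have hk : (0 : ℚ) < twiceShift t := by
    cases t <;> simp [twiceShift] at ht ⊢
  rw [row_wt_one, part_neg t 0 (-(a + m + twiceShift t)) x (by linarith), map_zero, mul_zero,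
    add_zero]

theorem part_D_zero_one (x : ℚ) : part .D 0 1 x = 0 := by
  ext1 v
  rw [part_one]
  simp [powerShift, shiftSum]

theorem part_D_zero_two (x : ℚ) : part .D 0 2 x = 0 := by
  ext1 v
  have h := congrFun (part_two .D 0 x) v
  simp only [Pi.smul_apply, Pi.add_apply, smul_eq_mul, longCoeff] at h
  simp [powerShift, shiftSum] at h
  simpa using h

theorem part_D_zero_three (x : ℚ) : part .D 0 3 x = 0 := by
  ext1 v
  have h := congrFun (part_three .D 0 x) v
  simp only [Pi.smul_apply, Pi.add_apply, smul_eq_mul, longCoeff] at h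
  simp [powerShift, shiftSum] at h
  simpa using h

/-- The recurrence for the row of the empty partition. -/
structure NullStep {n : ℕ} (c : ℤ[X]) (S : Functionals (n + 2)) (f : (Fin (n + 2) → ℚ) → ℤ[X])
    (L : Functionals (n + 1)) (g : (Fin (n + 1) → ℚ) → ℤ[X]) : Prop where
  s0 : S.l0 f = L.l0 g
  s1 : S.l1 f = X * L.l1 g
  s2 : S.l2 f = X ^ 2 * (L.l2 g + (1 - c) * L.l0 g) + c * X * L.l0 g
  s3 : S.l3 f = X ^ 3 * (L.l3 g + (1 - c) * L.l1 g) + c * X ^ 2 * L.l1 g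
  s11 : S.l11 f = X * (L.l2 g + L.l11 g + L.l0 g) - L.l2 g
  s21 : S.l21 f = X ^ 2 * (L.l3 g + L.l21 g + (2 - c) * L.l1 g) + c * X * L.l1 g - L.l3 g
  s111 : 0 < n → S.l111 f = X * (L.l21 g + L.l111 g + L.l1 g) - L.l21 g

/-- The recurrence for the rows of partitions with first part `1`. -/
structure OneStep {n : ℕ} (c : ℤ[X]) (S : Functionals (n + 2)) (f : (Fin (n + 2) → ℚ) → ℤ[X])
    (L : Functionals (n + 1)) (g : (Fin (n + 1) → ℚ) → ℤ[X]) : Prop where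
  s0 : S.l0 f = 0
  s1 : S.l1 f = L.l0 g
  s2 : S.l2 f = X * L.l1 g
  s3 : S.l3 f = X ^ 2 * (L.l2 g + (1 - c) * L.l0 g) + c * X * L.l0 g
  s11 : S.l11 f = L.l1 g
  s21 : S.l21 f = X * (L.l2 g + L.l11 g + L.l0 g)
  s111 : 0 < n → S.l111 f = L.l11 g

/-- The recurrence for the row of the partition `(2)`. -/
structure TwoStep {n : ℕ} (S : Functionals (n + 2)) (f : (Fin (n + 2) → ℚ) → ℤ[X])
    (L : Functionals (n + 1)) (g : (Fin (n + 1) → ℚ) → ℤ[X]) : Prop where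
  s0 : S.l0 f = 0
  s1 : S.l1 f = 0
  s2 : S.l2 f = L.l0 g
  s3 : S.l3 f = X * L.l1 g
  s11 : S.l11 f = 0
  s21 : S.l21 f = L.l1 g
  s111 : 0 < n → S.l111 f = 0

theorem nullStep (t : ClassicalType) (n : ℕ) (x : ℚ) :
    NullStep (longCoeff t) (functionals t (n + 2)) (row t (n + 2) 0 x) (functionals t (n + 1))
      (row t (n + 1) x 0) := by
  have u := functionals_isUniversal t (n + 1) (fun _ => Nat.succ_pos n)
  obtain ⟨s0, s1, s2, s3, s11, s21, s111⟩ := rankStep t n 0 x le_rfl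
  simp only [neg_zero, sub_zero, part_zero, u.part_one_0, u.part_one_1, u.part_one_11,
    u.part_two_0, u.part_two_1, u.part_three_0] at s0 s1 s2 s3 s11 s21 s111
  exact ⟨s0, s1, s2, s3, s11, s21, s111⟩

theorem oneStep (t : ClassicalType) (n : ℕ) (x : ℚ) :
    OneStep (longCoeff t) (functionals t (n + 2)) (row t (n + 2) 1 x) (functionals t (n + 1))
      (row t (n + 1) x 0) := by
  have u := functionals_isUniversal t (n + 1) (fun _ => Nat.succ_pos n)
  have h1 : part t (n + 1) (-1) x = 0 := part_neg t (n + 1) (-1) x (by norm_num)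
  obtain ⟨s0, s1, s2, s3, s11, s21, s111⟩ := rankStep t n 1 x zero_le_one
  simp only [show (2 : ℚ) - 1 = 1 by norm_num, show (3 : ℚ) - 1 = 2 by norm_num, h1, sub_self,
    part_zero, map_zero, sub_zero, u.part_one_0, u.part_one_1, u.part_two_0]
    at s0 s1 s2 s3 s11 s21 s111
  exact ⟨s0, s1, s2, s3, s11, s21, s111⟩

theorem twoStep (t : ClassicalType) (n : ℕ) (x : ℚ) :
    TwoStep (functionals t (n + 2)) (row t (n + 2) 2 x) (functionals t (n + 1))
      (row t (n + 1) x 0) := by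
  have u := functionals_isUniversal t (n + 1) (fun _ => Nat.succ_pos n)
  have h1 : part t (n + 1) (-1) x = 0 := part_neg t (n + 1) (-1) x (by norm_num)
  have h2 : part t (n + 1) (-2) x = 0 := part_neg t (n + 1) (-2) x (by norm_num)
  obtain ⟨s0, s1, s2, s3, s11, s21, s111⟩ := rankStep t n 2 x zero_le_two
  simp only [show (1 : ℚ) - 2 = -1 by norm_num, show (3 : ℚ) - 2 = 1 by norm_num, h1, h2,
    sub_self, part_zero, map_zero, sub_zero, u.part_one_0] at s0 s1 s2 s3 s11 s21 s111
  exact ⟨s0, s1, s2, s3, s11, s21, s111⟩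

/-- The general formulas for `part` apply in rank zero too, where the modification rules collapse
them to these values; they start the induction on the rank. -/
theorem rank_zero_values (t : ClassicalType) (ht : t ≠ .D) :
    ev (twiceShift t) 0 0 0 0 (part t 0 0 0) = 1 ∧
    ev (twiceShift t) 0 0 0 0 (part t 0 1 0) = X * (1 - longCoeff t) ∧
    ev (twiceShift t) 0 0 0 0 (part t 0 2 0) = X ^ 2 * (1 - longCoeff t) + longCoeff t * X ∧
    ev (twiceShift t) 0 0 0 0 (part t 0 3 0) = X ^ 3 * (1 - longCoeff t) := by
  have u := functionals_isUniversal t 0 (fun h => absurd h ht)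
  have h0 : row t 0 0 0 = 1 := by rw [← part_zero, part_rank_zero]
  have t1 := u.part_one_0 0
  have t2 := u.part_two_0 0
  have t3 := u.part_three_0 0
  refine ⟨by rw [part_rank_zero]; rfl, ?_⟩
  rw [h0] at t1 t2 t3
  cases t
  · simp only [functionals, LinearMap.zero_apply, longCoeff, ev_apply, Pi.one_apply, twiceShift] at *
    exact ⟨by linear_combination t1, by linear_combination t2, by linear_combination t3⟩
  · simp only [functionals, LinearMap.zero_apply, longCoeff, ev_apply, Pi.one_apply, twiceShift] at *
    exact ⟨by linear_combination t1, by linear_combination t2, by linear_combination t3⟩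
  · exact absurd rfl ht

theorem rank_one_D (m : ℚ) (hm : 0 ≤ m) (a : ℚ) (ha : 0 < a) :
    ev 0 1 a 0 0 (row .D 1 m 0) = ev 0 0 0 0 0 (part .D 0 (a - m) 0) := by
  have h := row_wt_one .D a m 0
  rw [part_neg .D 0 (-(a + m + twiceShift .D)) 0 (by simp [twiceShift]; linarith), map_zero,
    mul_zero, add_zero] at h
  exact h

/-! ### Closed forms of the rows, with denominators cleared -/

/-- The row of the partition `∅` in type `B`. -/
structure NullRowB {n : ℕ} (L : Functionals n) (f : (Fin n → ℚ) → ℤ[X]) : Prop where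
  k0 : L.l0 f = 1
  k1 : L.l1 f = X ^ n
  k2 : (X ^ 2 - 1) * L.l2 f = X ^ 2 * (X ^ (2 * n) - 1)
  k11 : (X ^ 2 - 1) * L.l11 f = X * (X ^ (2 * n) - 1)
  k3 : (X ^ 2 - 1) * L.l3 f = X ^ (n + 2) * (X ^ (2 * n) - 1)
  k21 : (X - 1) * L.l21 f = X ^ n * (X ^ (2 * n) - X)
  k111 : X * (X ^ 2 - 1) * L.l111 f = X ^ n * (X ^ (2 * n) - 1)

/-- The row of the partition `(1)` in type `B`. -/
structure OneRowB {n : ℕ} (L : Functionals n) (f : (Fin n → ℚ) → ℤ[X]) : Prop where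
  k0 : L.l0 f = 0
  k1 : L.l1 f = 1
  k2 : L.l2 f = X ^ n
  k11 : X * L.l11 f = X ^ n
  k3 : (X ^ 2 - 1) * L.l3 f = X ^ 2 * (X ^ (2 * n) - 1)
  k21 : (X ^ 2 - 1) * L.l21 f = (X + 1) * (X ^ (2 * n) - X)
  k111 : X * (X ^ 2 - 1) * L.l111 f = X ^ (2 * n) - X ^ 2

/-- The row of the partition `(2)` in type `B`. -/
structure TwoRowB {n : ℕ} (L : Functionals n) (f : (Fin n → ℚ) → ℤ[X]) : Prop where
  k0 : L.l0 f = 0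
  k1 : L.l1 f = 0
  k2 : L.l2 f = 1
  k11 : L.l11 f = 0
  k3 : L.l3 f = X ^ n
  k21 : X * L.l21 f = X ^ n
  k111 : L.l111 f = 0

/-- The row of the partition `(1, 1)` in type `B`. -/
structure OneOneRowB {n : ℕ} (L : Functionals n) (f : (Fin n → ℚ) → ℤ[X]) : Prop where
  k0 : L.l0 f = 0
  k1 : L.l1 f = 0
  k2 : L.l2 f = X
  k11 : L.l11 f = 1
  k3 : L.l3 f = X ^ (n + 1)
  k21 : X * L.l21 f = X ^ (n + 1) + X ^ n
  k111 : X ^ 2 * L.l111 f = X ^ n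

/-- The row of the partition `∅` in type `C`. -/
structure NullRowC {n : ℕ} (L : Functionals n) (f : (Fin n → ℚ) → ℤ[X]) : Prop where
  k0 : L.l0 f = 1
  k1 : L.l1 f = 0
  k2 : (X ^ 2 - 1) * L.l2 f = X * (X ^ (2 * n) - 1)
  k11 : (X ^ 2 - 1) * L.l11 f = X ^ (2 * n) - X ^ 2
  k3 : L.l3 f = 0
  k21 : L.l21 f = 0
  k111 : L.l111 f = 0

/-- The row of the partition `(1)` in type `C`. -/
structure OneRowC {n : ℕ} (L : Functionals n) (f : (Fin n → ℚ) → ℤ[X]) : Prop where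
  k0 : L.l0 f = 0
  k1 : L.l1 f = 1
  k2 : L.l2 f = 0
  k11 : L.l11 f = 0
  k3 : (X ^ 2 - 1) * L.l3 f = X * (X ^ (2 * n) - 1)
  k21 : X * (X ^ 2 - 1) * L.l21 f = (X + 1) * (X ^ (2 * n) - X ^ 2)
  k111 : X ^ 2 * (X ^ 2 - 1) * L.l111 f = X ^ (2 * n) - X ^ 4

/-- The row of the partition `(2)` in type `C`. -/
structure TwoRowC {n : ℕ} (L : Functionals n) (f : (Fin n → ℚ) → ℤ[X]) : Prop where
  k0 : L.l0 f = 0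
  k1 : L.l1 f = 0
  k2 : L.l2 f = 1
  k11 : L.l11 f = 0
  k3 : L.l3 f = 0
  k21 : L.l21 f = 0
  k111 : L.l111 f = 0

/-- The row of the partition `(1, 1)` in type `C`. -/
structure OneOneRowC {n : ℕ} (L : Functionals n) (f : (Fin n → ℚ) → ℤ[X]) : Prop where
  k0 : L.l0 f = 0
  k1 : L.l1 f = 0
  k2 : L.l2 f = X
  k11 : L.l11 f = 1
  k3 : L.l3 f = 0
  k21 : L.l21 f = 0
  k111 : L.l111 f = 0

/-- The row of the partition `∅` in type `D`, doubled. -/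
structure NullRowD {n : ℕ} (L : Functionals n) (f : (Fin n → ℚ) → ℤ[X]) : Prop where
  k0 : L.l0 f = 2
  k1 : L.l1 f = 0
  k2 : (X ^ 2 - 1) * L.l2 f = 2 * (X ^ (2 * n) - X ^ 2)
  k11 : X * (X ^ 2 - 1) * L.l11 f = 2 * (X ^ n * (X ^ 2 - 1) + X ^ (2 * n) - X ^ 2)
  k3 : L.l3 f = 0
  k21 : L.l21 f = 0
  k111 : L.l111 f = 0

/-- The row of the partition `(1)` in type `D`, doubled. -/
structure OneRowD {n : ℕ} (L : Functionals n) (f : (Fin n → ℚ) → ℤ[X]) : Prop where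
  k0 : L.l0 f = 0
  k1 : L.l1 f = 2
  k2 : L.l2 f = 0
  k11 : L.l11 f = 0
  k3 : (X ^ 2 - 1) * L.l3 f = 2 * (X ^ (2 * n) - X ^ 2)
  k21 : X ^ 2 * (X ^ 2 - 1) * L.l21 f =
    2 * ((X + 1) * (X ^ (n + 1) * (X - 1) + X ^ (2 * n) - X ^ 3))
  k111 : X ^ 3 * (X ^ 2 - 1) * L.l111 f =
    2 * (X ^ (n + 1) * (X ^ 2 - 1) + X ^ (2 * n) - X ^ 4)

/-- The row of the partition `(2)` in type `D`, doubled. -/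
structure TwoRowD {n : ℕ} (L : Functionals n) (f : (Fin n → ℚ) → ℤ[X]) : Prop where
  k0 : L.l0 f = 0
  k1 : L.l1 f = 0
  k2 : L.l2 f = 2
  k11 : L.l11 f = 0
  k3 : L.l3 f = 0
  k21 : L.l21 f = 0
  k111 : L.l111 f = 0

/-- The row of the partition `(1, 1)` in type `D`, doubled. -/
structure OneOneRowD {n : ℕ} (L : Functionals n) (f : (Fin n → ℚ) → ℤ[X]) : Prop where
  k0 : L.l0 f = 0
  k1 : L.l1 f = 0
  k2 : L.l2 f = 2 * X
  k11 : L.l11 f = 2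
  k3 : L.l3 f = 0
  k21 : L.l21 f = 0
  k111 : L.l111 f = 0

theorem nullRowB (n : ℕ) : NullRowB (functionals .B n) (row .B n 0 0) := by
  induction n with
  | zero =>
    have h0 : row .B 0 0 0 = 1 := by rw [← part_zero, part_rank_zero]
    constructor <;> simp [functionals, h0, ev_apply]
  | succ n ih =>
    obtain _ | n := n
    · have ⟨v0, v1, v2, v3⟩ := rank_zero_values .B (by simp)
      have r := fun a ha => row_wt_one_of_ne .B (by simp) a 0 0 ha le_rfl
      simp only [twiceShift, longCoeff] at v0 v1 v2 v3 r
      have r0 := r 0 le_rfl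
      have r1 := r 1 zero_le_one
      have r2 := r 2 zero_le_two
      have r3 := r 3 (by norm_num)
      simp only [sub_zero, v0, v1, v2, v3] at r0 r1 r2 r3
      constructor <;> simp [functionals, evals, r0, r1, r2, r3] <;> ring
    · have ⟨k0, k1, k2, k11, k3, k21, k111⟩ := ih
      have ⟨s0, s1, s2, s3, s11, s21, s111⟩ := nullStep .B n 0
      simp only [longCoeff] at s2 s3 s21
      constructor
      · linear_combination s0 + k0
      · linear_combination s1 + X * k1
      · linear_combination (X ^ 2 - 1) * s2 + X ^ 2 * k2 + X ^ 2 * (X ^ 2 - 1) * k0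
      · linear_combination (X ^ 2 - 1) * s11 + (X - 1) * k2 + X * k11 + X * (X ^ 2 - 1) * k0
      · linear_combination (X ^ 2 - 1) * s3 + X ^ 3 * k3 + X ^ 3 * (X ^ 2 - 1) * k1
      · linear_combination (X - 1) * s21 + (X - 1) * k3 + X ^ 2 * k21 + 2 * X ^ 2 * (X - 1) * k1
      · obtain _ | n := n
        -- In rank two the column `(1, 1, 1)` is not covered by the recurrence; the modification
        -- rule identifies it with `(1, 1)`.
        · rw [show (functionals .B (0 + 2)).l111 = (functionals .B (0 + 2)).l11 from rfl]
          linear_combination X * (X ^ 2 - 1) * s11 + X * (X - 1) * k2 + X ^ 2 * k11 + X ^ 2 * (X ^ 2 - 1) * k0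
        · linear_combination X * (X ^ 2 - 1) * s111 (Nat.succ_pos n) + X * (X ^ 2 - 1) * k21 + X * k111 + X ^ 2 * (X ^ 2 - 1) * k1

theorem oneRowB (n : ℕ) :
    OneRowB (functionals .B (n + 1)) (row .B (n + 1) 1 0) := by
  obtain _ | n := n
  · have ⟨v0, v1, v2, v3⟩ := rank_zero_values .B (by simp)
    have r := fun a ha => row_wt_one_of_ne .B (by simp) a 1 0 ha (by norm_num)
    simp only [twiceShift, longCoeff] at v0 v1 v2 v3 r
    have h1 : part .B 0 (-1) 0 = 0 := part_neg .B 0 (-1) 0 (by norm_num)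
    have h2 : part .B 0 (-2) 0 = 0 := part_neg .B 0 (-2) 0 (by norm_num)
    have r0 := r 0 le_rfl
    have r1 := r 1 zero_le_one
    have r2 := r 2 zero_le_two
    have r3 := r 3 (by norm_num)
    norm_num [h1, h2, v0, v1, v2, v3] at r0 r1 r2 r3
    constructor <;> simp [functionals, evals, r0, r1, r2, r3] <;> ring
  · have ⟨k0, k1, k2, k11, k3, k21, k111⟩ := nullRowB (n + 1)
    have ⟨s0, s1, s2, s3, s11, s21, s111⟩ := oneStep .B n 0
    simp only [longCoeff] at s3
    constructor
    · linear_combination s0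
    · linear_combination s1 + k0
    · linear_combination s2 + X * k1
    · linear_combination X * s11 + X * k1
    · linear_combination (X ^ 2 - 1) * s3 + X ^ 2 * k2 + X ^ 2 * (X ^ 2 - 1) * k0
    · linear_combination (X ^ 2 - 1) * s21 + X * k2 + X * k11 + X * (X ^ 2 - 1) * k0
    · obtain _ | n := n
      · rw [show (functionals .B (0 + 2)).l111 = (functionals .B (0 + 2)).l11 from rfl]
        linear_combination X * (X ^ 2 - 1) * s11 + X * (X ^ 2 - 1) * k1
      · linear_combination X * (X ^ 2 - 1) * s111 (Nat.succ_pos n) + X * k11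

theorem twoRowB (n : ℕ) :
    TwoRowB (functionals .B (n + 1)) (row .B (n + 1) 2 0) := by
  obtain _ | n := n
  · have ⟨v0, v1, v2, v3⟩ := rank_zero_values .B (by simp)
    have r := fun a ha => row_wt_one_of_ne .B (by simp) a 2 0 ha (by norm_num)
    simp only [twiceShift, longCoeff] at v0 v1 v2 v3 r
    have h1 : part .B 0 (-1) 0 = 0 := part_neg .B 0 (-1) 0 (by norm_num)
    have h2 : part .B 0 (-2) 0 = 0 := part_neg .B 0 (-2) 0 (by norm_num)
    have r0 := r 0 le_rfl
    have r1 := r 1 zero_le_one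
    have r2 := r 2 zero_le_two
    have r3 := r 3 (by norm_num)
    norm_num [h1, h2, v0, v1, v2, v3] at r0 r1 r2 r3
    constructor <;> simp [functionals, evals, r0, r1, r2, r3]
  · have ⟨k0, k1, k2, k11, k3, k21, k111⟩ := nullRowB (n + 1)
    have ⟨s0, s1, s2, s3, s11, s21, s111⟩ := twoStep .B n 0
    constructor
    · linear_combination s0
    · linear_combination s1
    · linear_combination s2 + k0
    · linear_combination s11
    · linear_combination s3 + X * k1
    · linear_combination X * s21 + X * k1
    · obtain _ | n := n
      · rw [show (functionals .B (0 + 2)).l111 = (functionals .B (0 + 2)).l11 from rfl]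
        linear_combination s11
      · linear_combination s111 (Nat.succ_pos n)

/-- Removing the first part of `(1, 1)` leaves `(1)`, so this row comes from `oneRowB` one rank
lower without a new induction. -/
theorem oneOneRowB (n : ℕ) :
    OneOneRowB (functionals .B (n + 2)) (row .B (n + 2) 1 1) := by
  have ⟨k0, k1, k2, k11, k3, k21, k111⟩ := oneRowB n
  have ⟨s0, s1, s2, s3, s11, s21, s111⟩ := oneStep .B n 1
  simp only [longCoeff] at s3
  constructor
  · linear_combination s0
  · linear_combination s1 + k0
  · linear_combination s2 + X * k1
  · linear_combination s11 + k1
  · linear_combination s3 + X ^ 2 * k2 + X ^ 2 * k0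
  · linear_combination X * s21 + X ^ 2 * k2 + X * k11 + X ^ 2 * k0
  · obtain _ | n := n
    · rw [show (functionals .B (0 + 2)).l111 = (functionals .B (0 + 2)).l11 from rfl]
      linear_combination X ^ 2 * s11 + X ^ 2 * k1
    · linear_combination X ^ 2 * s111 (Nat.succ_pos n) + X * k11

theorem nullRowC (n : ℕ) : NullRowC (functionals .C n) (row .C n 0 0) := by
  induction n with
  | zero =>
    have h0 : row .C 0 0 0 = 1 := by rw [← part_zero, part_rank_zero]
    constructor <;> simp [functionals, h0, ev_apply]
  | succ n ih =>
    obtain _ | n := n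
    · have ⟨v0, v1, v2, v3⟩ := rank_zero_values .C (by simp)
      have r := fun a ha => row_wt_one_of_ne .C (by simp) a 0 0 ha le_rfl
      simp only [twiceShift, longCoeff] at v0 v1 v2 v3 r
      have r0 := r 0 le_rfl
      have r1 := r 1 zero_le_one
      have r2 := r 2 zero_le_two
      have r3 := r 3 (by norm_num)
      simp only [sub_zero, v0, v1, v2, v3] at r0 r1 r2 r3
      constructor <;> simp [functionals, evals, r0, r1, r2, r3] <;> ring
    · have ⟨k0, k1, k2, k11, k3, k21, k111⟩ := ih
      have ⟨s0, s1, s2, s3, s11, s21, s111⟩ := nullStep .C n 0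
      simp only [longCoeff] at s2 s3 s21
      constructor
      · linear_combination s0 + k0
      · linear_combination s1 + X * k1
      · linear_combination (X ^ 2 - 1) * s2 + X ^ 2 * k2 + X * (X ^ 2 - 1) * k0
      · linear_combination (X ^ 2 - 1) * s11 + (X - 1) * k2 + X * k11 + X * (X ^ 2 - 1) * k0
      · linear_combination s3 + X ^ 3 * k3 + X ^ 2 * k1
      · linear_combination s21 + (X ^ 2 - 1) * k3 + X ^ 2 * k21 + (X ^ 2 + X) * k1
      · obtain _ | n := n
        · simp [functionals]
        · linear_combination s111 (Nat.succ_pos n) + (X - 1) * k21 + X * k111 + X * k1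

theorem oneRowC (n : ℕ) :
    OneRowC (functionals .C (n + 1)) (row .C (n + 1) 1 0) := by
  obtain _ | n := n
  · have ⟨v0, v1, v2, v3⟩ := rank_zero_values .C (by simp)
    have r := fun a ha => row_wt_one_of_ne .C (by simp) a 1 0 ha (by norm_num)
    simp only [twiceShift, longCoeff] at v0 v1 v2 v3 r
    have h1 : part .C 0 (-1) 0 = 0 := part_neg .C 0 (-1) 0 (by norm_num)
    have h2 : part .C 0 (-2) 0 = 0 := part_neg .C 0 (-2) 0 (by norm_num)
    have r0 := r 0 le_rfl
    have r1 := r 1 zero_le_one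
    have r2 := r 2 zero_le_two
    have r3 := r 3 (by norm_num)
    norm_num [h1, h2, v0, v1, v2, v3] at r0 r1 r2 r3
    constructor <;> simp [functionals, evals, r0, r1, r2, r3] <;> ring
  · have ⟨k0, k1, k2, k11, k3, k21, k111⟩ := nullRowC (n + 1)
    have ⟨s0, s1, s2, s3, s11, s21, s111⟩ := oneStep .C n 0
    simp only [longCoeff] at s3
    constructor
    · linear_combination s0
    · linear_combination s1 + k0
    · linear_combination s2 + X * k1
    · linear_combination s11 + k1
    · linear_combination (X ^ 2 - 1) * s3 + X ^ 2 * k2 + X * (X ^ 2 - 1) * k0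
    · linear_combination X * (X ^ 2 - 1) * s21 + X ^ 2 * k2 + X ^ 2 * k11 + X ^ 2 * (X ^ 2 - 1) * k0
    · obtain _ | n := n
      · simp [functionals]
      · linear_combination X ^ 2 * (X ^ 2 - 1) * s111 (Nat.succ_pos n) + X ^ 2 * k11

theorem twoRowC (n : ℕ) :
    TwoRowC (functionals .C (n + 1)) (row .C (n + 1) 2 0) := by
  obtain _ | n := n
  · have ⟨v0, v1, v2, v3⟩ := rank_zero_values .C (by simp)
    have r := fun a ha => row_wt_one_of_ne .C (by simp) a 2 0 ha (by norm_num)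
    simp only [twiceShift, longCoeff] at v0 v1 v2 v3 r
    have h1 : part .C 0 (-1) 0 = 0 := part_neg .C 0 (-1) 0 (by norm_num)
    have h2 : part .C 0 (-2) 0 = 0 := part_neg .C 0 (-2) 0 (by norm_num)
    have r0 := r 0 le_rfl
    have r1 := r 1 zero_le_one
    have r2 := r 2 zero_le_two
    have r3 := r 3 (by norm_num)
    norm_num [h1, h2, v0, v1, v2, v3] at r0 r1 r2 r3
    constructor <;> simp [functionals, evals, r0, r1, r2, r3]
  · have ⟨k0, k1, k2, k11, k3, k21, k111⟩ := nullRowC (n + 1)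
    have ⟨s0, s1, s2, s3, s11, s21, s111⟩ := twoStep .C n 0
    constructor
    · linear_combination s0
    · linear_combination s1
    · linear_combination s2 + k0
    · linear_combination s11
    · linear_combination s3 + X * k1
    · linear_combination s21 + k1
    · obtain _ | n := n
      · simp [functionals]
      · linear_combination s111 (Nat.succ_pos n)

theorem oneOneRowC (n : ℕ) :
    OneOneRowC (functionals .C (n + 2)) (row .C (n + 2) 1 1) := by
  have ⟨k0, k1, k2, k11, k3, k21, k111⟩ := oneRowC n
  have ⟨s0, s1, s2, s3, s11, s21, s111⟩ := oneStep .C n 1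
  simp only [longCoeff] at s3
  constructor
  · linear_combination s0
  · linear_combination s1 + k0
  · linear_combination s2 + X * k1
  · linear_combination s11 + k1
  · linear_combination s3 + X ^ 2 * k2 + X * k0
  · linear_combination s21 + X * k2 + X * k11 + X * k0
  · obtain _ | n := n
    · simp [functionals]
    · linear_combination s111 (Nat.succ_pos n) + k11

theorem nullRowD (n : ℕ) : NullRowD (functionals .D (n + 1)) (row .D (n + 1) 0 0) := by
  induction n with
  | zero =>
    -- For `a = m = 0` both signs give the same term, whence the value 2.
    have r0 := row_wt_one .D 0 0 0
    have r1 := rank_one_D 0 (by norm_num) 1 zero_lt_one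
    have r2 := rank_one_D 0 (by norm_num) 2 zero_lt_two
    have r3 := rank_one_D 0 (by norm_num) 3 (by norm_num)
    have h1 : part .D 0 (-1) 0 = 0 := part_neg .D 0 (-1) 0 (by norm_num)
    have h2 : part .D 0 (-2) 0 = 0 := part_neg .D 0 (-2) 0 (by norm_num)
    have v0 : ev 0 0 0 0 0 (part .D 0 0 0) = 1 := by rw [part_rank_zero]; rfl
    norm_num [h1, h2, v0, part_D_zero_one, part_D_zero_two, part_D_zero_three, twiceShift,
      signExp] at r0 r1 r2 r3
    constructor <;> simp [functionals, r0, r1, r2, r3] <;> ring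
  | succ n ih =>
    have ⟨k0, k1, k2, k11, k3, k21, k111⟩ := ih
    have ⟨s0, s1, s2, s3, s11, s21, s111⟩ := nullStep .D n 0
    simp only [longCoeff] at s2 s3 s21
    constructor
    · linear_combination s0 + k0
    · linear_combination s1 + X * k1
    · linear_combination (X ^ 2 - 1) * s2 + X ^ 2 * k2 + X ^ 2 * (X ^ 2 - 1) * k0
    · linear_combination X * (X ^ 2 - 1) * s11 + X * (X - 1) * k2 + X * k11 + X ^ 2 * (X ^ 2 - 1) * k0
    · linear_combination s3 + X ^ 3 * k3 + X ^ 3 * k1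
    · linear_combination s21 + (X ^ 2 - 1) * k3 + X ^ 2 * k21 + 2 * X ^ 2 * k1
    · obtain _ | n := n
      -- For `O(4)` the partition `(1, 1, 1)` is `(1)` twisted by the determinant, which has the
      -- same restriction as `(1)`.
      · rw [show (functionals .D (0 + 2)).l111 = (functionals .D (0 + 2)).l1 from rfl]
        linear_combination s1 + X * k1
      · linear_combination s111 (Nat.succ_pos n) + (X - 1) * k21 + X * k111 + X * k1

theorem oneRowD (n : ℕ) :
    OneRowD (functionals .D (n + 1)) (row .D (n + 1) 1 0) := by
  obtain _ | n := n
  · have r0 := row_wt_one .D 0 1 0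
    have r1 := rank_one_D 1 (by norm_num) 1 zero_lt_one
    have r2 := rank_one_D 1 (by norm_num) 2 zero_lt_two
    have r3 := rank_one_D 1 (by norm_num) 3 (by norm_num)
    have h1 : part .D 0 (-1) 0 = 0 := part_neg .D 0 (-1) 0 (by norm_num)
    have h2 : part .D 0 (-2) 0 = 0 := part_neg .D 0 (-2) 0 (by norm_num)
    have v0 : ev 0 0 0 0 0 (part .D 0 0 0) = 1 := by rw [part_rank_zero]; rfl
    norm_num [h1, h2, v0, part_D_zero_one, part_D_zero_two, part_D_zero_three, twiceShift,
      signExp] at r0 r1 r2 r3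
    constructor <;> simp [functionals, r0, r1, r2, r3, -zero_eq_mul] <;> ring
  · have ⟨k0, k1, k2, k11, k3, k21, k111⟩ := nullRowD n
    have ⟨s0, s1, s2, s3, s11, s21, s111⟩ := oneStep .D n 0
    simp only [longCoeff] at s3
    constructor
    · linear_combination s0
    · linear_combination s1 + k0
    · linear_combination s2 + X * k1
    · linear_combination s11 + k1
    · linear_combination (X ^ 2 - 1) * s3 + X ^ 2 * k2 + X ^ 2 * (X ^ 2 - 1) * k0
    · linear_combination X ^ 2 * (X ^ 2 - 1) * s21 + X ^ 3 * k2 + X ^ 2 * k11 + X ^ 3 * (X ^ 2 - 1) * k0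
    · obtain _ | n := n
      · rw [show (functionals .D (0 + 2)).l111 = (functionals .D (0 + 2)).l1 from rfl]
        linear_combination X ^ 3 * (X ^ 2 - 1) * s1 + X ^ 3 * (X ^ 2 - 1) * k0
      · linear_combination X ^ 3 * (X ^ 2 - 1) * s111 (Nat.succ_pos n) + X ^ 2 * k11

theorem twoRowD (n : ℕ) :
    TwoRowD (functionals .D (n + 1)) (row .D (n + 1) 2 0) := by
  obtain _ | n := n
  · have r0 := row_wt_one .D 0 2 0
    have r1 := rank_one_D 2 (by norm_num) 1 zero_lt_one
    have r2 := rank_one_D 2 (by norm_num) 2 zero_lt_two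
    have r3 := rank_one_D 2 (by norm_num) 3 (by norm_num)
    have h1 : part .D 0 (-1) 0 = 0 := part_neg .D 0 (-1) 0 (by norm_num)
    have h2 : part .D 0 (-2) 0 = 0 := part_neg .D 0 (-2) 0 (by norm_num)
    have v0 : ev 0 0 0 0 0 (part .D 0 0 0) = 1 := by rw [part_rank_zero]; rfl
    norm_num [h1, h2, v0, part_D_zero_one, part_D_zero_two, part_D_zero_three, twiceShift,
      signExp] at r0 r1 r2 r3
    constructor <;> simp [functionals, r0, r1, r2, r3]
  · have ⟨k0, k1, k2, k11, k3, k21, k111⟩ := nullRowD n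
    have ⟨s0, s1, s2, s3, s11, s21, s111⟩ := twoStep .D n 0
    constructor
    · linear_combination s0
    · linear_combination s1
    · linear_combination s2 + k0
    · linear_combination s11
    · linear_combination s3 + X * k1
    · linear_combination s21 + k1
    · obtain _ | n := n
      · rw [show (functionals .D (0 + 2)).l111 = (functionals .D (0 + 2)).l1 from rfl]
        linear_combination s1
      · linear_combination s111 (Nat.succ_pos n)

theorem oneOneRowD (n : ℕ) :
    OneOneRowD (functionals .D (n + 2)) (row .D (n + 2) 1 1) := by
  have ⟨k0, k1, k2, k11, k3, k21, k111⟩ := oneRowD n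
  have ⟨s0, s1, s2, s3, s11, s21, s111⟩ := oneStep .D n 1
  simp only [longCoeff] at s3
  constructor
  · linear_combination s0
  · linear_combination s1 + k0
  · linear_combination s2 + X * k1
  · linear_combination s11 + k1
  · linear_combination s3 + X ^ 2 * k2 + X ^ 2 * k0
  · linear_combination s21 + X * k2 + X * k11 + X * k0
  · obtain _ | n := n
    · rw [show (functionals .D (0 + 2)).l111 = (functionals .D (0 + 2)).l1 from rfl]
      linear_combination s1 + k0
    · linear_combination s111 (Nat.succ_pos n) + k11

/-! ### The diagram automorphism in type `D` -/

section Reflection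

variable {n : ℕ}

/-- The change of the sign of the coordinate `i`. -/
def negAt (i : Fin n) : (Fin n → ℚ) →ₗ[ℚ] (Fin n → ℚ) :=
  LinearMap.pi fun k => (if k = i then -1 else 1 : ℚ) • LinearMap.proj k

theorem negAt_apply (i : Fin n) (v : Fin n → ℚ) (k : Fin n) :
    negAt i v k = if k = i then -v k else v k := by
  simp only [negAt, LinearMap.pi_apply, LinearMap.smul_apply, LinearMap.proj_apply]
  split_ifs <;> simp

theorem negAt_negAt (i : Fin n) (v : Fin n → ℚ) : negAt i (negAt i v) = v := by
  ext k
  simp only [negAt_apply]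
  split_ifs <;> simp

theorem negAt_stdVec_self (i : Fin n) : negAt i (stdVec n i) = -stdVec n i := by
  ext k
  by_cases h : k = i <;> simp [negAt_apply, stdVec, h]

theorem negAt_stdVec_of_ne {i j : Fin n} (h : j ≠ i) : negAt i (stdVec n j) = stdVec n j := by
  ext k
  by_cases hk : k = i
  · subst hk
    simp [negAt_apply, stdVec, h.symm]
  · simp [negAt_apply, hk]

theorem negAt_mem_posRoots {i : Fin n} (hi : (i : ℕ) + 1 = n) {α : Fin n → ℚ}
    (h : α ∈ posRoots .D n) : negAt i α ∈ posRoots .D n := by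
  simp only [posRoots, Finset.union_empty, Finset.mem_union, Finset.mem_image, Finset.mem_filter,
    Finset.mem_univ, true_and] at h ⊢
  rcases h with ⟨⟨a, b⟩, hab, rfl⟩ | ⟨⟨a, b⟩, hab, rfl⟩ <;>
    simp only [Fin.lt_def] at hab <;>
    have ha : a ≠ i := (by rintro rfl; have := b.2; omega) <;>
    simp only [map_sub, map_add, negAt_stdVec_of_ne ha] <;>
    by_cases hb : b = i
  · subst hb
    exact Or.inr ⟨(a, b), hab, by rw [negAt_stdVec_self, sub_neg_eq_add]⟩
  · exact Or.inl ⟨(a, b), hab, by rw [negAt_stdVec_of_ne hb]⟩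
  · subst hb
    exact Or.inl ⟨(a, b), hab, by rw [negAt_stdVec_self, sub_eq_add_neg]⟩
  · exact Or.inr ⟨(a, b), hab, by rw [negAt_stdVec_of_ne hb]⟩

/-- Changing the sign of the last coordinate exchanges `ε j - ε i` with `ε j + ε i`, so it permutes
the positive roots and hence the decompositions. -/
theorem kostantQ_negAt {i : Fin n} (hi : (i : ℕ) + 1 = n) (β : Fin n → ℚ) :
    kostantQ .D n (negAt i β) = kostantQ .D n β := by
  let g : posRoots .D n → posRoots .D n := fun α => ⟨negAt i α, negAt_mem_posRoots hi α.2⟩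
  have hg : Function.Involutive g := fun α => Subtype.ext (negAt_negAt i α)
  have hmem : ∀ b, ∀ m ∈ decomps .D n b, m ∘ g ∈ decomps .D n (negAt i b) := by
    intro b m hm
    rw [mem_decomps] at hm ⊢
    rw [← hm, map_sum, ← Equiv.sum_comp hg.toPerm]
    refine Finset.sum_congr rfl fun α _ => ?_
    rw [map_nsmul]
    simp only [Function.Involutive.coe_toPerm, Function.comp_apply, hg α]
    rfl
  refine Finset.sum_nbij' (fun m => m ∘ g) (fun m => m ∘ g) (fun m hm => ?_) (hmem β)
    (fun m _ => ?_) (fun m _ => ?_) (fun m _ => ?_)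
  · have := hmem _ m hm
    rwa [negAt_negAt] at this
  · ext α
    simp [hg α]
  · ext α
    simp [hg α]
  · congr 1
    exact (Equiv.sum_comp hg.toPerm m).symm

/-- Negate the sign in the last position. Since `w i = 0`, the argument of the partition function
changes by the diagram automorphism and its value does not, while the product of the signs changes:
the sum equals its negative. -/
theorem kfSum_eq_zero_of_last {i : Fin n} (hi : (i : ℕ) + 1 = n) (v w : Fin n → ℚ)
    (hw : w i = 0) : kfSum .D 1 n v w = 0 := by
  refine self_eq_neg.1 ?_
  conv_lhs => rw [kfSum, alternant]
  rw [kfSum, alternant, ← Finset.sum_neg_distrib]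
  refine Finset.sum_congr rfl fun π _ => ?_
  rw [← Finset.sum_neg_distrib,
    ← Equiv.sum_comp (Equiv.mulRight (Pi.mulSingle i (-1) : Fin n → ℤˣ))]
  refine Finset.sum_congr rfl fun s _ => ?_
  simp only [Equiv.coe_mulRight, Pi.mul_apply, Finset.prod_mul_distrib]
  rw [show ∏ j, (Pi.mulSingle i (-1) : Fin n → ℤˣ) j = -1 from
    (Finset.prod_eq_single i (fun j _ h => Pi.mulSingle_eq_of_ne h _) (by simp)).trans
      (Pi.mulSingle_eq_same _ _), ← neg_mul, ← kostantQ_negAt hi]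
  congr 1
  · simp
  · congr 1
    ext k
    by_cases h : k = i
    · subst h
      simp [negAt_apply, hw]
    · simp [negAt_apply, h]

end Reflection

/-! ### Kostka–Foulkes polynomials as values of the functionals -/

theorem weightOf_add_rho (t : ClassicalType) (n : ℕ) (p : List ℕ) (hp : p.length ≤ 3) :
    weightOf n p + rho t n =
      wt (twiceShift t) n (p.getD 0 0 : ℕ) (p.getD 1 0 : ℕ) (p.getD 2 0 : ℕ) := by
  ext i
  rw [Pi.add_apply, rho_apply, weightOf, wt, add_comm]
  congr 1
  split_ifs with h0 h1 h2
  · rw [h0]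
  · rw [h1]
  · rw [h2]
  · rw [List.getD_eq_default _ _ (by omega), Nat.cast_zero]

/-- The functional attached to a column of the tables. -/
def Functionals.col {n : ℕ} (L : Functionals n) : Fin 7 → Functional n :=
  ![L.l3, L.l21, L.l111, L.l2, L.l11, L.l1, L.l0]

/-- The row of the table attached to a partition with at most two parts. -/
noncomputable def rowOf (t : ClassicalType) (n : ℕ) (i : Fin 4) : (Fin n → ℚ) → ℤ[X] :=
  row t n ((rowShape i).getD 0 0 : ℕ) ((rowShape i).getD 1 0 : ℕ)

theorem rowShape_length (i : Fin 4) : (rowShape i).length ≤ 2 := by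
  fin_cases i <;> simp [rowShape]

theorem colShape_length (j : Fin 7) : (colShape j).length ≤ 3 := by
  fin_cases j <;> simp [colShape]

/-- The column of the table in terms of the evaluations. -/
theorem evals_col (t : ClassicalType) (n : ℕ) (j : Fin 7) (f : (Fin n → ℚ) → ℤ[X]) :
    (evals (twiceShift t) n).col j f = f (weightOf n (colShape j) + rho t n) := by
  rw [weightOf_add_rho t n _ (colShape_length j)]
  fin_cases j <;> simp [colShape, Functionals.col, evals, ev_apply]

theorem rowOf_apply (t : ClassicalType) (n : ℕ) (i : Fin 4) (v : Fin n → ℚ) :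
    rowOf t n i v = kfSum t (signExp t) n v (weightOf n (rowShape i) + rho t n) := by
  rw [weightOf_add_rho t n _ ((rowShape_length i).trans (by norm_num)), rowOf, row]
  rw [List.getD_eq_default _ _ (rowShape_length i), Nat.cast_zero]

theorem functionals_col (t : ClassicalType) (n : ℕ) (j : Fin 7) (hj : (colShape j).length ≤ n)
    (h : t = .D → (colShape j).length < n) :
    (functionals t n).col j = (evals (twiceShift t) n).col j := by
  match t, n with
  | .B, 0 | .B, 1 | .B, 2 | .C, 0 | .C, 1 | .C, 2 =>
    fin_cases j <;>
      simp [colShape, Functionals.col, functionals, evals, twiceShift] at hj ⊢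
  | .D, 0 | .D, 1 | .D, 2 | .D, 3 =>
    replace h := h rfl
    fin_cases j <;>
      simp [colShape, Functionals.col, functionals, evals, twiceShift] at h ⊢
  | .B, n + 3 | .C, n + 3 | .D, n + 4 => rfl

theorem functionals_col_D (n : ℕ) (hn : 2 ≤ n) (j : Fin 7) (hj : (colShape j).length = n) :
    (functionals .D n).col j = (2 : ℤ[X]) • (evals (twiceShift .D) n).col j := by
  have h3 := colShape_length j
  have : n = 2 ∨ n = 3 := by omega
  rcases this with rfl | rfl <;> fin_cases j <;>
    simp [colShape, Functionals.col, functionals, evals, twiceShift] at hj ⊢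

theorem kostkaFoulkes_eq_col (t : ClassicalType) (ht : t ≠ .D) (n : ℕ) (i : Fin 4) (j : Fin 7)
    (hj : (colShape j).length ≤ n) :
    kostkaFoulkes t n (weightOf n (colShape j)) (weightOf n (rowShape i)) =
      (functionals t n).col j (rowOf t n i) := by
  rw [functionals_col t n j hj (fun h => absurd h ht), evals_col, rowOf_apply,
    kostkaFoulkes_eq_kfSum t ht]
  cases t
  · rfl
  · rfl
  · exact absurd rfl ht

theorem last_eq_zero {n : ℕ} {i : Fin n} (hi : (i : ℕ) + 1 = n) {p : List ℕ}
    (hp : p.length < n) : (weightOf n p + rho .D n) i = 0 := by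
  rw [Pi.add_apply, rho_apply, weightOf, List.getD_eq_default _ _ (by omega),
    show (n : ℚ) = (i : ℕ) + 1 by exact_mod_cast hi.symm]
  simp [twiceShift]

/-- When `lam` has fewer than `n` parts, `lam + rho` ends in 0, and the alternant that is odd under
sign changes vanishes there. -/
theorem two_mul_kostkaFoulkes_of_lt (n : ℕ) (i : Fin 4) (j : Fin 7)
    (hj : (colShape j).length < n) :
    2 * kostkaFoulkes .D n (weightOf n (colShape j)) (weightOf n (rowShape i)) =
      (functionals .D n).col j (rowOf .D n i) := by
  obtain ⟨k, rfl⟩ : ∃ k, n = k + 1 := ⟨n - 1, by omega⟩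
  have hl : ((Fin.last k : Fin (k + 1)) : ℕ) + 1 = k + 1 := rfl
  have h0 := (isAlt_kfSum .D 1 (k + 1) (weightOf (k + 1) (rowShape i) + rho .D (k + 1))
    ).eq_zero_of_zero odd_one (last_eq_zero hl hj)
  rw [functionals_col .D _ j hj.le (fun _ => hj), evals_col, rowOf_apply,
    two_mul_kostkaFoulkes_D]
  rw [h0, add_zero]
  rfl

/-- At full length the functional carries an extra factor 2, so it equals twice the even alternant;
this turns the 2 of `two_mul_kostkaFoulkes_D` into a 4. -/
theorem four_mul_kostkaFoulkes_of_eq (n : ℕ) (hn : 2 ≤ n) (i : Fin 4) (j : Fin 7)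
    (hj : (colShape j).length = n) :
    4 * kostkaFoulkes .D n (weightOf n (colShape j)) (weightOf n (rowShape i)) =
      (functionals .D n).col j (rowOf .D n i) +
        2 * kfSum .D 1 n (weightOf n (colShape j) + rho .D n)
          (weightOf n (rowShape i) + rho .D n) := by
  have h := two_mul_kostkaFoulkes_D n (weightOf n (colShape j)) (weightOf n (rowShape i))
  rw [functionals_col_D n hn j hj, LinearMap.smul_apply, smul_eq_mul,
    evals_col, rowOf_apply]
  simp only [signExp]
  linear_combination 2 * h

theorem four_mul_kostkaFoulkes (n : ℕ) (hn : 2 ≤ n) (i : Fin 4) (j : Fin 7)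
    (hi : (rowShape i).length < n) (hj : (colShape j).length = n) :
    4 * kostkaFoulkes .D n (weightOf n (colShape j)) (weightOf n (rowShape i)) =
      (functionals .D n).col j (rowOf .D n i) := by
  obtain ⟨k, rfl⟩ : ∃ k, n = k + 1 := ⟨n - 1, by omega⟩
  have hl : ((Fin.last k : Fin (k + 1)) : ℕ) + 1 = k + 1 := rfl
  rw [four_mul_kostkaFoulkes_of_eq _ hn i j hj, kfSum_eq_zero_of_last hl _ _ (last_eq_zero hl hi),
    mul_zero, add_zero]

/-! ### The odd alternant in type `D`, rank two, for the row `(1, 1)` -/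

theorem kfPart_D_rank_zero_one (e : ℕ) (v w : Fin 0 → ℚ) : kfPart .D e 0 1 v w = 0 := by
  have h := kfPart_rec .D e 0 1 v w
  simpa [shiftSum] using h

theorem kfSum_D_rank_one (a b d : ℚ) (ha : 0 ≤ a) :
    kfSum .D 1 1 (wt 0 1 a b d) (wt 0 1 1 0 0) =
      kfPart .D 1 0 (a - 1) (wt 0 0 b d 0) (wt 0 0 0 0 0) := by
  have h := kfSum_wt_one .D 1 a b d 1 0
  simp only [twiceShift] at h
  rw [h, kfPart_neg _ _ _ (-(a + 1 + (0 : ℕ))) (by push_cast; linarith), mul_zero, add_zero]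

theorem kfSum_D_rank_two (a d : ℚ) (ha : 0 ≤ a) (hd : 0 ≤ d) (hd' : d ≤ 1) :
    kfSum .D 1 2 (wt 0 2 a 1 d) (wt 0 2 1 1 0) =
      kfPart .D 1 1 (a - 1) (wt 0 1 1 d 0) (wt 0 1 1 0 0) := by
  have h := kfSum_wt .D 1 0 a 1 d 1 1 ha zero_le_one hd zero_le_one hd'
  simp only [twiceShift] at h
  rw [h, kfPart_neg _ _ _ (1 - 1 - 1) (by norm_num), sub_zero]

theorem kfSum_D_one_one : kfSum .D 1 2 (wt 0 2 1 1 0) (wt 0 2 1 1 0) = 1 := by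
  rw [kfSum_D_rank_two _ _ zero_le_one le_rfl zero_le_one, sub_self, kfPart_zero,
    kfSum_D_rank_one _ _ _ zero_le_one, sub_self, kfPart_zero, kfSum_rank_zero]

theorem kfSum_D_two_one : kfSum .D 1 2 (wt 0 2 2 1 0) (wt 0 2 1 1 0) = 0 := by
  rw [kfSum_D_rank_two _ _ zero_le_two le_rfl zero_le_one]
  -- A drop by one moves the remaining coordinate of `(1)` to 2 or 0. In rank one, where type `D`
  -- has no roots, neither can reach 1.
  have h := kfPart_rec .D 1 1 1 (wt 0 1 1 0 0) (wt 0 1 1 0 0)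
  simp only [Finset.sum_range_one, shiftSum_wt_one] at h
  norm_num [kfPart_zero, kfSum_D_rank_one, kfPart_neg, kfPart_D_rank_zero_one] at h
  norm_num [h]

/-! ### The entries of the tables -/

section Tables

/-- Needed for the denominators `q - 1` and `q ^ 2 - 1`; degrees separate the powers. -/
theorem q_pow_ne_one {m : ℕ} (hm : 0 < m) : q ^ m ≠ 1 := by
  intro h
  rw [q, ← RatFunc.algebraMap_X, ← map_pow, ← map_one (algebraMap ℤ[X] (RatFunc ℤ))] at h
  have h1 := congrArg natDegree (IsFractionRing.injective ℤ[X] (RatFunc ℤ) h)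
  simp at h1
  omega

theorem q_ne_zero : q ≠ 0 := by
  intro h
  rw [q, ← RatFunc.algebraMap_X, ← map_zero (algebraMap ℤ[X] (RatFunc ℤ))] at h
  exact X_ne_zero (IsFractionRing.injective ℤ[X] (RatFunc ℤ) h)

theorem q_sub_one_ne_zero : q - 1 ≠ 0 := by
  have := q_pow_ne_one one_pos
  rw [pow_one] at this
  exact sub_ne_zero.2 this

theorem q_sq_sub_one_ne_zero : q ^ 2 - 1 ≠ 0 := sub_ne_zero.2 (q_pow_ne_one two_pos)

theorem algebraMap_eq_div {c A r : ℤ[X]} (hc : algebraMap ℤ[X] (RatFunc ℤ) c ≠ 0)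
    (h : c * A = r) :
    algebraMap ℤ[X] (RatFunc ℤ) A =
      algebraMap ℤ[X] (RatFunc ℤ) r / algebraMap ℤ[X] (RatFunc ℤ) c := by
  rw [eq_div_iff hc, mul_comm, ← map_mul, h]

theorem entry_eq (t : ClassicalType) (ht : t ≠ .D) (n : ℕ) (i : Fin 4) (j : Fin 7)
    (hj : (colShape j).length ≤ n) {A : ℤ[X]}
    (h : (functionals t n).col j (rowOf t n i) = A) :
    entry t n (colShape j) (rowShape i) = algebraMap ℤ[X] (RatFunc ℤ) A := by
  rw [entry, kostkaFoulkes_eq_col t ht n i j hj, h]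

theorem entry_eq_div (t : ClassicalType) (ht : t ≠ .D) (n : ℕ) (i : Fin 4) (j : Fin 7)
    (hj : (colShape j).length ≤ n) {c r : ℤ[X]}
    (h : c * (functionals t n).col j (rowOf t n i) = r)
    (hc : algebraMap ℤ[X] (RatFunc ℤ) c ≠ 0) :
    entry t n (colShape j) (rowShape i) =
      algebraMap ℤ[X] (RatFunc ℤ) r / algebraMap ℤ[X] (RatFunc ℤ) c := by
  rw [entry, kostkaFoulkes_eq_col t ht n i j hj, algebraMap_eq_div hc h]

theorem entry_D_eq_div (n : ℕ) (i : Fin 4) (j : Fin 7)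
    (hj : (colShape j).length < n) {c r : ℤ[X]}
    (h : c * (functionals .D n).col j (rowOf .D n i) = 2 * r)
    (hc : algebraMap ℤ[X] (RatFunc ℤ) c ≠ 0) :
    entry .D n (colShape j) (rowShape i) =
      algebraMap ℤ[X] (RatFunc ℤ) r / algebraMap ℤ[X] (RatFunc ℤ) c := by
  refine algebraMap_eq_div hc (mul_left_cancel₀ (two_ne_zero (α := ℤ[X])) ?_)
  rw [← h, ← two_mul_kostkaFoulkes_of_lt n i j hj]
  ring

theorem entry_D_eq (n : ℕ) (i : Fin 4) (j : Fin 7) (hj : (colShape j).length < n) {A : ℤ[X]}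
    (h : (functionals .D n).col j (rowOf .D n i) = 2 * A) :
    entry .D n (colShape j) (rowShape i) = algebraMap ℤ[X] (RatFunc ℤ) A := by
  rw [entry_D_eq_div n i j hj (c := 1) (by rw [one_mul, h]) (by simp), map_one, div_one]

theorem entry_D_eq_of_length_eq (n : ℕ) (hn : 2 ≤ n) (i : Fin 4) (j : Fin 7)
    (hi : (rowShape i).length < n) (hj : (colShape j).length = n) {A : ℤ[X]}
    (h : (functionals .D n).col j (rowOf .D n i) = 4 * A) :
    entry .D n (colShape j) (rowShape i) = algebraMap ℤ[X] (RatFunc ℤ) A := by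
  rw [entry, mul_left_cancel₀ (show (4 : ℤ[X]) ≠ 0 by norm_num)
    ((four_mul_kostkaFoulkes n hn i j hi hj).trans h)]

theorem entry_B_two (n : ℕ) (j : Fin 7) (hn : 1 ≤ n) (hj : (colShape j).length ≤ n) :
    entry .B n (colShape j) (rowShape 0) = tableB n 0 j := by
  obtain ⟨n, rfl⟩ : ∃ k, n = k + 1 := ⟨n - 1, by omega⟩
  have hq := q_ne_zero
  have ⟨k0, k1, k2, k11, k3, k21, k111⟩ :
      TwoRowB (functionals .B (n + 1)) (rowOf .B (n + 1) 0) := by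
    simpa [rowOf, rowShape] using twoRowB n
  fin_cases j
  · refine (entry_eq .B (by simp) _ 0 0 hj k3).trans ?_
    simp [tableB]
  · obtain ⟨n, rfl⟩ : ∃ k, n = k + 1 := ⟨n - 1, by simp [colShape] at hj; omega⟩
    refine (entry_eq_div .B (by simp) _ 0 1 hj k21 (by simpa using hq)).trans ?_
    simp [tableB]
    field_simp
    ring
  · obtain ⟨n, rfl⟩ : ∃ k, n = k + 2 := ⟨n - 2, by simp [colShape] at hj; omega⟩
    refine (entry_eq .B (by simp) _ 0 2 hj k111).trans ?_
    simp [tableB]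
  · refine (entry_eq .B (by simp) _ 0 3 hj k2).trans ?_
    simp [tableB]
  · obtain ⟨n, rfl⟩ : ∃ k, n = k + 1 := ⟨n - 1, by simp [colShape] at hj; omega⟩
    refine (entry_eq .B (by simp) _ 0 4 hj k11).trans ?_
    simp [tableB]
  · refine (entry_eq .B (by simp) _ 0 5 hj k1).trans ?_
    simp [tableB]
  · refine (entry_eq .B (by simp) _ 0 6 hj k0).trans ?_
    simp [tableB]

theorem entry_B_one_one (n : ℕ) (j : Fin 7) (hn : 2 ≤ n) (hj : (colShape j).length ≤ n) :
    entry .B n (colShape j) (rowShape 1) = tableB n 1 j := by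
  obtain ⟨n, rfl⟩ : ∃ k, n = k + 2 := ⟨n - 2, by omega⟩
  have hq := q_ne_zero
  have ⟨k0, k1, k2, k11, k3, k21, k111⟩ :
      OneOneRowB (functionals .B (n + 2)) (rowOf .B (n + 2) 1) := by
    simpa [rowOf, rowShape] using oneOneRowB n
  fin_cases j
  · refine (entry_eq .B (by simp) _ 1 0 hj k3).trans ?_
    simp [tableB]
  · refine (entry_eq_div .B (by simp) _ 1 1 hj k21 (by simpa using hq)).trans ?_
    simp [tableB]
    field_simp
    ring
  · obtain ⟨n, rfl⟩ : ∃ k, n = k + 1 := ⟨n - 1, by simp [colShape] at hj; omega⟩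
    refine (entry_eq_div .B (by simp) _ 1 2 hj k111 (by simpa using hq)).trans ?_
    simp [tableB]
    field_simp
    ring
  · refine (entry_eq .B (by simp) _ 1 3 hj k2).trans ?_
    simp [tableB]
  · refine (entry_eq .B (by simp) _ 1 4 hj k11).trans ?_
    simp [tableB]
  · refine (entry_eq .B (by simp) _ 1 5 hj k1).trans ?_
    simp [tableB]
  · refine (entry_eq .B (by simp) _ 1 6 hj k0).trans ?_
    simp [tableB]

theorem entry_B_one (n : ℕ) (j : Fin 7) (hn : 1 ≤ n) (hj : (colShape j).length ≤ n) :
    entry .B n (colShape j) (rowShape 2) = tableB n 2 j := by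
  obtain ⟨n, rfl⟩ : ∃ k, n = k + 1 := ⟨n - 1, by omega⟩
  have hq := q_ne_zero
  have hq1 := q_sub_one_ne_zero
  have hq2 := q_sq_sub_one_ne_zero
  have ⟨k0, k1, k2, k11, k3, k21, k111⟩ :
      OneRowB (functionals .B (n + 1)) (rowOf .B (n + 1) 2) := by
    simpa [rowOf, rowShape] using oneRowB n
  fin_cases j
  · refine (entry_eq_div .B (by simp) _ 2 0 hj k3 (by simpa using hq2)).trans ?_
    simp [tableB]
    field_simp
  -- A column with two parts forces rank at least two, so the subtraction in the exponent of the
  -- table is exact. The other columns are treated alike.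
  · obtain ⟨n, rfl⟩ : ∃ k, n = k + 1 := ⟨n - 1, by simp [colShape] at hj; omega⟩
    refine (entry_eq_div .B (by simp) _ 2 1 hj k21 (by simpa using hq2)).trans ?_
    have e : 2 * (n + 1 + 1) - 1 = 2 * n + 3 := by omega
    simp [tableB, e]
    field_simp
    ring
  · obtain ⟨n, rfl⟩ : ∃ k, n = k + 2 := ⟨n - 2, by simp [colShape] at hj; omega⟩
    refine (entry_eq_div .B (by simp) _ 2 2 hj k111 (by simpa using ⟨hq, hq2⟩)).trans ?_
    have e : 2 * (n + 1 + 2) - 2 = 2 * n + 4 := by omega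
    simp [tableB, e]
    field_simp
    ring
  · refine (entry_eq .B (by simp) _ 2 3 hj k2).trans ?_
    simp [tableB]
  · obtain ⟨n, rfl⟩ : ∃ k, n = k + 1 := ⟨n - 1, by simp [colShape] at hj; omega⟩
    refine (entry_eq_div .B (by simp) _ 2 4 hj k11 (by simpa using hq)).trans ?_
    simp [tableB]
    field_simp
    ring
  · refine (entry_eq .B (by simp) _ 2 5 hj k1).trans ?_
    simp [tableB]
  · refine (entry_eq .B (by simp) _ 2 6 hj k0).trans ?_
    simp [tableB]

theorem entry_B_null (n : ℕ) (j : Fin 7) (hj : (colShape j).length ≤ n) :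
    entry .B n (colShape j) (rowShape 3) = tableB n 3 j := by
  have hq := q_ne_zero
  have hq1 := q_sub_one_ne_zero
  have hq2 := q_sq_sub_one_ne_zero
  have ⟨k0, k1, k2, k11, k3, k21, k111⟩ :
      NullRowB (functionals .B n) (rowOf .B n 3) := by
    simpa [rowOf, rowShape] using nullRowB n
  fin_cases j
  · refine (entry_eq_div .B (by simp) _ 3 0 hj k3 (by simpa using hq2)).trans ?_
    simp [tableB]
    field_simp
  · obtain ⟨n, rfl⟩ : ∃ k, n = k + 2 := ⟨n - 2, by simp [colShape] at hj; omega⟩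
    refine (entry_eq_div .B (by simp) _ 3 1 hj k21 (by simpa using hq1)).trans ?_
    have e : 2 * (n + 2) - 1 = 2 * n + 3 := by omega
    simp [tableB, e]
    field_simp
    ring
  · obtain ⟨n, rfl⟩ : ∃ k, n = k + 3 := ⟨n - 3, by simp [colShape] at hj; omega⟩
    refine (entry_eq_div .B (by simp) _ 3 2 hj k111 (by simpa using ⟨hq, hq2⟩)).trans ?_
    simp [tableB]
    field_simp
    ring
  · refine (entry_eq_div .B (by simp) _ 3 3 hj k2 (by simpa using hq2)).trans ?_
    simp [tableB]
    field_simp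
  · refine (entry_eq_div .B (by simp) _ 3 4 hj k11 (by simpa using hq2)).trans ?_
    simp [tableB]
    field_simp
  · refine (entry_eq .B (by simp) _ 3 5 hj k1).trans ?_
    simp [tableB]
  · refine (entry_eq .B (by simp) _ 3 6 hj k0).trans ?_
    simp [tableB]

theorem entry_C_two (n : ℕ) (j : Fin 7) (hn : 1 ≤ n) (hj : (colShape j).length ≤ n) :
    entry .C n (colShape j) (rowShape 0) = tableC n 0 j := by
  obtain ⟨n, rfl⟩ : ∃ k, n = k + 1 := ⟨n - 1, by omega⟩
  have ⟨k0, k1, k2, k11, k3, k21, k111⟩ :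
      TwoRowC (functionals .C (n + 1)) (rowOf .C (n + 1) 0) := by
    simpa [rowOf, rowShape] using twoRowC n
  fin_cases j
  · refine (entry_eq .C (by simp) _ 0 0 hj k3).trans ?_
    simp [tableC]
  · refine (entry_eq .C (by simp) _ 0 1 hj k21).trans ?_
    simp [tableC]
  · refine (entry_eq .C (by simp) _ 0 2 hj k111).trans ?_
    simp [tableC]
  · refine (entry_eq .C (by simp) _ 0 3 hj k2).trans ?_
    simp [tableC]
  · refine (entry_eq .C (by simp) _ 0 4 hj k11).trans ?_
    simp [tableC]
  · refine (entry_eq .C (by simp) _ 0 5 hj k1).trans ?_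
    simp [tableC]
  · refine (entry_eq .C (by simp) _ 0 6 hj k0).trans ?_
    simp [tableC]

theorem entry_C_one_one (n : ℕ) (j : Fin 7) (hn : 2 ≤ n) (hj : (colShape j).length ≤ n) :
    entry .C n (colShape j) (rowShape 1) = tableC n 1 j := by
  obtain ⟨n, rfl⟩ : ∃ k, n = k + 2 := ⟨n - 2, by omega⟩
  have ⟨k0, k1, k2, k11, k3, k21, k111⟩ :
      OneOneRowC (functionals .C (n + 2)) (rowOf .C (n + 2) 1) := by
    simpa [rowOf, rowShape] using oneOneRowC n
  fin_cases j
  · refine (entry_eq .C (by simp) _ 1 0 hj k3).trans ?_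
    simp [tableC]
  · refine (entry_eq .C (by simp) _ 1 1 hj k21).trans ?_
    simp [tableC]
  · refine (entry_eq .C (by simp) _ 1 2 hj k111).trans ?_
    simp [tableC]
  · refine (entry_eq .C (by simp) _ 1 3 hj k2).trans ?_
    simp [tableC]
  · refine (entry_eq .C (by simp) _ 1 4 hj k11).trans ?_
    simp [tableC]
  · refine (entry_eq .C (by simp) _ 1 5 hj k1).trans ?_
    simp [tableC]
  · refine (entry_eq .C (by simp) _ 1 6 hj k0).trans ?_
    simp [tableC]

theorem entry_C_one (n : ℕ) (j : Fin 7) (hn : 1 ≤ n) (hj : (colShape j).length ≤ n) :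
    entry .C n (colShape j) (rowShape 2) = tableC n 2 j := by
  obtain ⟨n, rfl⟩ : ∃ k, n = k + 1 := ⟨n - 1, by omega⟩
  have hq := q_ne_zero
  have hq1 := q_sub_one_ne_zero
  have hq2 := q_sq_sub_one_ne_zero
  have ⟨k0, k1, k2, k11, k3, k21, k111⟩ :
      OneRowC (functionals .C (n + 1)) (rowOf .C (n + 1) 2) := by
    simpa [rowOf, rowShape] using oneRowC n
  fin_cases j
  · refine (entry_eq_div .C (by simp) _ 2 0 hj k3 (by simpa using hq2)).trans ?_
    simp [tableC]
    field_simp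
  · obtain ⟨n, rfl⟩ : ∃ k, n = k + 1 := ⟨n - 1, by simp [colShape] at hj; omega⟩
    refine (entry_eq_div .C (by simp) _ 2 1 hj k21 (by simpa using ⟨hq, hq2⟩)).trans ?_
    have e : 2 * (n + 1 + 1) - 2 = 2 * n + 2 := by omega
    simp [tableC, e]
    field_simp
    ring
  · obtain ⟨n, rfl⟩ : ∃ k, n = k + 2 := ⟨n - 2, by simp [colShape] at hj; omega⟩
    refine (entry_eq_div .C (by simp) _ 2 2 hj k111 (by simpa using ⟨hq, hq2⟩)).trans ?_
    have e : 2 * (n + 1 + 2) - 4 = 2 * n + 2 := by omega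
    simp [tableC, e]
    field_simp
    ring
  · refine (entry_eq .C (by simp) _ 2 3 hj k2).trans ?_
    simp [tableC]
  · refine (entry_eq .C (by simp) _ 2 4 hj k11).trans ?_
    simp [tableC]
  · refine (entry_eq .C (by simp) _ 2 5 hj k1).trans ?_
    simp [tableC]
  · refine (entry_eq .C (by simp) _ 2 6 hj k0).trans ?_
    simp [tableC]

theorem entry_C_null (n : ℕ) (j : Fin 7) (hj : (colShape j).length ≤ n) :
    entry .C n (colShape j) (rowShape 3) = tableC n 3 j := by
  have hq2 := q_sq_sub_one_ne_zero
  have ⟨k0, k1, k2, k11, k3, k21, k111⟩ :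
      NullRowC (functionals .C n) (rowOf .C n 3) := by
    simpa [rowOf, rowShape] using nullRowC n
  fin_cases j
  · refine (entry_eq .C (by simp) _ 3 0 hj k3).trans ?_
    simp [tableC]
  · refine (entry_eq .C (by simp) _ 3 1 hj k21).trans ?_
    simp [tableC]
  · refine (entry_eq .C (by simp) _ 3 2 hj k111).trans ?_
    simp [tableC]
  · refine (entry_eq_div .C (by simp) _ 3 3 hj k2 (by simpa using hq2)).trans ?_
    simp [tableC]
    field_simp
  · obtain ⟨n, rfl⟩ : ∃ k, n = k + 2 := ⟨n - 2, by simp [colShape] at hj; omega⟩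
    refine (entry_eq_div .C (by simp) _ 3 4 hj k11 (by simpa using hq2)).trans ?_
    have e : 2 * (n + 2) - 2 = 2 * n + 2 := by omega
    simp [tableC, e]
    field_simp
    ring
  · refine (entry_eq .C (by simp) _ 3 5 hj k1).trans ?_
    simp [tableC]
  · refine (entry_eq .C (by simp) _ 3 6 hj k0).trans ?_
    simp [tableC]

theorem entry_D_two_of_lt (n : ℕ) (j : Fin 7) (hn : 2 ≤ n) (hj : (colShape j).length < n) :
    entry .D n (colShape j) (rowShape 0) = tableD n 0 j := by
  obtain ⟨n, rfl⟩ : ∃ k, n = k + 2 := ⟨n - 2, by omega⟩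
  have ⟨k0, k1, k2, k11, k3, k21, k111⟩ :
      TwoRowD (functionals .D (n + 2)) (rowOf .D (n + 2) 0) := by
    simpa [rowOf, rowShape] using twoRowD (n + 1)
  fin_cases j
  · refine (entry_D_eq _ 0 0 hj (A := 0) (k3.trans (by simp))).trans ?_
    simp [tableD]
  · refine (entry_D_eq _ 0 1 hj (A := 0) (k21.trans (by simp))).trans ?_
    simp [tableD]
  · refine (entry_D_eq _ 0 2 hj (A := 0) (k111.trans (by simp))).trans ?_
    simp [tableD]
  · refine (entry_D_eq _ 0 3 hj (A := 1) (k2.trans (by simp))).trans ?_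
    simp [tableD]
  · refine (entry_D_eq _ 0 4 hj (A := 0) (k11.trans (by simp))).trans ?_
    simp [tableD]
  · refine (entry_D_eq _ 0 5 hj (A := 0) (k1.trans (by simp))).trans ?_
    simp [tableD]
  · refine (entry_D_eq _ 0 6 hj (A := 0) (k0.trans (by simp))).trans ?_
    simp [tableD]

theorem entry_D_one_one_of_lt (n : ℕ) (j : Fin 7) (hn : 2 ≤ n) (hj : (colShape j).length < n) :
    entry .D n (colShape j) (rowShape 1) = tableD n 1 j := by
  obtain ⟨n, rfl⟩ : ∃ k, n = k + 2 := ⟨n - 2, by omega⟩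
  have ⟨k0, k1, k2, k11, k3, k21, k111⟩ :
      OneOneRowD (functionals .D (n + 2)) (rowOf .D (n + 2) 1) := by
    simpa [rowOf, rowShape] using oneOneRowD n
  fin_cases j
  · refine (entry_D_eq _ 1 0 hj (A := 0) (k3.trans (by simp))).trans ?_
    simp [tableD]
  · refine (entry_D_eq _ 1 1 hj (A := 0) (k21.trans (by simp))).trans ?_
    simp [tableD]
  · refine (entry_D_eq _ 1 2 hj (A := 0) (k111.trans (by simp))).trans ?_
    simp [tableD]
  · refine (entry_D_eq _ 1 3 hj (A := X) (k2.trans (by simp))).trans ?_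
    simp [tableD]
  · refine (entry_D_eq _ 1 4 hj (A := 1) (k11.trans (by simp))).trans ?_
    simp [tableD]
  · refine (entry_D_eq _ 1 5 hj (A := 0) (k1.trans (by simp))).trans ?_
    simp [tableD]
  · refine (entry_D_eq _ 1 6 hj (A := 0) (k0.trans (by simp))).trans ?_
    simp [tableD]

theorem entry_D_one_of_lt (n : ℕ) (j : Fin 7) (hn : 2 ≤ n) (hj : (colShape j).length < n) :
    entry .D n (colShape j) (rowShape 2) = tableD n 2 j := by
  obtain ⟨n, rfl⟩ : ∃ k, n = k + 2 := ⟨n - 2, by omega⟩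
  have hq := q_ne_zero
  have hq1 := q_sub_one_ne_zero
  have hq2 := q_sq_sub_one_ne_zero
  have ⟨k0, k1, k2, k11, k3, k21, k111⟩ :
      OneRowD (functionals .D (n + 2)) (rowOf .D (n + 2) 2) := by
    simpa [rowOf, rowShape] using oneRowD (n + 1)
  fin_cases j
  · refine (entry_D_eq_div _ 2 0 hj k3 (by simpa using hq2)).trans ?_
    have e : 2 * (n + 2) - 2 = 2 * n + 2 := by omega
    simp [tableD, e]
    field_simp
    ring
  · obtain ⟨n, rfl⟩ : ∃ k, n = k + 1 := ⟨n - 1, by simp [colShape] at hj; omega⟩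
    refine (entry_D_eq_div _ 2 1 hj k21 (by simpa using ⟨hq, hq2⟩)).trans ?_
    have e : 2 * (n + 2 + 1) - 3 = 2 * n + 3 := by omega
    simp [tableD, e]
    field_simp
    ring
  · obtain ⟨n, rfl⟩ : ∃ k, n = k + 2 := ⟨n - 2, by simp [colShape] at hj; omega⟩
    refine (entry_D_eq_div _ 2 2 hj k111 (by simpa using ⟨hq, hq2⟩)).trans ?_
    have e : 2 * (n + 2 + 2) - 4 = 2 * n + 4 := by omega
    simp [tableD, e]
    field_simp
    ring
  · refine (entry_D_eq _ 2 3 hj (A := 0) (k2.trans (by simp))).trans ?_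
    simp [tableD]
  · refine (entry_D_eq _ 2 4 hj (A := 0) (k11.trans (by simp))).trans ?_
    simp [tableD]
  · refine (entry_D_eq _ 2 5 hj (A := 1) (k1.trans (by simp))).trans ?_
    simp [tableD]
  · refine (entry_D_eq _ 2 6 hj (A := 0) (k0.trans (by simp))).trans ?_
    simp [tableD]

theorem entry_D_null_of_lt (n : ℕ) (j : Fin 7) (hn : 2 ≤ n) (hj : (colShape j).length < n) :
    entry .D n (colShape j) (rowShape 3) = tableD n 3 j := by
  obtain ⟨n, rfl⟩ : ∃ k, n = k + 2 := ⟨n - 2, by omega⟩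
  have hq := q_ne_zero
  have hq2 := q_sq_sub_one_ne_zero
  have ⟨k0, k1, k2, k11, k3, k21, k111⟩ :
      NullRowD (functionals .D (n + 2)) (rowOf .D (n + 2) 3) := by
    simpa [rowOf, rowShape] using nullRowD (n + 1)
  fin_cases j
  · refine (entry_D_eq _ 3 0 hj (A := 0) (k3.trans (by simp))).trans ?_
    simp [tableD]
  · refine (entry_D_eq _ 3 1 hj (A := 0) (k21.trans (by simp))).trans ?_
    simp [tableD]
  · refine (entry_D_eq _ 3 2 hj (A := 0) (k111.trans (by simp))).trans ?_
    simp [tableD]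
  · refine (entry_D_eq_div _ 3 3 hj k2 (by simpa using hq2)).trans ?_
    have e : 2 * (n + 2) - 2 = 2 * n + 2 := by omega
    simp [tableD, e]
    field_simp
    ring
  · obtain ⟨n, rfl⟩ : ∃ k, n = k + 1 := ⟨n - 1, by simp [colShape] at hj; omega⟩
    refine (entry_D_eq_div _ 3 4 hj k11 (by simpa using ⟨hq, hq2⟩)).trans ?_
    have e : 2 * (n + 2 + 1) - 2 = 2 * n + 4 := by omega
    simp [tableD, e]
    field_simp
    ring
  · refine (entry_D_eq _ 3 5 hj (A := 0) (k1.trans (by simp))).trans ?_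
    simp [tableD]
  · refine (entry_D_eq _ 3 6 hj (A := 1) (k0.trans (by simp))).trans ?_
    simp [tableD]

theorem entry_D_zero_of_length_eq (n : ℕ) (hn : 2 ≤ n) (i : Fin 4) (j : Fin 7)
    (hi : (rowShape i).length < n) (hj : (colShape j).length = n)
    (h : (functionals .D n).col j (rowOf .D n i) = 0) :
    entry .D n (colShape j) (rowShape i) = 0 := by
  rw [entry_D_eq_of_length_eq n hn i j hi hj (A := 0) (h.trans (by simp)), map_zero]

/-- The even and the odd alternant both contribute: `4 K = 2 + 2`. -/
theorem entry_D_one_one_one_one :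
    entry .D 2 (colShape 4) (rowShape 1) = 1 := by
  have h := four_mul_kostkaFoulkes_of_eq 2 le_rfl 1 4 rfl
  have k : (functionals .D 2).col 4 (rowOf .D 2 1) = 2 := by
    simpa [rowOf, rowShape, Functionals.col] using (oneOneRowD 0).k11
  rw [k, weightOf_add_rho .D 2 _ (colShape_length 4), weightOf_add_rho .D 2 _ (by simp [rowShape])]
    at h
  simp only [colShape, rowShape] at h
  simp [twiceShift, kfSum_D_one_one] at h
  rw [entry, ← map_one (algebraMap ℤ[X] (RatFunc ℤ))]
  congr 1
  refine mul_left_cancel₀ (show (4 : ℤ[X]) ≠ 0 by norm_num) (Eq.trans h ?_)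
  norm_num

theorem entry_D_two_one_one_one :
    entry .D 2 (colShape 1) (rowShape 1) = 0 := by
  have h := four_mul_kostkaFoulkes_of_eq 2 le_rfl 1 1 rfl
  have k : (functionals .D 2).col 1 (rowOf .D 2 1) = 0 := by
    simpa [rowOf, rowShape, Functionals.col] using (oneOneRowD 0).k21
  rw [k, weightOf_add_rho .D 2 _ (colShape_length 1), weightOf_add_rho .D 2 _ (by simp [rowShape])]
    at h
  simp only [colShape, rowShape] at h
  simp [twiceShift, kfSum_D_two_one] at h
  rw [entry, ← map_zero (algebraMap ℤ[X] (RatFunc ℤ))]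
  congr 1

theorem col_of_length_eq {n : ℕ} (hn : 2 ≤ n) {j : Fin 7} (hj : (colShape j).length = n) :
    -- The columns of full length are `(2, 1)` and `(1, 1)` in rank two, and `(1, 1, 1)` in rank
    -- three.
    n = 2 ∧ j = 1 ∨ n = 2 ∧ j = 4 ∨ n = 3 ∧ j = 2 := by
  fin_cases j <;> simp [colShape] at hj ⊢ <;> omega

theorem entry_D_of_length_eq (n : ℕ) (hn : 2 ≤ n) (i : Fin 4) (j : Fin 7)
    (hj : (colShape j).length = n)
    (hs : (colShape j).sum ≠ (rowShape i).sum + 2) :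
    entry .D n (colShape j) (rowShape i) = tableD n i j := by
  rcases col_of_length_eq hn hj with ⟨rfl, rfl⟩ | ⟨rfl, rfl⟩ | ⟨rfl, rfl⟩
  · fin_cases i
    · refine (entry_D_zero_of_length_eq 2 hn 0 1 (by simp [rowShape]) hj ?_).trans ?_
      · simpa [rowOf, rowShape, Functionals.col] using (twoRowD 1).k21
      · simp [tableD]
    · refine entry_D_two_one_one_one.trans ?_
      simp [tableD]
    · simp [rowShape, colShape] at hs
    · refine (entry_D_zero_of_length_eq 2 hn 3 1 (by simp [rowShape]) hj ?_).trans ?_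
      · simpa [rowOf, rowShape, Functionals.col] using (nullRowD 1).k21
      · simp [tableD]
  · fin_cases i
    · refine (entry_D_zero_of_length_eq 2 hn 0 4 (by simp [rowShape]) hj ?_).trans ?_
      · simpa [rowOf, rowShape, Functionals.col] using (twoRowD 1).k11
      · simp [tableD]
    · refine entry_D_one_one_one_one.trans ?_
      simp [tableD]
    · refine (entry_D_zero_of_length_eq 2 hn 2 4 (by simp [rowShape]) hj ?_).trans ?_
      · simpa [rowOf, rowShape, Functionals.col] using (oneRowD 1).k11
      · simp [tableD]
    · simp [rowShape, colShape] at hs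
  · fin_cases i
    · refine (entry_D_zero_of_length_eq 3 hn 0 2 (by simp [rowShape]) hj ?_).trans ?_
      · simpa [rowOf, rowShape, Functionals.col] using (twoRowD 2).k111
      · simp [tableD]
    · refine (entry_D_zero_of_length_eq 3 hn 1 2 (by simp [rowShape]) hj ?_).trans ?_
      · simpa [rowOf, rowShape, Functionals.col] using (oneOneRowD 1).k111
      · simp [tableD]
    · simp [rowShape, colShape] at hs
    · refine (entry_D_zero_of_length_eq 3 hn 3 2 (by simp [rowShape]) hj ?_).trans ?_
      · simpa [rowOf, rowShape, Functionals.col] using (nullRowD 2).k111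
      · simp [tableD]

/-- In the three cases the closed form of the functional specializes to `4 q`, and it equals `4 K`
because `mu` has fewer than `n` parts. -/
theorem entry_D_exceptional (n : ℕ) (hn : 2 ≤ n) (i : Fin 4) (j : Fin 7)
    (hj : (colShape j).length = n)
    (hs : (colShape j).sum = (rowShape i).sum + 2) :
    entry .D n (colShape j) (rowShape i) = q := by
  have hX : (X : ℤ[X]) ≠ 0 := X_ne_zero
  have hX2 : (X ^ 2 - 1 : ℤ[X]) ≠ 0 := X_pow_sub_C_ne_zero two_pos 1
  rw [q, ← RatFunc.algebraMap_X]
  rcases col_of_length_eq hn hj with ⟨rfl, rfl⟩ | ⟨rfl, rfl⟩ | ⟨rfl, rfl⟩ <;> fin_cases i <;>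
    simp [rowShape, colShape] at hs
  · refine entry_D_eq_of_length_eq 2 hn 2 1 (by simp [rowShape]) hj ?_
    have k := (oneRowD 1).k21
    refine mul_left_cancel₀ (mul_ne_zero (pow_ne_zero 2 hX) hX2) (Eq.trans ?_ (k.trans ?_))
    · simp [rowOf, rowShape, Functionals.col]
    · ring
  · refine entry_D_eq_of_length_eq 2 hn 3 4 (by simp [rowShape]) hj ?_
    have k := (nullRowD 1).k11
    refine mul_left_cancel₀ (mul_ne_zero hX hX2) (Eq.trans ?_ (k.trans ?_))
    · simp [rowOf, rowShape, Functionals.col]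
    · ring
  · refine entry_D_eq_of_length_eq 3 hn 2 2 (by simp [rowShape]) hj ?_
    have k := (oneRowD 2).k111
    refine mul_left_cancel₀ (mul_ne_zero (pow_ne_zero 3 hX) hX2) (Eq.trans ?_ (k.trans ?_))
    · simp [rowOf, rowShape, Functionals.col]
    · ring

end Tables

end KostkaFoulkes

theorem mainTheorem7 (n : ℕ) :
    (∀ (i : Fin 4) (j : Fin 7),
      (KostkaFoulkes.rowShape i).length ≤ n → (KostkaFoulkes.colShape j).length ≤ n →
        KostkaFoulkes.entry .B n (KostkaFoulkes.colShape j) (KostkaFoulkes.rowShape i) =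
          KostkaFoulkes.tableB n i j) ∧
    (∀ (i : Fin 4) (j : Fin 7),
      (KostkaFoulkes.rowShape i).length ≤ n → (KostkaFoulkes.colShape j).length ≤ n →
        KostkaFoulkes.entry .C n (KostkaFoulkes.colShape j) (KostkaFoulkes.rowShape i) =
          KostkaFoulkes.tableC n i j) ∧
    (2 ≤ n → ∀ (i : Fin 4) (j : Fin 7),
      (KostkaFoulkes.rowShape i).length ≤ n → (KostkaFoulkes.colShape j).length ≤ n →
        (¬ ((KostkaFoulkes.colShape j).length = n ∧
            (KostkaFoulkes.colShape j).sum = (KostkaFoulkes.rowShape i).sum + 2) →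
          KostkaFoulkes.entry .D n (KostkaFoulkes.colShape j) (KostkaFoulkes.rowShape i) =
            KostkaFoulkes.tableD n i j) ∧
        ((KostkaFoulkes.colShape j).length = n ∧
            (KostkaFoulkes.colShape j).sum = (KostkaFoulkes.rowShape i).sum + 2 →
          KostkaFoulkes.entry .D n (KostkaFoulkes.colShape j) (KostkaFoulkes.rowShape i) =
            KostkaFoulkes.q)) := by
  refine ⟨fun i j hi hj => ?_, fun i j hi hj => ?_, fun hn i j _ hj => ⟨fun h => ?_, fun h => ?_⟩⟩
  · fin_cases i
    · exact KostkaFoulkes.entry_B_two n j hi hj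
    · exact KostkaFoulkes.entry_B_one_one n j hi hj
    · exact KostkaFoulkes.entry_B_one n j hi hj
    · exact KostkaFoulkes.entry_B_null n j hj
  · fin_cases i
    · exact KostkaFoulkes.entry_C_two n j hi hj
    · exact KostkaFoulkes.entry_C_one_one n j hi hj
    · exact KostkaFoulkes.entry_C_one n j hi hj
    · exact KostkaFoulkes.entry_C_null n j hj
  · rcases hj.lt_or_eq with hj | hj
    · fin_cases i
      · exact KostkaFoulkes.entry_D_two_of_lt n j hn hj
      · exact KostkaFoulkes.entry_D_one_one_of_lt n j hn hj
      · exact KostkaFoulkes.entry_D_one_of_lt n j hn hj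
      · exact KostkaFoulkes.entry_D_null_of_lt n j hn hj
    · exact KostkaFoulkes.entry_D_of_length_eq n hn i j hj fun hs => h ⟨hj, hs⟩
  · exact KostkaFoulkes.entry_D_exceptional n hn i j h.1 h.2
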